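/- Let $\mathcal O=\mathbf C\{x_0,\dots,x_n\}$ ($n\ge 0$) and let $f\in\mathcal O$, $f(0)=0$, have an isolated singularity at $0$ (that is, $f$ has no critical point other than $0$ near $0$). Let $F\in\mathbf C\{x_0,\dots,x_n,s_1,\dots,s_m\}$ be a deformation of $f$: $F|_{\mathbf s=0}=f$. Let $\Omega^p$ be the module of germs of holomorphic $p$-forms in $x$, i.e. the free $\mathcal O$-module on the forms $dx_{i_1}\wedge\dots\wedge dx_{i_p}$, and let $d$ denote the differential relative to the parameters $\mathbf s$. Define the formal Gauss-Manin system and Brieskorn lattice of $f$ by $$\widehat G_f=H^{n+1}\bigl(\Omega^{\bullet}((u)),\,u\,d-df\wedge\bigr),\qquad \widehat H''_f=H^{n+1}\bigl(\Omega^{\bullet}[[u]],\,u\,d-df\wedge\bigr),$$ and the bi-formal Gauss-Manin system and Brieskorn lattice of $F$ by $$\widehat G_{F,\widehat S}=H^{n+1}\bigl(\Omega^{\bullet}((u))[[\mathbf s]],\,u\,d-dF\wedge\bigr),\qquad \widehat H''_{F,\widehat S}=H^{n+1}\bigl(\Omega^{\bullet}[[u]][[\mathbf s]],\,u\,d-dF\wedge\bigr).$$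 Here $u=\partial_t^{-1}$; on $\widehat G_f$ the action of $t$ is induced by $f+u^2\partial/\partial u$, and on $\widehat G_{F,\widehat S}$ the actions of $t$ and $\partial_{s_i}$ are induced by $F+u^2\partial/\partial u$ and $\partial/\partial s_i-(\partial F/\partial s_i)\,u^{-1}$. Put $\Omega_f=\widehat H''_f/\partial_t^{-1}\widehat H''_f$ and $\Omega_{F,\widehat S}=\widehat H''_{F,\widehat S}/\partial_t^{-1}\widehat H''_{F,\widehat S}$; setting $\mathbf s=0$ defines restriction maps $\widehat H''_{F,\widehat S}\to\widehat H''_f$ and $\Omega_{F,\widehat S}\to\Omega_f$. A $\mathbf C$-linear section $\widehat\sigma_0$ of the projection $\widehat H''_f\to\Omega_f$ is called good if its image $I_0$ satisfies, in $\widehat G_f$, $$tI_0\subset I_0+\partial_t^{-1}I_0 .$$ A $\mathbf C[[\mathbf s]]$-linear section $\widehat\sigma_{\widehat S}$ of the projection $\widehat H''_{F,\widehat S}\to\Omega_{F,\widehat S}$ is called good if its image $I_{\widehat S}$ satisfies, in $\widehat G_{F,\widehat S}$, $$tI_{\widehat S}\subset I_{\widehat S}+\partial_t^{-1}I_{\widehat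 S},\qquad \partial_{s_i}I_{\widehat S}\subset I_{\widehat S}+\partial_tI_{\widehat S}\quad(1\le i\le m).$$ Theorem. For every good section $\widehat\sigma_0$ of $\widehat H''_f\to\Omega_f$ there is exactly one good section $\widehat\sigma_{\widehat S}$ of $\widehat H''_{F,\widehat S}\to\Omega_{F,\widehat S}$ that extends $\widehat\sigma_0$, i.e. such that the restriction to $\mathbf s=0$ of $\widehat\sigma_{\widehat S}(w)$ is $\widehat\sigma_0$ of the restriction of $w$, for all $w\in\Omega_{F,\widehat S}$. -/

import Mathlib

noncomputable section

namespace FormalBrieskorn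

/-! ### Convergent power series -/

/-- The convergent power series in the variables `y i`, `i : σ`, as a subalgebra of the formal power
series: the series that converge absolutely on some polydisc around the origin. -/
def convSubalgebra (σ : Type) : Subalgebra ℂ (MvPowerSeries σ ℂ) where
  carrier := {g | ∃ r : ℝ, 0 < r ∧
    Summable fun ν : σ →₀ ℕ => ‖MvPowerSeries.coeff ν g‖ * r ^ ν.degree}
  mul_mem' := by
    classical
    rintro a b ⟨r, hr, ha⟩ ⟨s, hs, hb⟩
    have key : ∀ (g : MvPowerSeries σ ℂ) (q p : ℝ), 0 < p → p ≤ q →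
        (Summable fun ν : σ →₀ ℕ => ‖MvPowerSeries.coeff ν g‖ * q ^ ν.degree) →
        Summable fun ν : σ →₀ ℕ => ‖MvPowerSeries.coeff ν g‖ * p ^ ν.degree := by
      intro g q p hp hpq h
      refine h.of_nonneg_of_le (fun ν => by positivity) fun ν => ?_
      gcongr
    have hp : 0 < min r s := lt_min hr hs
    have h := summable_sum_mul_antidiagonal_of_summable_mul
      (Summable.mul_of_nonneg (key a r _ hp (min_le_left _ _) ha)
        (key b s _ hp (min_le_right _ _) hb)
        (fun ν => by positivity) (fun ν => by positivity))
    refine ⟨min r s, hp, h.of_nonneg_of_le (fun ν => by positivity) fun ν => ?_⟩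
    rw [MvPowerSeries.coeff_mul]
    refine (mul_le_mul_of_nonneg_right (norm_sum_le _ _) (by positivity)).trans ?_
    rw [Finset.sum_mul]
    refine Finset.sum_le_sum fun x hx => ?_
    replace hx : x.1 + x.2 = ν := Finset.HasAntidiagonal.mem_antidiagonal.mp hx
    rw [norm_mul, ← hx, map_add, pow_add]
    exact le_of_eq (by ring)
  add_mem' := by
    rintro a b ⟨r, hr, ha⟩ ⟨s, hs, hb⟩
    have key : ∀ (g : MvPowerSeries σ ℂ) (q p : ℝ), 0 < p → p ≤ q →
        (Summable fun ν : σ →₀ ℕ => ‖MvPowerSeries.coeff ν g‖ * q ^ ν.degree) →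
        Summable fun ν : σ →₀ ℕ => ‖MvPowerSeries.coeff ν g‖ * p ^ ν.degree := by
      intro g q p hp hpq h
      refine h.of_nonneg_of_le (fun ν => by positivity) fun ν => ?_
      gcongr
    have hp : 0 < min r s := lt_min hr hs
    refine ⟨min r s, hp, ((key a r _ hp (min_le_left _ _) ha).add
      (key b s _ hp (min_le_right _ _) hb)).of_nonneg_of_le (fun ν => by positivity) fun ν => ?_⟩
    rw [map_add, ← add_mul]
    gcongr
    exact norm_add_le _ _
  algebraMap_mem' := by
    classical
    intro c
    refine ⟨1, one_pos, summable_of_ne_finset_zero (s := {0}) fun ν hν => ?_⟩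
    have : ν ≠ 0 := by simpa using hν
    simp [MvPowerSeries.algebraMap_apply, MvPowerSeries.coeff_C, this]

/-- The ring `ℂ{y}` of convergent power series in the variables `y i`, `i : σ`. -/
def ConvSeries (σ : Type) : Type := convSubalgebra σ

instance (σ : Type) : CommRing (ConvSeries σ) := inferInstanceAs (CommRing (convSubalgebra σ))

instance (σ : Type) : Algebra ℂ (ConvSeries σ) := inferInstanceAs (Algebra ℂ (convSubalgebra σ))

/-- The inclusion `ℂ{y} → ℂ[[y]]`. -/
def toSeries (σ : Type) : ConvSeries σ →ₐ[ℂ] MvPowerSeries σ ℂ := (convSubalgebra σ).val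

/-- The value at the point `z` (near the origin) of a convergent power series. -/
def evalAt {σ : Type} (g : ConvSeries σ) (z : σ → ℂ) : ℂ :=
  ∑' ν : σ →₀ ℕ, MvPowerSeries.coeff ν (toSeries σ g) * ν.prod fun i k => z i ^ k

theorem pderiv_mem {σ : Type} (i : σ) {g : MvPowerSeries σ ℂ} (hg : g ∈ convSubalgebra σ) :
    MvPowerSeries.pderiv ℂ i g ∈ convSubalgebra σ := by
  classical
  obtain ⟨r, hr, h⟩ := hg
  have h1 := (h.comp_injective (add_left_injective (Finsupp.single i 1))).mul_right (r⁻¹)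
  refine ⟨r / 2, by positivity, h1.of_nonneg_of_le (fun ν => by positivity) fun ν => ?_⟩
  rw [MvPowerSeries.coeff_pderiv, norm_mul]
  simp only [Function.comp_apply, map_add, Finsupp.degree_single, pow_add, pow_one]
  have h2 : ‖((ν i : ℂ) + 1)‖ ≤ 2 ^ ν.degree := by
    have h3 : ν i + 1 ≤ 2 ^ ν.degree :=
      (Nat.succ_le_succ (Finsupp.le_degree i ν)).trans (Nat.lt_two_pow_self)
    have h4 : ‖((ν i : ℂ) + 1)‖ = ((ν i + 1 : ℕ) : ℝ) := by
      rw [← Complex.norm_natCast]; push_cast; rfl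
    rw [h4]
    exact_mod_cast h3
  have h5 : (2 : ℝ) ^ ν.degree * (r / 2) ^ ν.degree = r ^ ν.degree := by
    rw [← mul_pow]; congr 1; ring
  calc _ ≤ ‖MvPowerSeries.coeff (ν + Finsupp.single i 1) g‖ * 2 ^ ν.degree
        * (r / 2) ^ ν.degree := by gcongr
    _ = ‖MvPowerSeries.coeff (ν + Finsupp.single i 1) g‖ * r ^ ν.degree := by
        rw [mul_assoc, h5]
    _ = _ := by field_simp

/-- The partial derivative `∂/∂yᵢ` on `ℂ{y}`. -/
def partialX {σ : Type} (i : σ) : ConvSeries σ →ₗ[ℂ] ConvSeries σ :=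
  (MvPowerSeries.pderiv ℂ i).toLinearMap.restrict (p := Subalgebra.toSubmodule (convSubalgebra σ))
    (q := Subalgebra.toSubmodule (convSubalgebra σ)) fun _ hg => pderiv_mem i hg

theorem toSeries_partialX {σ : Type} (i : σ) (a : ConvSeries σ) :
    toSeries σ (partialX i a) = MvPowerSeries.pderiv ℂ i (toSeries σ a) := rfl

theorem toSeries_injective (σ : Type) : Function.Injective (toSeries σ) := Subtype.val_injective

theorem partialX_mul {σ : Type} (i : σ) (a b : ConvSeries σ) :
    partialX i (a * b) = partialX i a * b + a * partialX i b := by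
  apply toSeries_injective
  simp only [toSeries_partialX, map_mul, map_add, Derivation.leibniz, smul_eq_mul]
  ring

/-- `f` vanishes at the origin, and the origin is an isolated singularity of `f`: near the origin
there is no critical point of `f` other than the origin. -/
def IsolatedSingularity {n : ℕ} (f : ConvSeries (Fin (n + 1))) : Prop :=
  evalAt f 0 = 0 ∧
  ∃ r : ℝ, 0 < r ∧ ∀ z : Fin (n + 1) → ℂ, (∀ i, ‖z i‖ < r) →
    (∀ i, evalAt (partialX i f) z = 0) → z = 0

/-- For `F ∈ ℂ{x, s}`, the same series as an element of `ℂ{x}[[s]]`: the coefficient of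
`x ^ α` in the coefficient of `s ^ β` is the coefficient of `x ^ α s ^ β` in `F`. -/
def expand {n m : ℕ} (F : ConvSeries (Fin (n + 1) ⊕ Fin m)) :
    MvPowerSeries (Fin m) (ConvSeries (Fin (n + 1))) := fun β =>
  (⟨fun α => MvPowerSeries.coeff (α.sumElim β) (toSeries _ F), by
    obtain ⟨r, hr, h⟩ := F.2
    have inj : Function.Injective fun α : Fin (n + 1) →₀ ℕ => α.sumElim β := by
      intro a b hab
      ext i
      simpa using DFunLike.congr_fun hab (Sum.inl i)
    have hdeg : ∀ α : Fin (n + 1) →₀ ℕ, (α.sumElim β).degree = α.degree + β.degree := by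
      intro α
      simp [Finsupp.degree_eq_sum]
    refine ⟨r, hr, ((h.comp_injective inj).mul_right ((r ^ β.degree)⁻¹)).congr fun α => ?_⟩
    simp only [Function.comp_apply, hdeg, pow_add]
    rw [← mul_assoc, mul_assoc, mul_inv_cancel₀ (by positivity), mul_one]
    rfl⟩ : convSubalgebra (Fin (n + 1)))

/-! ### Complexes of differential forms and their top cohomology -/

/-- Forms `∑ ω_J dx_J` of degree `p` in the `N` variables `x`, with coefficients in `R`. The form
is given by its coefficients `ω_J`, for the `p`-element sets `J` of indices. -/
abbrev Form (N p : ℕ) (R : Type) : Type := {J : Finset (Fin N) // J.card = p} → R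

section Complex

variable {A R R' : Type} [CommRing A] [CommRing R] [Algebra A R] [CommRing R']
variable {N : ℕ}

/-- The differential `ω ↦ ∑ⱼ dxⱼ ∧ Pⱼ(ω)` for a family of operators `Pⱼ` on the coefficients.
The sign is that of sorting `j` into its place among the elements of `J`. -/
def diff (P : Fin N → R →ₗ[A] R) (p : ℕ) : Form N p R →ₗ[A] Form N (p + 1) R :=
  LinearMap.pi fun J => ∑ j : {j : Fin N // j ∈ J.1},
    ((-1 : ℤ) ^ (J.1.filter (· < j.1)).card) •
      (P j.1).comp (LinearMap.proj (R := A) (φ := fun _ => R)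
        (⟨J.1.erase j.1, by rw [Finset.card_erase_of_mem j.2, J.2]; rfl⟩ :
          {J : Finset (Fin N) // J.card = p}))

/-- The cohomology in the top degree `n + 1` of the complex of forms in `n + 1` variables with
the differential `diff P`. (There are no forms of degree `n + 2`.) -/
abbrev TopCoh {n : ℕ} (P : Fin (n + 1) → R →ₗ[A] R) : Type :=
  Form (n + 1) (n + 1) R ⧸ LinearMap.range (diff P n)

/-- Applying an additive map to all the coefficients of a form. -/
def Form.map {p : ℕ} (T : R →+ R') : Form N p R →+ Form N p R' where
  toFun ω := fun J => T (ω J)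
  map_zero' := funext fun _ => map_zero T
  map_add' _ _ := funext fun _ => map_add T _ _

theorem Form.map_diff {B : Type} [CommRing B] [Algebra B R']
    {P : Fin N → R →ₗ[A] R} {P' : Fin N → R' →ₗ[B] R'} (T T' : R →+ R')
    (h : ∀ j x, T (P j x) = P' j (T' x)) {p : ℕ} (ω : Form N p R) :
    Form.map T (diff P p ω) = diff P' p (Form.map T' ω) := by
  funext J
  simp only [Form.map, diff, AddMonoidHom.coe_mk, ZeroHom.coe_mk, LinearMap.pi_apply,
    LinearMap.sum_apply, map_sum, LinearMap.smul_apply, LinearMap.comp_apply, LinearMap.proj_apply,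
    map_zsmul, h]

/-- The additive map induced on top cohomology by an additive map of the coefficients that is
compatible with the operators which define the differentials. -/
def TopCoh.map {n : ℕ} {B : Type} [CommRing B] [Algebra B R']
    {P : Fin (n + 1) → R →ₗ[A] R} {P' : Fin (n + 1) → R' →ₗ[B] R'} (T T' : R →+ R')
    (h : ∀ j x, T (P j x) = P' j (T' x)) : TopCoh P →+ TopCoh P' :=
  QuotientAddGroup.map (LinearMap.range (diff P n)).toAddSubgroup
    (LinearMap.range (diff P' n)).toAddSubgroup (Form.map T) <| by
    rintro _ ⟨ω, rfl⟩
    exact ⟨Form.map T' ω, (Form.map_diff T T' h ω).symm⟩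

/-- The same for a linear map of the coefficients. -/
def TopCoh.mapₗ {n : ℕ} [Algebra A R'] {P : Fin (n + 1) → R →ₗ[A] R} {P' : Fin (n + 1) → R' →ₗ[A] R'}
    (T : R →ₗ[A] R') (h : ∀ j x, T (P j x) = P' j (T x)) : TopCoh P →ₗ[A] TopCoh P' :=
  Submodule.mapQ _ _ (LinearMap.pi fun J => T.comp (LinearMap.proj J)) <| by
    rintro _ ⟨ω, rfl⟩
    exact ⟨Form.map T.toAddMonoidHom ω,
      (Form.map_diff T.toAddMonoidHom T.toAddMonoidHom h ω).symm⟩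

end Complex

/-! ### Series in `s` with coefficientwise operators -/

section Coeffwise

variable {m : ℕ} {K K' : Type} [CommRing K] [Algebra ℂ K] [CommRing K'] [Algebra ℂ K']

/-- A `ℂ`-linear map of the coefficients, applied to the coefficients of series in `s`. It is
linear over `ℂ[[s]]`. -/
def coeffwise (m : ℕ) (L : K →ₗ[ℂ] K') :
    MvPowerSeries (Fin m) K →ₗ[MvPowerSeries (Fin m) ℂ] MvPowerSeries (Fin m) K' where
  toFun g := fun ν => L (MvPowerSeries.coeff ν g)
  map_add' a b := funext fun ν => map_add L _ _
  map_smul' c g := by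
    classical
    ext ν
    change L (MvPowerSeries.coeff ν (c • g)) = MvPowerSeries.coeff ν (c •
      (show MvPowerSeries (Fin m) K' from fun ν => L (MvPowerSeries.coeff ν g)))
    rw [Algebra.smul_def, Algebra.smul_def, MvPowerSeries.algebraMap_apply'',
      MvPowerSeries.algebraMap_apply'', MvPowerSeries.coeff_mul, MvPowerSeries.coeff_mul, map_sum]
    refine Finset.sum_congr rfl fun x _ => ?_
    rw [MvPowerSeries.coeff_map, MvPowerSeries.coeff_map, ← Algebra.smul_def, ← Algebra.smul_def,
      map_smul]
    rfl

theorem coeff_coeffwise (L : K →ₗ[ℂ] K') (g : MvPowerSeries (Fin m) K) (ν : Fin m →₀ ℕ) :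
    MvPowerSeries.coeff ν (coeffwise m L g) = L (MvPowerSeries.coeff ν g) := rfl

theorem coeffwise_C_mul (L : K →ₗ[ℂ] K) (c c' : K)
    (h : ∀ x, L (c * x) = c' * x + c * L x) (g : MvPowerSeries (Fin m) K) :
    coeffwise m L (MvPowerSeries.C c * g) =
      MvPowerSeries.C c' * g + MvPowerSeries.C c * coeffwise m L g := by
  ext ν
  simp [coeff_coeffwise, h, MvPowerSeries.coeff_C_mul]

theorem coeffwise_map_mul {O : Type} [CommRing O] [Algebra ℂ O] (κ : O →+* K) (δ : O →ₗ[ℂ] O)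
    (L : K →ₗ[ℂ] K) (h : ∀ a x, L (κ a * x) = κ (δ a) * x + κ a * L x)
    (F : MvPowerSeries (Fin m) O) (g : MvPowerSeries (Fin m) K) :
    coeffwise m L (MvPowerSeries.map κ F * g) =
      MvPowerSeries.map κ (coeffwise m δ F) * g + MvPowerSeries.map κ F * coeffwise m L g := by
  classical
  ext ν
  simp only [coeff_coeffwise, MvPowerSeries.coeff_mul, map_add, map_sum, MvPowerSeries.coeff_map,
    h, Finset.sum_add_distrib]

theorem pderiv_coeffwise (i : Fin m) (L : K →ₗ[ℂ] K') (g : MvPowerSeries (Fin m) K) :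
    MvPowerSeries.pderiv K' i (coeffwise m L g) = coeffwise m L (MvPowerSeries.pderiv K i g) := by
  ext ν
  simp only [coeff_coeffwise, MvPowerSeries.coeff_pderiv]
  have h : ∀ (k : ℕ) (x : K), L (x * ((k : K) + 1)) = L x * ((k : K') + 1) := by
    intro k x
    have := map_nsmul L (k + 1) x
    rw [nsmul_eq_mul, nsmul_eq_mul] at this
    push_cast at this
    rw [mul_comm x, this, mul_comm]
  exact (h _ _).symm

end Coeffwise

theorem pderiv_map {m : ℕ} {O K : Type} [CommRing O] [CommRing K] (κ : O →+* K) (i : Fin m)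
    (F : MvPowerSeries (Fin m) O) :
    MvPowerSeries.pderiv K i (MvPowerSeries.map κ F) =
      MvPowerSeries.map κ (MvPowerSeries.pderiv O i F) := by
  ext ν
  simp [MvPowerSeries.coeff_pderiv, MvPowerSeries.coeff_map]

/-! ### The coefficient rings `O[[u]]` and `O((u))`, where `O = ℂ{x₀, …, xₙ}` -/

section Coefficients

/-- The ring `O[[u]]`. -/
abbrev CoefP (n : ℕ) : Type := PowerSeries (ConvSeries (Fin (n + 1)))

/-- The ring `O((u))`. -/
def CoefL (n : ℕ) : Type := LaurentSeries (ConvSeries (Fin (n + 1)))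

variable {n : ℕ}

instance : CommRing (CoefL n) :=
  inferInstanceAs (CommRing (LaurentSeries (ConvSeries (Fin (n + 1)))))

instance : Algebra ℂ (CoefL n) :=
  HahnSeries.instAlgebra (Γ := ℤ) (R := ℂ) (A := ConvSeries (Fin (n + 1)))

/-- The coefficient of `u ^ k`. -/
def CoefL.coeff (g : CoefL n) (k : ℤ) : ConvSeries (Fin (n + 1)) := HahnSeries.coeff g k

/-- The monomial `u ^ k`, `k ∈ ℤ`. -/
def uPow (n : ℕ) (k : ℤ) : CoefL n := HahnSeries.single k 1

/-- The inclusion `O → O((u))`. -/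
def constL (n : ℕ) : ConvSeries (Fin (n + 1)) →+* CoefL n := HahnSeries.C

/-- The inclusion `O[[u]] → O((u))`. -/
def PtoL (n : ℕ) : CoefP n →+* CoefL n := HahnSeries.ofPowerSeries ℤ _

theorem CoefL.ext {a b : CoefL n} (h : ∀ k, a.coeff k = b.coeff k) : a = b :=
  HahnSeries.ext (funext h)

theorem CoefL.coeff_add (a b : CoefL n) (k : ℤ) : (a + b).coeff k = a.coeff k + b.coeff k := rfl

theorem CoefL.coeff_smul (c : ℂ) (a : CoefL n) (k : ℤ) : (c • a).coeff k = c • a.coeff k := rfl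

theorem CoefL.coeff_uPow_mul (d : ℤ) (a : CoefL n) (k : ℤ) :
    (uPow n d * a).coeff k = a.coeff (k - d) :=
  (HahnSeries.coeff_single_mul (Γ' := ℤ)).trans (one_mul _)

theorem CoefL.coeff_constL_mul (c : ConvSeries (Fin (n + 1))) (a : CoefL n) (k : ℤ) :
    (constL n c * a).coeff k = c * a.coeff k :=
  HahnSeries.coeff_single_zero_mul

theorem uPow_add (d e : ℤ) : uPow n (d + e) = uPow n d * uPow n e := by
  have h := HahnSeries.single_mul_single (Γ := ℤ) (R := ConvSeries (Fin (n + 1))) (a := d) (b := e)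
    (r := 1) (s := 1)
  rw [one_mul] at h
  exact h.symm

theorem uPow_zero : uPow n 0 = 1 := rfl

theorem coeff_PtoL_natCast (g : CoefP n) (k : ℕ) :
    (PtoL n g).coeff k = PowerSeries.coeff k g :=
  HahnSeries.ofPowerSeries_apply_coeff g k

theorem coeff_PtoL_neg (g : CoefP n) {k : ℤ} (hk : k < 0) : (PtoL n g).coeff k = 0 := by
  change (HahnSeries.ofPowerSeries ℤ _ g).coeff k = 0
  rw [HahnSeries.ofPowerSeries_apply]
  refine HahnSeries.embDomain_of_notMem_range ?_
  rintro ⟨l, hl⟩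
  have : (l : ℤ) = k := hl
  omega

theorem PtoL_X : PtoL n PowerSeries.X = uPow n 1 := HahnSeries.ofPowerSeries_X

theorem PtoL_C (a : ConvSeries (Fin (n + 1))) : PtoL n (PowerSeries.C a) = constL n a :=
  HahnSeries.ofPowerSeries_C a

/-- `∂/∂xⱼ` on `O[[u]]`. -/
def dP (j : Fin (n + 1)) : CoefP n →ₗ[ℂ] CoefP n where
  toFun g := PowerSeries.mk fun k => partialX j (PowerSeries.coeff k g)
  map_add' a b := by ext k : 1; simp
  map_smul' c a := by ext k : 1; simp

/-- `∂/∂xⱼ` on `O((u))`. -/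
def dL (j : Fin (n + 1)) : CoefL n →ₗ[ℂ] CoefL n where
  toFun g := HahnSeries.map (g : LaurentSeries (ConvSeries (Fin (n + 1)))) (partialX j)
  map_add' a b := CoefL.ext fun k => map_add (partialX j) (a.coeff k) (b.coeff k)
  map_smul' c a := CoefL.ext fun k => map_smul (partialX j) c (a.coeff k)

/-- `u² ∂/∂u` on `O((u))`. -/
def thetaL : CoefL n →ₗ[ℂ] CoefL n where
  toFun g := uPow n 2 * show CoefL n from LaurentSeries.derivative (ConvSeries (Fin (n + 1))) g
  map_add' a b := by
    rw [← mul_add]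
    exact congrArg (uPow n 2 * ·) (map_add (LaurentSeries.derivative _) a b)
  map_smul' c a := by
    refine CoefL.ext fun k => ?_
    rw [RingHom.id_apply, CoefL.coeff_smul, CoefL.coeff_uPow_mul, CoefL.coeff_uPow_mul]
    exact smul_comm _ c _

theorem coeff_dP (j : Fin (n + 1)) (g : CoefP n) (k : ℕ) :
    PowerSeries.coeff k (dP j g) = partialX j (PowerSeries.coeff k g) :=
  PowerSeries.coeff_mk k fun k => partialX j (PowerSeries.coeff k g)

theorem coeff_dL (j : Fin (n + 1)) (g : CoefL n) (k : ℤ) :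
    (dL j g).coeff k = partialX j (g.coeff k) := rfl

theorem coeff_thetaL (g : CoefL n) (k : ℤ) :
    (thetaL g).coeff k = (k - 1) • g.coeff (k - 1) := by
  refine (CoefL.coeff_uPow_mul 2 _ k).trans ?_
  have h : k - 2 + ((1 : ℕ) : ℤ) = k - 1 := by push_cast; ring
  change Ring.choose (k - 2 + ((1 : ℕ) : ℤ)) 1 • g.coeff (k - 2 + ((1 : ℕ) : ℤ)) = _
  rw [h, Ring.choose_one_right]

theorem dP_X_mul (j : Fin (n + 1)) (g : CoefP n) :
    dP j (PowerSeries.X * g) = PowerSeries.X * dP j g := by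
  ext k : 1
  cases k <;> simp [coeff_dP, PowerSeries.coeff_succ_X_mul]

theorem dL_uPow_mul (j : Fin (n + 1)) (d : ℤ) (g : CoefL n) :
    dL j (uPow n d * g) = uPow n d * dL j g :=
  CoefL.ext fun k => by simp only [coeff_dL, CoefL.coeff_uPow_mul]

theorem dL_constL_mul (j : Fin (n + 1)) (a : ConvSeries (Fin (n + 1))) (g : CoefL n) :
    dL j (constL n a * g) = constL n (partialX j a) * g + constL n a * dL j g :=
  CoefL.ext fun k => by
    simp only [coeff_dL, CoefL.coeff_add, CoefL.coeff_constL_mul, partialX_mul]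

theorem thetaL_constL_mul (a : ConvSeries (Fin (n + 1))) (g : CoefL n) :
    thetaL (constL n a * g) = constL n a * thetaL g :=
  CoefL.ext fun k => by simp only [coeff_thetaL, CoefL.coeff_constL_mul, mul_smul_comm]

theorem thetaL_u_mul (g : CoefL n) :
    thetaL (uPow n 1 * g) = uPow n 1 * uPow n 1 * g + uPow n 1 * thetaL g := by
  refine CoefL.ext fun k => ?_
  rw [mul_assoc]
  simp only [coeff_thetaL, CoefL.coeff_add, CoefL.coeff_uPow_mul]
  have h : k - 1 = 1 + (k - 1 - 1) := by ring
  nth_rewrite 1 [h]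
  module

theorem thetaL_dL (j : Fin (n + 1)) (g : CoefL n) : thetaL (dL j g) = dL j (thetaL g) :=
  CoefL.ext fun k => by simp only [coeff_thetaL, coeff_dL, map_zsmul]

theorem PtoL_dP (j : Fin (n + 1)) (g : CoefP n) : PtoL n (dP j g) = dL j (PtoL n g) := by
  refine CoefL.ext fun k => ?_
  rw [coeff_dL]
  rcases lt_or_ge k 0 with hk | hk
  · rw [coeff_PtoL_neg _ hk, coeff_PtoL_neg _ hk, map_zero]
  · lift k to ℕ using hk
    rw [coeff_PtoL_natCast, coeff_PtoL_natCast, coeff_dP]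

end Coefficients

/-! ### The differentials `u d - df ∧` and `u d - dF ∧` and the operators `t`, `∂/∂sᵢ`

Here `K` is the coefficient ring `O[[u]]` or `O((u))`, with the element `u`, the inclusion `κ` of
`O`, the derivations `d j = ∂/∂xⱼ` and, for `O((u))`, the element `v = u⁻¹` and `θ = u² ∂/∂u`. -/

section Operators

variable {n m : ℕ} {K K' : Type} [CommRing K] [Algebra ℂ K] [CommRing K'] [Algebra ℂ K']

/-- The operators `u ∂/∂xⱼ - ∂f/∂xⱼ`; they define the differential `u d - df ∧`. -/
def opPt (u : K) (κ : ConvSeries (Fin (n + 1)) →+* K) (d : Fin (n + 1) → K →ₗ[ℂ] K)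
    (f : ConvSeries (Fin (n + 1))) (j : Fin (n + 1)) : K →ₗ[ℂ] K :=
  (LinearMap.mulLeft ℂ u).comp (d j) - LinearMap.mulLeft ℂ (κ (partialX j f))

/-- The operators `u ∂/∂xⱼ - ∂F/∂xⱼ`; they define the differential `u d - dF ∧`, where `d` is
relative to the parameters `s`. -/
def opS (u : K) (κ : ConvSeries (Fin (n + 1)) →+* K) (d : Fin (n + 1) → K →ₗ[ℂ] K)
    (F : ConvSeries (Fin (n + 1) ⊕ Fin m)) (j : Fin (n + 1)) :
    MvPowerSeries (Fin m) K →ₗ[MvPowerSeries (Fin m) ℂ] MvPowerSeries (Fin m) K :=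
  (LinearMap.mulLeft _ (MvPowerSeries.C u)).comp (coeffwise m (d j)) -
    LinearMap.mulLeft _ (MvPowerSeries.map κ (coeffwise m (partialX j) (expand F)))

/-- The operator `f + θ`. -/
def tOpPt (κ : ConvSeries (Fin (n + 1)) →+* K) (θ : K →ₗ[ℂ] K) (f : ConvSeries (Fin (n + 1))) :
    K →ₗ[ℂ] K :=
  LinearMap.mulLeft ℂ (κ f) + θ

/-- The operator `F + θ`. -/
def tOpS (κ : ConvSeries (Fin (n + 1)) →+* K) (θ : K →ₗ[ℂ] K)
    (F : ConvSeries (Fin (n + 1) ⊕ Fin m)) :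
    MvPowerSeries (Fin m) K →ₗ[MvPowerSeries (Fin m) ℂ] MvPowerSeries (Fin m) K :=
  LinearMap.mulLeft _ (MvPowerSeries.map κ (expand F)) + coeffwise m θ

/-- The operator `∂/∂sᵢ - (∂F/∂sᵢ) v`. -/
def sOpS {K : Type} [CommRing K] (v : K) (κ : ConvSeries (Fin (n + 1)) →+* K)
    (F : ConvSeries (Fin (n + 1) ⊕ Fin m)) (i : Fin m) :
    MvPowerSeries (Fin m) K →+ MvPowerSeries (Fin m) K :=
  (MvPowerSeries.pderiv K i).toLinearMap.toAddMonoidHom -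
    AddMonoidHom.mulLeft (MvPowerSeries.C v *
      MvPowerSeries.map κ (MvPowerSeries.pderiv _ i (expand F)))

theorem sOpS_apply {K : Type} [CommRing K] (v : K) (κ : ConvSeries (Fin (n + 1)) →+* K)
    (F : ConvSeries (Fin (n + 1) ⊕ Fin m)) (i : Fin m) (g : MvPowerSeries (Fin m) K) :
    sOpS v κ F i g = MvPowerSeries.pderiv K i g -
      MvPowerSeries.C v * MvPowerSeries.map κ (MvPowerSeries.pderiv _ i (expand F)) * g := rfl

variable (u v : K) (κ : ConvSeries (Fin (n + 1)) →+* K) (d : Fin (n + 1) → K →ₗ[ℂ] K)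
  (θ : K →ₗ[ℂ] K) (f : ConvSeries (Fin (n + 1))) (F : ConvSeries (Fin (n + 1) ⊕ Fin m))
  (i : Fin m) (j : Fin (n + 1))

theorem opPt_apply (g : K) : opPt u κ d f j g = u * d j g - κ (partialX j f) * g := rfl

theorem opS_apply (g : MvPowerSeries (Fin m) K) :
    opS u κ d F j g = MvPowerSeries.C u * coeffwise m (d j) g -
      MvPowerSeries.map κ (coeffwise m (partialX j) (expand F)) * g := rfl

theorem tOpPt_apply (g : K) : tOpPt κ θ f g = κ f * g + θ g := rfl

theorem tOpS_apply (g : MvPowerSeries (Fin m) K) :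
    tOpS κ θ F g = MvPowerSeries.map κ (expand F) * g + coeffwise m θ g := rfl

/-- Compatibility with the restriction to `s = 0`. -/
theorem constantCoeff_opS (g : MvPowerSeries (Fin m) K) :
    MvPowerSeries.constantCoeff (opS u κ d F j g) =
      opPt u κ d (MvPowerSeries.constantCoeff (expand F)) j (MvPowerSeries.constantCoeff g) := by
  rw [opS_apply, opPt_apply, map_sub, map_mul, map_mul, MvPowerSeries.constantCoeff_C,
    MvPowerSeries.constantCoeff_map]
  rfl

theorem map_opPt (ρ : K →+* K') (u' : K') (κ' : ConvSeries (Fin (n + 1)) →+* K')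
    (d' : Fin (n + 1) → K' →ₗ[ℂ] K') (hu : ρ u = u') (hκ : ∀ a, ρ (κ a) = κ' a)
    (hd : ∀ x, ρ (d j x) = d' j (ρ x)) (g : K) :
    ρ (opPt u κ d f j g) = opPt u' κ' d' f j (ρ g) := by
  rw [opPt_apply, opPt_apply, map_sub, map_mul, map_mul, hu, hκ, hd]

theorem map_opS (ρ : K →+* K') (u' : K') (κ' : ConvSeries (Fin (n + 1)) →+* K')
    (d' : Fin (n + 1) → K' →ₗ[ℂ] K') (hu : ρ u = u') (hκ : ∀ a, ρ (κ a) = κ' a)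
    (hd : ∀ x, ρ (d j x) = d' j (ρ x)) (g : MvPowerSeries (Fin m) K) :
    MvPowerSeries.map ρ (opS u κ d F j g) = opS u' κ' d' F j (MvPowerSeries.map ρ g) := by
  have h1 : MvPowerSeries.map ρ (coeffwise m (d j) g) =
      coeffwise m (d' j) (MvPowerSeries.map ρ g) := by
    ext ν
    simp only [MvPowerSeries.coeff_map, coeff_coeffwise, hd]
  have h2 : ∀ a : MvPowerSeries (Fin m) (ConvSeries (Fin (n + 1))),
      MvPowerSeries.map ρ (MvPowerSeries.map κ a) = MvPowerSeries.map κ' a := by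
    intro a
    ext ν
    simp only [MvPowerSeries.coeff_map, hκ]
  rw [opS_apply, opS_apply, map_sub, map_mul, map_mul, MvPowerSeries.map_C, hu, h1, h2]

variable {d θ}

theorem mul_opPt (c : K) (hc : ∀ x, d j (c * x) = c * d j x) (g : K) :
    c * opPt u κ d f j g = opPt u κ d f j (c * g) := by
  rw [opPt_apply, opPt_apply, hc]
  ring

theorem mul_opS (c : K) (hc : ∀ x, d j (c * x) = c * d j x) (g : MvPowerSeries (Fin m) K) :
    MvPowerSeries.C c * opS u κ d F j g = opS u κ d F j (MvPowerSeries.C c * g) := by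
  rw [opS_apply, opS_apply, coeffwise_C_mul (d j) c 0 (fun y => by rw [hc, zero_mul, zero_add]),
    map_zero]
  ring

theorem tOpPt_opPt (hu : ∀ x, d j (u * x) = u * d j x)
    (hd : ∀ a x, d j (κ a * x) = κ (partialX j a) * x + κ a * d j x)
    (hθu : ∀ x, θ (u * x) = u * u * x + u * θ x) (hθκ : ∀ a x, θ (κ a * x) = κ a * θ x)
    (hθd : ∀ x, θ (d j x) = d j (θ x)) (g : K) :
    tOpPt κ θ f (opPt u κ d f j g) = opPt u κ d f j (tOpPt κ θ f g + u * g) := by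
  simp only [opPt_apply, tOpPt_apply, map_sub, map_add, hu, hd, hθu, hθκ, hθd]
  ring

theorem tOpS_opS (hu : ∀ x, d j (u * x) = u * d j x)
    (hd : ∀ a x, d j (κ a * x) = κ (partialX j a) * x + κ a * d j x)
    (hθu : ∀ x, θ (u * x) = u * u * x + u * θ x) (hθκ : ∀ a x, θ (κ a * x) = κ a * θ x)
    (hθd : ∀ x, θ (d j x) = d j (θ x)) (g : MvPowerSeries (Fin m) K) :
    (tOpS κ θ F).toAddMonoidHom (opS u κ d F j g) = opS u κ d F j
      ((tOpS κ θ F + LinearMap.mulLeft _ (MvPowerSeries.C u)).toAddMonoidHom g) := by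
  rw [LinearMap.toAddMonoidHom_coe, LinearMap.toAddMonoidHom_coe, LinearMap.add_apply,
    LinearMap.mulLeft_apply]
  have h3 : coeffwise m θ (coeffwise m (d j) g) = coeffwise m (d j) (coeffwise m θ g) := by
    ext ν : 1
    exact hθd _
  have h4 : coeffwise m (0 : ConvSeries (Fin (n + 1)) →ₗ[ℂ] ConvSeries (Fin (n + 1)))
      (coeffwise m (partialX j) (expand F)) = 0 := by
    ext ν : 1
    rfl
  simp only [opS_apply, tOpS_apply]
  rw [map_sub, map_add, map_add, coeffwise_C_mul θ _ _ hθu,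
    coeffwise_map_mul κ 0 θ (fun a y => by
      rw [LinearMap.zero_apply, map_zero, zero_mul, zero_add, hθκ]),
    coeffwise_map_mul κ (partialX j) (d j) hd,
    coeffwise_C_mul (d j) u 0 (fun y => by rw [hu, zero_mul, zero_add]), h3, h4, map_zero,
    map_zero, map_mul]
  ring

theorem sOpS_opS (huv : u * v = 1) (hv : ∀ x, d j (v * x) = v * d j x)
    (hd : ∀ a x, d j (κ a * x) = κ (partialX j a) * x + κ a * d j x)
    (g : MvPowerSeries (Fin m) K) :
    sOpS v κ F i (opS u κ d F j g) = opS u κ d F j (sOpS v κ F i g) := by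
  have h1 : (MvPowerSeries.C u : MvPowerSeries (Fin m) K) * MvPowerSeries.C v = 1 := by
    rw [← map_mul, huv, map_one]
  simp only [opS_apply, sOpS_apply, map_sub, Derivation.leibniz, smul_eq_mul,
    MvPowerSeries.pderiv_C, pderiv_map, pderiv_coeffwise, mul_zero, add_zero, mul_assoc]
  rw [coeffwise_C_mul (d j) v 0 (fun y => by rw [hv, zero_mul, zero_add]),
    coeffwise_map_mul κ (partialX j) (d j) hd, map_zero]
  linear_combination (MvPowerSeries.map κ
    (coeffwise m (partialX j) (MvPowerSeries.pderiv _ i (expand F))) * g) * h1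

end Operators

/-! ### Gauss-Manin systems and Brieskorn lattices -/

section Lattices

variable {n m : ℕ}

/-- The operators of the complex `(Ω_X[[u]], u d - df ∧)`. -/
def opP (f : ConvSeries (Fin (n + 1))) : Fin (n + 1) → CoefP n →ₗ[ℂ] CoefP n :=
  opPt PowerSeries.X PowerSeries.C dP f

/-- The operators of the complex `(Ω_X((u)), u d - df ∧)`. -/
def opL (f : ConvSeries (Fin (n + 1))) : Fin (n + 1) → CoefL n →ₗ[ℂ] CoefL n :=
  opPt (uPow n 1) (constL n) dL f

/-- The operators of the complex `(Ω_X[[u]][[s]], u d - dF ∧)`. -/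
def opPS (F : ConvSeries (Fin (n + 1) ⊕ Fin m)) : Fin (n + 1) →
    MvPowerSeries (Fin m) (CoefP n) →ₗ[MvPowerSeries (Fin m) ℂ] MvPowerSeries (Fin m) (CoefP n) :=
  opS PowerSeries.X PowerSeries.C dP F

/-- The operators of the complex `(Ω_X((u))[[s]], u d - dF ∧)`. -/
def opLS (F : ConvSeries (Fin (n + 1) ⊕ Fin m)) : Fin (n + 1) →
    MvPowerSeries (Fin m) (CoefL n) →ₗ[MvPowerSeries (Fin m) ℂ] MvPowerSeries (Fin m) (CoefL n) :=
  opS (uPow n 1) (constL n) dL F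

/-- The formal Brieskorn lattice of `f`. -/
abbrev Lattice (f : ConvSeries (Fin (n + 1))) : Type := TopCoh (opP f)

/-- The formal Gauss-Manin system of `f`. -/
abbrev GaussManin (f : ConvSeries (Fin (n + 1))) : Type := TopCoh (opL f)

/-- The bi-formal Brieskorn lattice of the deformation `F`. -/
abbrev LatticeS (F : ConvSeries (Fin (n + 1) ⊕ Fin m)) : Type := TopCoh (opPS F)

/-- The bi-formal Gauss-Manin system of the deformation `F`. -/
abbrev GaussManinS (F : ConvSeries (Fin (n + 1) ⊕ Fin m)) : Type := TopCoh (opLS F)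

/-- The canonical map from the formal Brieskorn lattice to the formal Gauss-Manin system. -/
def toGM (f : ConvSeries (Fin (n + 1))) : Lattice f →+ GaussManin f :=
  TopCoh.map (PtoL n).toAddMonoidHom (PtoL n).toAddMonoidHom fun j x =>
    map_opPt _ _ _ f j (PtoL n) _ _ _ PtoL_X PtoL_C (PtoL_dP j) x

/-- The canonical map from the bi-formal Brieskorn lattice to the bi-formal Gauss-Manin system. -/
def toGMS (F : ConvSeries (Fin (n + 1) ⊕ Fin m)) : LatticeS F →+ GaussManinS F :=
  TopCoh.map (MvPowerSeries.map (PtoL n)).toAddMonoidHom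
    (MvPowerSeries.map (PtoL n)).toAddMonoidHom fun j x =>
      map_opS _ _ _ F j (PtoL n) _ _ _ PtoL_X PtoL_C (PtoL_dP j) x

/-- The action of `u = ∂ₜ⁻¹` on the formal Brieskorn lattice. -/
def uLattice (f : ConvSeries (Fin (n + 1))) : Lattice f →ₗ[ℂ] Lattice f :=
  TopCoh.mapₗ (LinearMap.mulLeft ℂ PowerSeries.X) fun j x =>
    mul_opPt _ _ f j PowerSeries.X (dP_X_mul j) x

/-- The action of `u = ∂ₜ⁻¹` on the bi-formal Brieskorn lattice. -/
def uLatticeS (F : ConvSeries (Fin (n + 1) ⊕ Fin m)) :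
    LatticeS F →ₗ[MvPowerSeries (Fin m) ℂ] LatticeS F :=
  TopCoh.mapₗ (LinearMap.mulLeft _ (MvPowerSeries.C PowerSeries.X)) fun j x =>
    mul_opS _ _ F j PowerSeries.X (dP_X_mul j) x

/-- The action of `u ^ k = ∂ₜ ^ (-k)`, `k ∈ ℤ`, on the formal Gauss-Manin system. -/
def uGM (f : ConvSeries (Fin (n + 1))) (k : ℤ) : GaussManin f →ₗ[ℂ] GaussManin f :=
  TopCoh.mapₗ (LinearMap.mulLeft ℂ (uPow n k)) fun j x =>
    mul_opPt _ _ f j (uPow n k) (dL_uPow_mul j k) x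

/-- The action of `u ^ k = ∂ₜ ^ (-k)`, `k ∈ ℤ`, on the bi-formal Gauss-Manin system. -/
def uGMS (F : ConvSeries (Fin (n + 1) ⊕ Fin m)) (k : ℤ) :
    GaussManinS F →ₗ[MvPowerSeries (Fin m) ℂ] GaussManinS F :=
  TopCoh.mapₗ (LinearMap.mulLeft _ (MvPowerSeries.C (uPow n k))) fun j x =>
    mul_opS _ _ F j (uPow n k) (dL_uPow_mul j k) x

/-- The action of `t` on the formal Gauss-Manin system: on forms it is `f + u² ∂/∂u`, since
`t δ(t - f) = f δ(t - f)` and `t u ^ k = u ^ k t + k u ^ (k + 1)` for `u = ∂ₜ⁻¹`. -/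
def tGM (f : ConvSeries (Fin (n + 1))) : GaussManin f →+ GaussManin f :=
  TopCoh.map (tOpPt (constL n) thetaL f).toAddMonoidHom
    (tOpPt (constL n) thetaL f + LinearMap.mulLeft ℂ (uPow n 1)).toAddMonoidHom fun j x =>
      tOpPt_opPt (uPow n 1) (constL n) f j (dL_uPow_mul j 1) (dL_constL_mul j) thetaL_u_mul thetaL_constL_mul
        (thetaL_dL j) x

theorem tOpS_opLS (F : ConvSeries (Fin (n + 1) ⊕ Fin m)) (j : Fin (n + 1))
    (x : MvPowerSeries (Fin m) (CoefL n)) :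
    (tOpS (constL n) thetaL F).toAddMonoidHom (opLS F j x) = opLS F j
      ((tOpS (constL n) thetaL F +
        LinearMap.mulLeft _ (MvPowerSeries.C (uPow n 1))).toAddMonoidHom x) := by
  have h := tOpS_opS (d := dL) (θ := thetaL) (uPow n 1) (constL n) F j (dL_uPow_mul j 1)
    (dL_constL_mul j) thetaL_u_mul thetaL_constL_mul (thetaL_dL j) x
  exact h

/-- The action of `t` on the bi-formal Gauss-Manin system: on forms it is `F + u² ∂/∂u`. -/
def tGMS (F : ConvSeries (Fin (n + 1) ⊕ Fin m)) : GaussManinS F →+ GaussManinS F :=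
  TopCoh.map (tOpS (constL n) thetaL F).toAddMonoidHom _ (tOpS_opLS F)

/-- The action of `∂/∂sᵢ` on the bi-formal Gauss-Manin system: on forms it is
`∂/∂sᵢ - (∂F/∂sᵢ) u⁻¹`, since `∂_{sᵢ} δ(t - F) = -(∂F/∂sᵢ) ∂ₜ δ(t - F)`. -/
def sGMS (F : ConvSeries (Fin (n + 1) ⊕ Fin m)) (i : Fin m) :
    GaussManinS F →+ GaussManinS F :=
  TopCoh.map (sOpS (uPow n (-1)) (constL n) F i) (sOpS (uPow n (-1)) (constL n) F i) fun j x =>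
    sOpS_opS _ _ _ F i j (by rw [← uPow_add]; exact uPow_zero) (dL_uPow_mul j (-1))
      (dL_constL_mul j) x

/-- The restriction to `s = 0` of the bi-formal Brieskorn lattice of a deformation `F` of `f`. -/
def restrLattice (f : ConvSeries (Fin (n + 1))) (F : ConvSeries (Fin (n + 1) ⊕ Fin m))
    (hF : MvPowerSeries.constantCoeff (expand F) = f) : LatticeS F →+ Lattice f :=
  TopCoh.map MvPowerSeries.constantCoeff.toAddMonoidHom
    MvPowerSeries.constantCoeff.toAddMonoidHom fun j x => by
      subst hF
      exact constantCoeff_opS _ _ _ F j x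

/-- `Ω_f`, as the quotient of the formal Brieskorn lattice by the image of `∂ₜ⁻¹`. -/
abbrev Omega (f : ConvSeries (Fin (n + 1))) : Type := Lattice f ⧸ LinearMap.range (uLattice f)

/-- `Ω_F` (formal in `s`), as the quotient of the bi-formal Brieskorn lattice by the image of
`∂ₜ⁻¹`. -/
abbrev OmegaS (F : ConvSeries (Fin (n + 1) ⊕ Fin m)) : Type :=
  LatticeS F ⧸ LinearMap.range (uLatticeS F)

/-- The restriction to `s = 0` of `Ω_F`. -/
def restrOmega (f : ConvSeries (Fin (n + 1))) (F : ConvSeries (Fin (n + 1) ⊕ Fin m))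
    (hF : MvPowerSeries.constantCoeff (expand F) = f) : OmegaS F →+ Omega f :=
  QuotientAddGroup.map (LinearMap.range (uLatticeS F)).toAddSubgroup
    (LinearMap.range (uLattice f)).toAddSubgroup (restrLattice f F hF) <| by
    rintro _ ⟨y, rfl⟩
    refine ⟨restrLattice f F hF y, ?_⟩
    induction y using Submodule.Quotient.induction_on with
    | H ω =>
      refine congrArg (Submodule.Quotient.mk) (funext fun J => ?_)
      change PowerSeries.X * MvPowerSeries.constantCoeff (ω J) =
        MvPowerSeries.constantCoeff (MvPowerSeries.C PowerSeries.X * ω J)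
      rw [map_mul, MvPowerSeries.constantCoeff_C]

/-! ### Good sections -/

/-- `σ` is a good section of the projection from the formal Brieskorn lattice of `f` onto `Ω_f`:
its image `I` satisfies `t I ⊆ I + ∂ₜ⁻¹ I`. -/
structure IsGoodSection (f : ConvSeries (Fin (n + 1))) (σ : Omega f →ₗ[ℂ] Lattice f) : Prop where
  proj : ∀ w, Submodule.Quotient.mk (σ w) = w
  t_mem : ∀ x ∈ LinearMap.range σ, ∃ y ∈ LinearMap.range σ, ∃ z ∈ LinearMap.range σ,
    tGM f (toGM f x) = toGM f y + uGM f 1 (toGM f z)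

/-- `σ` is a good section of the projection from the bi-formal Brieskorn lattice of `F` onto
`Ω_F`: its image `I` satisfies `t I ⊆ I + ∂ₜ⁻¹ I` and `∂_{sᵢ} I ⊆ I + ∂ₜ I` for all `i`. -/
structure IsGoodSectionS (F : ConvSeries (Fin (n + 1) ⊕ Fin m))
    (σ : OmegaS F →ₗ[MvPowerSeries (Fin m) ℂ] LatticeS F) : Prop where
  proj : ∀ w, Submodule.Quotient.mk (σ w) = w
  t_mem : ∀ x ∈ LinearMap.range σ, ∃ y ∈ LinearMap.range σ, ∃ z ∈ LinearMap.range σ,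
    tGMS F (toGMS F x) = toGMS F y + uGMS F 1 (toGMS F z)
  s_mem : ∀ i : Fin m, ∀ x ∈ LinearMap.range σ,
    ∃ y ∈ LinearMap.range σ, ∃ z ∈ LinearMap.range σ,
      sGMS F i (toGMS F x) = toGMS F y + uGMS F (-1) (toGMS F z)

end Lattices

end FormalBrieskorn

end

/-! Write H ⊂ G for the formal lattice and Gauss-Manin system of f, and I₀ for the image of the
given section. Set I₀[u⁻¹] = ∑_{k≥0} u⁻ᵏI₀ (`tail`). Since I₀ is a complement of uH in H, an
induction on pole order gives G = H ⊕ u⁻¹I₀[u⁻¹] and H ∩ I₀[u⁻¹] = I₀. Goodness of the section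
becomes t I₀[u⁻¹] ⊂ u I₀[u⁻¹].

Multiplication by exp(-(F - f)/u), which makes sense because F - f vanishes at s = 0, turns u d -
dF∧ into u d - df∧, F + u²∂/∂u into f + u²∂/∂u, and ∂/∂sᵢ - (∂F/∂sᵢ)u⁻¹ into ∂/∂sᵢ. So the
Gauss-Manin system of F embeds into G[[s]], by the coefficient maps `trivCoeff`, compatibly with u,
t and ∂/∂sᵢ.

Existence: the extension has as image the elements of the bi-formal lattice all of whose
coefficients in G[[s]] lie in I₀[u⁻¹] (`flatPart`). With V = u⁻¹I₀[u⁻¹], the lattice of F maps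
bijectively onto (G/V)[[s]]: coefficients are corrected by recursion on the multi-index, and at the
lowest order the exponential acts as 1 (`exists_sub_trivCoeff_mem`, `eq_zero_of_trivCoeff_mem`).
This makes `flatPart` a complement of the image of u (`isCompl_flatPart`); both goodness conditions
then follow from the stability of I₀[u⁻¹] under u⁻¹ and u⁻¹t.

Uniqueness: if the image R of a section satisfies ∂_{sᵢ}R ⊂ R + u⁻¹R, then ∑ u⁻ᵏR is stable under
all ∂/∂sᵢ. Its values at s = 0 lie in I₀[u⁻¹], so by Taylor's formula all its coefficients do, and R
is contained in `flatPart` (`mem_flatPart_of_good`).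

The isolated singularity enters through the injectivity of H → G (`toGM_injective`). That follows,
by dividing out powers of u, from exactness of the Koszul complex of the partial derivatives of f
below the top degree (`koszul_exact`). The latter is proved by analysis: on summable Laurent series
with xₜ invertible, Gelfand theory shows that the partial derivatives generate the unit ideal, so
their Koszul complex is contractible there. A descending induction over the coordinates, as in the
computation of local cohomology at the origin, brings exactness back to power series. -/

noncomputable section

namespace FormalBrieskorn

/-! ### The total Koszul complex of a family of commuting operators -/

section TotalForms

variable {M M' : Type} [AddCommGroup M] [AddCommGroup M'] {N : ℕ}

/-- The sign of sorting `j` into its place among the elements of `J`. -/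
def koszulSign (J : Finset (Fin N)) (j : Fin N) : ℤ := (-1) ^ (J.filter (· < j)).card

theorem koszulSign_mul_self (J : Finset (Fin N)) (j : Fin N) :
    koszulSign J j * koszulSign J j = 1 := by
  rw [koszulSign, ← mul_pow]; simp

theorem koszulSign_erase_self (J : Finset (Fin N)) (j : Fin N) :
    koszulSign (J.erase j) j = koszulSign J j := by
  unfold koszulSign
  congr 2
  ext i; simp only [Finset.mem_filter, Finset.mem_erase]
  constructor
  · rintro ⟨⟨_, h⟩, h'⟩; exact ⟨h, h'⟩
  · rintro ⟨h, h'⟩; exact ⟨⟨h'.ne, h⟩, h'⟩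

theorem koszulSign_erase_of_lt {J : Finset (Fin N)} {i j : Fin N} (h : i < j) :
    koszulSign (J.erase j) i = koszulSign J i := by
  unfold koszulSign
  congr 2
  ext k; simp only [Finset.mem_filter, Finset.mem_erase]
  constructor
  · rintro ⟨⟨_, h⟩, h'⟩; exact ⟨h, h'⟩
  · rintro ⟨h1, h'⟩; exact ⟨⟨(h'.trans h).ne, h1⟩, h'⟩

theorem koszulSign_erase_of_gt {J : Finset (Fin N)} {i j : Fin N} (hi : i ∈ J) (h : i < j) :
    koszulSign (J.erase i) j = -koszulSign J j := by
  unfold koszulSign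
  rw [Finset.filter_erase]
  have hmem : i ∈ J.filter (· < j) := Finset.mem_filter.mpr ⟨hi, h⟩
  rw [← Finset.card_erase_add_one hmem, pow_succ]
  ring

theorem koszulSign_swap {J : Finset (Fin N)} {i j : Fin N} (hi : i ∈ J) (hj : j ∈ J) (h : i ≠ j) :
    koszulSign J j * koszulSign (J.erase j) i = -(koszulSign J i * koszulSign (J.erase i) j) := by
  rcases lt_or_gt_of_ne h with h | h
  · rw [koszulSign_erase_of_lt h, koszulSign_erase_of_gt hi h]; ring
  · rw [koszulSign_erase_of_lt h, koszulSign_erase_of_gt hj h]; ring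

/-- The sign rule that cancels the mixed terms of the homotopy formula. It is `koszulSign_swap` for
the set with i added, rearranged using that every sign is its own inverse. -/
theorem koszulSign_swap_insert {J : Finset (Fin N)} {i j : Fin N} (hi : i ∉ J) (hj : j ∈ J) :
    koszulSign J j * koszulSign (J.erase j) i = -(koszulSign J i * koszulSign (insert i J) j) := by
  have h : i ≠ j := fun h => hi (h ▸ hj)
  have h1 : koszulSign J i = koszulSign (insert i J) i := by
    rw [← koszulSign_erase_self (insert i J), Finset.erase_insert hi]
  have key := koszulSign_swap (J := insert i J) (Finset.mem_insert_self i J)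
    (Finset.mem_insert_of_mem hj) h
  have h2 : koszulSign J j = koszulSign ((insert i J).erase i) j := by rw [Finset.erase_insert hi]
  have h3 : (insert i J).erase j = insert i (J.erase j) := Finset.erase_insert_of_ne h
  have h4 : koszulSign ((insert i J).erase j) i = koszulSign (J.erase j) i := by
    rw [h3, ← koszulSign_erase_self (insert i (J.erase j)), Finset.erase_insert]
    exact fun h => hi (Finset.mem_of_mem_erase h)
  rw [h4, ← h2, ← h1] at key
  have e1 := koszulSign_mul_self J j
  have e2 := koszulSign_mul_self (insert i J) j
  linear_combination (koszulSign J j * koszulSign (insert i J) j) * key -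
    (koszulSign J j * koszulSign (J.erase j) i) * e2 -
    (koszulSign J i * koszulSign (insert i J) j) * e1

/-- The differential `ω ↦ ∑ⱼ dxⱼ ∧ Pⱼ(ω)` on forms of all degrees. -/
def totalDiff (P : Fin N → M →+ M) : (Finset (Fin N) → M) →+ (Finset (Fin N) → M) where
  toFun z J := ∑ j ∈ J, koszulSign J j • P j (z (J.erase j))
  map_zero' := by funext J; simp
  map_add' a b := by funext J; simp [Finset.sum_add_distrib]

theorem totalDiff_apply (P : Fin N → M →+ M) (z : Finset (Fin N) → M) (J : Finset (Fin N)) :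
    totalDiff P z J = ∑ j ∈ J, koszulSign J j • P j (z (J.erase j)) := rfl

/-- The contraction `ω ↦ ∑ⱼ ι(∂ⱼ) Bⱼ(ω)` on forms of all degrees. -/
def contraction (B : Fin N → M →+ M) : (Finset (Fin N) → M) →+ (Finset (Fin N) → M) where
  toFun z J := ∑ j ∈ Jᶜ, koszulSign J j • B j (z (insert j J))
  map_zero' := by funext J; simp
  map_add' a b := by funext J; simp [Finset.sum_add_distrib]

theorem contraction_apply (P : Fin N → M →+ M) (z : Finset (Fin N) → M) (J : Finset (Fin N)) :
    contraction P z J = ∑ j ∈ Jᶜ, koszulSign J j • P j (z (insert j J)) := rfl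

theorem totalDiff_totalDiff (P : Fin N → M →+ M) (hP : ∀ i j x, P i (P j x) = P j (P i x))
    (z : Finset (Fin N) → M) : totalDiff P (totalDiff P z) = 0 := by
  funext J
  simp only [totalDiff_apply, map_sum, map_zsmul, Finset.smul_sum, smul_smul, Pi.zero_apply]
  rw [Finset.sum_sigma']
  refine Finset.sum_involution (fun p _ => ⟨p.2, p.1⟩) ?_ ?_ ?_ ?_
  · rintro ⟨j, i⟩ hp
    simp only [Finset.mem_sigma, Finset.mem_erase] at hp
    obtain ⟨hj, hij, hi⟩ := hp
    simp only
    rw [koszulSign_swap hi hj hij, hP i j, Finset.erase_right_comm, ← add_smul]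
    simp
  · rintro ⟨j, i⟩ hp _ heq
    simp only [Finset.mem_sigma, Finset.mem_erase] at hp
    simp only [Sigma.mk.injEq, heq_eq_eq] at heq
    exact hp.2.1 heq.1
  · rintro ⟨j, i⟩ hp
    simp only [Finset.mem_sigma, Finset.mem_erase] at hp ⊢
    exact ⟨hp.2.2, hp.2.1.symm, hp.1⟩
  · rintro ⟨j, i⟩ _; rfl

/-- A relation ∑ BⱼPⱼ = 1 makes the Koszul complex contractible. The terms BⱼPⱼ(z J) with j in J
come from the first summand and those with j outside J from the second, so together they give z J;
the mixed terms cancel in pairs by anticommutation. -/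
theorem totalDiff_contraction (P B : Fin N → M →+ M)
    (hPB : ∀ i j x, P i (B j x) = B j (P i x)) (hone : ∀ x, ∑ j, B j (P j x) = x)
    (z : Finset (Fin N) → M) :
    totalDiff P (contraction B z) + contraction B (totalDiff P z) = z := by
  funext J
  simp only [totalDiff_apply, contraction_apply, Pi.add_apply, map_sum, map_zsmul,
    Finset.smul_sum, smul_smul]
  have h1 : ∀ j ∈ J, ∑ i ∈ (J.erase j)ᶜ, (koszulSign J j * koszulSign (J.erase j) i) •
      P j (B i (z (insert i (J.erase j)))) = B j (P j (z J)) +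
      ∑ i ∈ Jᶜ, (koszulSign J j * koszulSign (J.erase j) i) •
        B i (P j (z (insert i (J.erase j)))) := by
    intro j hj
    rw [Finset.compl_erase, Finset.sum_insert (by simpa using hj), koszulSign_erase_self,
      koszulSign_mul_self, one_smul, Finset.insert_erase hj, hPB]
    simp only [hPB]
  have h2 : ∀ i ∈ Jᶜ, ∑ j ∈ insert i J, (koszulSign J i * koszulSign (insert i J) j) •
      B i (P j (z ((insert i J).erase j))) = B i (P i (z J)) -
      ∑ j ∈ J, (koszulSign J j * koszulSign (J.erase j) i) •
        B i (P j (z (insert i (J.erase j)))) := by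
    intro i hi
    have hi' : i ∉ J := by simpa using hi
    rw [Finset.sum_insert hi', ← koszulSign_erase_self (insert i J), Finset.erase_insert hi',
      koszulSign_mul_self, one_smul, sub_eq_add_neg, ← Finset.sum_neg_distrib]
    congr 1
    refine Finset.sum_congr rfl fun j hj => ?_
    have hne : i ≠ j := fun h => hi' (h ▸ hj)
    rw [koszulSign_swap_insert hi' hj, Finset.erase_insert_of_ne hne, neg_smul, neg_neg]
  rw [Finset.sum_congr rfl h1, Finset.sum_congr rfl h2, Finset.sum_add_distrib,
    Finset.sum_sub_distrib, Finset.sum_comm (s := J) (t := Jᶜ)]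
  rw [add_add_sub_cancel, Finset.sum_add_sum_compl, hone]

/-- A form of all degrees is concentrated in the degree `p`. -/
def IsHomogeneousForm (p : ℕ) (z : Finset (Fin N) → M) : Prop := ∀ J, z J ≠ 0 → J.card = p

theorem IsHomogeneousForm.totalDiff {p : ℕ} {z : Finset (Fin N) → M} (hz : IsHomogeneousForm p z)
    (P : Fin N → M →+ M) : IsHomogeneousForm (p + 1) (totalDiff P z) := by
  intro J hJ
  obtain ⟨j, hj, hne⟩ := Finset.exists_ne_zero_of_sum_ne_zero hJ
  have : z (J.erase j) ≠ 0 := fun h => hne (by rw [h, map_zero, smul_zero])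
  rw [← hz _ this, Finset.card_erase_add_one hj]

/-- The extension by zero of a form of degree `p`. -/
def Form.extend {p : ℕ} (ω : Form N p M) : Finset (Fin N) → M :=
  fun J => if h : J.card = p then ω ⟨J, h⟩ else 0

theorem Form.extend_apply {p : ℕ} (ω : Form N p M) (J : {J : Finset (Fin N) // J.card = p}) :
    Form.extend ω J.1 = ω J := dif_pos J.2

theorem Form.isHomogeneousForm_extend {p : ℕ} (ω : Form N p M) :
    IsHomogeneousForm p (Form.extend ω) := by
  intro J hJ
  by_contra h
  exact hJ (dif_neg h)

end TotalForms

/-! ### Forms of a fixed degree inside the forms of all degrees. -/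

section Comparison

variable {A R : Type} [CommRing A] [CommRing R] [Algebra A R] {N : ℕ}

theorem diff_restrict (P : Fin N → R →ₗ[A] R) (p : ℕ) (z : Finset (Fin N) → R)
    (J : {J : Finset (Fin N) // J.card = p + 1}) :
    diff P p (fun J => z J.1) J = totalDiff (fun j => (P j).toAddMonoidHom) z J.1 := by
  rw [totalDiff_apply, ← Finset.sum_coe_sort]
  simp only [diff, LinearMap.pi_apply, LinearMap.sum_apply, LinearMap.smul_apply,
    LinearMap.comp_apply, LinearMap.proj_apply]
  rfl

theorem totalDiff_extend (P : Fin N → R →ₗ[A] R) (p : ℕ) (ω : Form N p R) :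
    totalDiff (fun j => (P j).toAddMonoidHom) (Form.extend ω) = Form.extend (diff P p ω) := by
  funext J
  by_cases h : J.card = p + 1
  · rw [show Form.extend (diff P p ω) J = _ from Form.extend_apply (diff P p ω) ⟨J, h⟩,
      ← diff_restrict P p (Form.extend ω) ⟨J, h⟩]
    exact congrArg (fun w : Form N p R => diff P p w ⟨J, h⟩) (funext (Form.extend_apply ω))
  · rw [Form.extend, dif_neg h]
    by_contra h'
    exact h ((Form.isHomogeneousForm_extend ω).totalDiff _ J h')

end Comparison

/-! ### Banach algebras of operators and the absence of common zeros -/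

/-- Gelfand theory: a proper ideal containing all Tⱼ lies in a maximal ideal, which is the kernel of
a character by Gelfand-Mazur. Characters of a Banach algebra are contractive, so only contractive
ones have to be tested. -/
theorem exists_sum_mul_eq_one {A : Type} [NormedRing A] [NormedAlgebra ℂ A] [NormOneClass A]
    [CompleteSpace A] (C : Subalgebra ℂ A) (hC : IsClosed (C : Set A))
    (comm : ∀ x y : C, x * y = y * x) {N : ℕ} (T : Fin N → C)
    (h : ∀ φ : C →ₐ[ℂ] ℂ, (∀ x, ‖φ x‖ ≤ ‖(x : A)‖) → ∃ j, φ (T j) ≠ 0) :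
    ∃ B : Fin N → C, ∑ j, B j * T j = 1 := by
  let _ : NormedCommRing C := { (inferInstance : NormedRing C) with mul_comm := comm }
  have : CompleteSpace C := hC.completeSpace_coe
  have : NormOneClass C := ⟨norm_one (α := A)⟩
  by_contra hno
  have hspan : Ideal.span (Set.range T) ≠ ⊤ := by
    intro htop
    exact hno (Ideal.mem_span_range_iff_exists_fun.mp (htop ▸ Submodule.mem_top (x := (1 : C))))
  obtain ⟨M, hM, hle⟩ := Ideal.exists_le_maximal _ hspan
  obtain ⟨j, hj⟩ := h (WeakDual.CharacterSpace.equivAlgHom M.toCharacterSpace) fun x =>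
    AlgHom.norm_apply_le_self _ x
  exact hj (M.toCharacterSpace_apply_eq_zero_of_mem (hle (Ideal.subset_span ⟨j, rfl⟩)))

/-! ### Summable Laurent series and shift operators -/

section Shifts

/-- The Banach space of summable families indexed by `ℤ ^ N`. -/
abbrev LaurentL1 (N : ℕ) : Type := lp (fun _ : Fin N → ℤ => ℂ) 1

variable {N : ℕ}

theorem LaurentL1.summable (a : LaurentL1 N) : Summable fun α => ‖a α‖ := by
  have := (lp.memℓp a).summable (by norm_num)
  simpa using this

instance : Nontrivial (LaurentL1 N) where
  exists_pair_ne := ⟨lp.single 1 0 1, 0, fun h => one_ne_zero (α := ℂ) <| by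
    have h1 : (lp.single 1 0 1 : LaurentL1 N) 0 = 0 := by rw [h]; rfl
    rwa [lp.single_apply_self] at h1⟩

theorem LaurentL1.norm_eq (a : LaurentL1 N) : ‖a‖ = ∑' α, ‖a α‖ := by
  have := lp.norm_eq_tsum_rpow (p := 1) (by norm_num) a
  simpa using this

theorem memℓp_one_of_summable {ι : Type} {a : ι → ℂ} (h : Summable fun α => ‖a α‖) :
    Memℓp a 1 := memℓp_gen (by simpa using h)

/-- Multiplication by the monomial with exponent `v`. -/
def shift (v : Fin N → ℤ) : LaurentL1 N →L[ℂ] LaurentL1 N :=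
  LinearMap.mkContinuous
    { toFun := fun a => ⟨fun α => a (α - v), memℓp_one_of_summable
        ((Equiv.subRight v).summable_iff.mpr a.summable)⟩
      map_add' := fun _ _ => rfl
      map_smul' := fun _ _ => rfl } 1 fun a => by
        rw [LaurentL1.norm_eq, LaurentL1.norm_eq, one_mul]
        exact le_of_eq ((Equiv.subRight v).tsum_eq fun α => ‖a α‖)

theorem shift_apply (v : Fin N → ℤ) (a : LaurentL1 N) (α : Fin N → ℤ) :
    shift v a α = a (α - v) := rfl

theorem norm_shift_le (v : Fin N → ℤ) : ‖shift v‖ ≤ 1 :=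
  LinearMap.mkContinuous_norm_le _ zero_le_one _

theorem shift_zero : shift (0 : Fin N → ℤ) = 1 := by
  ext a α
  simp [shift_apply]

theorem shift_add (v w : Fin N → ℤ) : shift (v + w) = shift v * shift w := by
  ext a α
  rw [mul_apply_eq_comp, shift_apply, shift_apply, shift_apply, sub_sub]

/-- The closed algebra of operators generated by the shifts by the vectors in `V`. -/
def shiftAlgebra (V : Set (Fin N → ℤ)) : Subalgebra ℂ (LaurentL1 N →L[ℂ] LaurentL1 N) :=
  (Algebra.adjoin ℂ (shift '' V)).topologicalClosure

theorem isClosed_shiftAlgebra (V : Set (Fin N → ℤ)) :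
    IsClosed (shiftAlgebra V : Set (LaurentL1 N →L[ℂ] LaurentL1 N)) :=
  Subalgebra.isClosed_topologicalClosure _

theorem shift_mem_shiftAlgebra {V : Set (Fin N → ℤ)} {v : Fin N → ℤ} (hv : v ∈ V) :
    shift v ∈ shiftAlgebra V :=
  Subalgebra.le_topologicalClosure _ (Algebra.subset_adjoin ⟨v, hv, rfl⟩)

theorem shiftAlgebra_comm (V : Set (Fin N → ℤ)) (x y : shiftAlgebra V) : x * y = y * x := by
  have h : ∀ a ∈ shift '' V, ∀ b ∈ shift '' V, a * b = b * a := by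
    rintro _ ⟨v, -, rfl⟩ _ ⟨w, -, rfl⟩
    rw [← shift_add, ← shift_add, add_comm]
  let _ := Subalgebra.commRingTopologicalClosure (Algebra.adjoin ℂ (shift '' V))
    (Algebra.isMulCommutative_adjoin ℂ h).is_comm.comm
  exact mul_comm (G := (Algebra.adjoin ℂ (shift '' V)).topologicalClosure) x y

/-- The families supported in `X`. -/
def supportedIn (X : Set (Fin N → ℤ)) : Submodule ℂ (LaurentL1 N) where
  carrier := {a | ∀ α ∉ X, a α = 0}
  zero_mem' := fun _ _ => rfl
  add_mem' := fun {a b} ha hb α hα => by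
    rw [lp.coeFn_add, Pi.add_apply, ha α hα, hb α hα, add_zero]
  smul_mem' := fun c a ha α hα => by
    rw [lp.coeFn_smul, Pi.smul_apply, ha α hα, smul_zero]

theorem supportedIn_mono {X Y : Set (Fin N → ℤ)} (h : X ⊆ Y) : supportedIn X ≤ supportedIn Y :=
  fun _ ha α hα => ha α fun hX => hα (h hX)

theorem continuous_coord (α : Fin N → ℤ) : Continuous fun a : LaurentL1 N => a α :=
  (lp.evalCLM ℂ (fun _ : Fin N → ℤ => ℂ) 1 α).continuous

/-- The operators that preserve a support condition form a subalgebra, closed because the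
coordinates are continuous. It is therefore enough to check the generating shifts. -/
theorem shiftAlgebra_apply_mem {V X : Set (Fin N → ℤ)} (hX : ∀ α ∈ X, ∀ v ∈ V, α + v ∈ X)
    {T : LaurentL1 N →L[ℂ] LaurentL1 N} (hT : T ∈ shiftAlgebra V) {a : LaurentL1 N}
    (ha : a ∈ supportedIn X) : T a ∈ supportedIn X := by
  let stab : Subalgebra ℂ (LaurentL1 N →L[ℂ] LaurentL1 N) :=
    { carrier := {T | ∀ a ∈ supportedIn X, T a ∈ supportedIn X}
      mul_mem' := fun {S T} hS hT a ha => hS _ (hT a ha)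
      add_mem' := fun {S T} hS hT a ha => add_mem (hS a ha) (hT a ha)
      algebraMap_mem' := fun c a ha => by
        rw [Algebra.algebraMap_eq_smul_one]
        exact (supportedIn X).smul_mem c ha }
  have hclosed : IsClosed (stab : Set (LaurentL1 N →L[ℂ] LaurentL1 N)) := by
    have : (stab : Set (LaurentL1 N →L[ℂ] LaurentL1 N)) =
        ⋂ a ∈ supportedIn X, ⋂ α ∈ Xᶜ, {T | T a α = 0} := by
      ext T
      simp only [Set.mem_iInter]
      exact Iff.rfl
    rw [this]
    refine isClosed_biInter fun a _ => isClosed_biInter fun α _ => ?_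
    refine isClosed_eq ((continuous_coord α).comp ?_) continuous_const
    exact (ContinuousLinearMap.apply ℂ (LaurentL1 N) a).continuous
  refine (Subalgebra.topologicalClosure_minimal (t := stab) ?_ hclosed) hT a ha
  rw [Algebra.adjoin_le_iff]
  rintro _ ⟨v, hv, rfl⟩ a ha α hα
  rw [shift_apply]
  refine ha _ fun h => hα ?_
  simpa using hX _ h v hv

/-- The families cut off outside of `X`. -/
def truncate (X : Set (Fin N → ℤ)) (a : LaurentL1 N) : LaurentL1 N :=
  ⟨X.indicator a, memℓp_one_of_summable <| by
    refine a.summable.of_nonneg_of_le (fun _ => norm_nonneg _) fun α => ?_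
    exact norm_indicator_le_norm_self _ _⟩

theorem truncate_apply_of_mem {X : Set (Fin N → ℤ)} {α : Fin N → ℤ} (h : α ∈ X)
    (a : LaurentL1 N) : truncate X a α = a α := Set.indicator_of_mem h _

theorem truncate_apply_of_notMem {X : Set (Fin N → ℤ)} {α : Fin N → ℤ} (h : α ∉ X)
    (a : LaurentL1 N) : truncate X a α = 0 := Set.indicator_of_notMem h _

theorem truncate_zero (X : Set (Fin N → ℤ)) : truncate X 0 = 0 := by
  ext α
  by_cases h : α ∈ X
  · rw [truncate_apply_of_mem h]
  · rw [truncate_apply_of_notMem h]; rfl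

end Shifts

/-! ### Power series as operators -/

section SeriesOperators

variable {N : ℕ}

/-- Natural exponents as integral exponents. -/
def toIntExp : (Fin N →₀ ℕ) →+ (Fin N → ℤ) where
  toFun ν i := ν i
  map_zero' := rfl
  map_add' a b := by funext i; simp

theorem toIntExp_apply (ν : Fin N →₀ ℕ) (i : Fin N) : toIntExp ν i = ν i := rfl

theorem toIntExp_injective : Function.Injective (toIntExp (N := N)) := by
  intro a b h
  ext i
  exact Int.ofNat.inj (congrFun h i)

theorem mem_range_toIntExp {α : Fin N → ℤ} : α ∈ Set.range (toIntExp (N := N)) ↔ ∀ i, 0 ≤ α i := by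
  constructor
  · rintro ⟨ν, rfl⟩ i
    exact Int.natCast_nonneg _
  · intro h
    refine ⟨Finsupp.equivFunOnFinite.symm fun i => (α i).toNat, funext fun i => ?_⟩
    simp [toIntExp_apply, h i]

/-- Multiplication by a summable power series. -/
def seriesOp (c : (Fin N →₀ ℕ) → ℂ) : LaurentL1 N →L[ℂ] LaurentL1 N :=
  ∑' ν, c ν • shift (toIntExp ν)

variable {c : (Fin N →₀ ℕ) → ℂ}

theorem hasSum_seriesOp (hc : Summable fun ν => ‖c ν‖) :
    HasSum (fun ν => c ν • shift (toIntExp ν)) (seriesOp c) := by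
  refine Summable.hasSum (Summable.of_norm_bounded hc fun ν => ?_)
  refine (norm_smul_le (c ν) (shift (toIntExp ν))).trans ?_
  exact mul_le_of_le_one_right (norm_nonneg _) (norm_shift_le _)

theorem seriesOp_apply (hc : Summable fun ν => ‖c ν‖) (a : LaurentL1 N) (α : Fin N → ℤ) :
    seriesOp c a α = ∑' ν, c ν * a (α - toIntExp ν) := by
  have h1 := ((ContinuousLinearMap.apply ℂ (LaurentL1 N) a).hasSum (hasSum_seriesOp hc))
  have h2 := (lp.evalCLM ℂ (fun _ : Fin N → ℤ => ℂ) 1 α).hasSum h1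
  exact h2.tsum_eq.symm

theorem seriesOp_mem (hc : Summable fun ν => ‖c ν‖) {V : Set (Fin N → ℤ)}
    (hV : ∀ ν, toIntExp ν ∈ V) : seriesOp c ∈ shiftAlgebra V := by
  refine (isClosed_shiftAlgebra V).mem_of_tendsto (hasSum_seriesOp hc) (Filter.Eventually.of_forall
    fun s => ?_)
  exact sum_mem fun ν _ => Subalgebra.smul_mem _ (shift_mem_shiftAlgebra (hV ν)) _

theorem character_shift {V : Set (Fin N → ℤ)} (hV : ∀ ν, toIntExp ν ∈ V)
    (φ : shiftAlgebra V →ₐ[ℂ] ℂ) (ν : Fin N →₀ ℕ) :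
    φ ⟨shift (toIntExp ν), shift_mem_shiftAlgebra (hV ν)⟩ = ν.prod fun i k =>
      φ ⟨shift (toIntExp (Finsupp.single i 1)), shift_mem_shiftAlgebra (hV _)⟩ ^ k := by
  have hadd : ∀ μ ν : Fin N →₀ ℕ,
      φ ⟨shift (toIntExp (μ + ν)), shift_mem_shiftAlgebra (hV (μ + ν))⟩ =
      φ ⟨shift (toIntExp μ), shift_mem_shiftAlgebra (hV μ)⟩ *
      φ ⟨shift (toIntExp ν), shift_mem_shiftAlgebra (hV ν)⟩ := by
    intro μ ν
    rw [← map_mul]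
    congr 1
    ext1
    change shift (toIntExp (μ + ν)) = shift (toIntExp μ) * shift (toIntExp ν)
    rw [map_add, shift_add]
  have hzero : φ ⟨shift (toIntExp 0), shift_mem_shiftAlgebra (hV 0)⟩ = 1 := by
    rw [← map_one φ]
    congr 1
    ext1
    change shift (toIntExp 0) = 1
    rw [map_zero, shift_zero]
  induction ν using Finsupp.induction_linear with
  | zero => rw [hzero, Finsupp.prod_zero_index]
  | add μ ν hμ hν =>
    rw [hadd, hμ, hν, Finsupp.prod_add_index' (fun _ => pow_zero _) (fun _ _ _ => pow_add _ _ _)]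
  | single i k =>
    rw [Finsupp.prod_single_index (h := fun i k =>
      φ ⟨shift (toIntExp (Finsupp.single i 1)), shift_mem_shiftAlgebra (hV _)⟩ ^ k) (pow_zero _)]
    induction k with
    | zero => simpa using hzero
    | succ k ih => 
      have := hadd (Finsupp.single i k) (Finsupp.single i 1)
      rw [ih, ← pow_succ] at this
      rw [← this]
      congr 4
      exact Finsupp.single_add _ _ _

/-- A contractive character is continuous and can be applied termwise, so on series it is evaluation
at the point whose coordinates are its values on the unit shifts. -/
theorem character_seriesOp (hc : Summable fun ν => ‖c ν‖) {V : Set (Fin N → ℤ)}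
    (hV : ∀ ν, toIntExp ν ∈ V) (φ : shiftAlgebra V →ₐ[ℂ] ℂ)
    (hφ : ∀ x : shiftAlgebra V, ‖φ x‖ ≤ ‖(x : LaurentL1 N →L[ℂ] LaurentL1 N)‖) :
    φ ⟨seriesOp c, seriesOp_mem hc hV⟩ = ∑' ν, c ν * ν.prod fun i k =>
      φ ⟨shift (toIntExp (Finsupp.single i 1)), shift_mem_shiftAlgebra (hV _)⟩ ^ k := by
  have hcont : Continuous φ := AddMonoidHomClass.continuous_of_bound φ 1 fun x => by
    rw [one_mul]; exact hφ x
  have h1 : HasSum (fun ν => c ν • (⟨shift (toIntExp ν), shift_mem_shiftAlgebra (hV ν)⟩ :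
      shiftAlgebra V)) ⟨seriesOp c, seriesOp_mem hc hV⟩ :=
    (Topology.IsInducing.hasSum_iff (g := (shiftAlgebra V).val)
      Topology.IsInducing.subtypeVal _ _).mp (hasSum_seriesOp hc)
  have h2 := h1.map φ hcont
  rw [← h2.tsum_eq]
  refine tsum_congr fun ν => ?_
  rw [← character_shift hV]
  exact φ.toLinearMap.map_smul _ _

end SeriesOperators

/-! ### Exactness of the Koszul complex of series without common zeros outside of the origin -/

section KoszulExact

variable {N : ℕ}

/-- The exponents that may be negative only in the first `t` coordinates. -/
def negBelow (N t : ℕ) : Set (Fin N → ℤ) := {α | ∀ i, α i < 0 → (i : ℕ) < t}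

/-- The exponents that may be negative only in the first `t` coordinates, but not in all of them. -/
def negProper (N t : ℕ) : Set (Fin N → ℤ) :=
  {α | α ∈ negBelow N t ∧ ∃ i : Fin N, (i : ℕ) < t ∧ 0 ≤ α i}

/-- The directions which are non-negative outside of the coordinate `t`. -/
def freeDirections (t : Fin N) : Set (Fin N → ℤ) := {v | ∀ i, i ≠ t → 0 ≤ v i}

theorem toIntExp_mem_freeDirections (t : Fin N) (ν : Fin N →₀ ℕ) :
    toIntExp ν ∈ freeDirections t := fun _ _ => Int.natCast_nonneg _

theorem seriesOp_apply_mem {c : (Fin N →₀ ℕ) → ℂ} (hc : Summable fun ν => ‖c ν‖)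
    {X : Set (Fin N → ℤ)} (hX : ∀ α ∈ X, ∀ v : Fin N → ℤ, (∀ i, 0 ≤ v i) → α + v ∈ X)
    {a : LaurentL1 N} (ha : a ∈ supportedIn X) : seriesOp c a ∈ supportedIn X :=
  shiftAlgebra_apply_mem (V := {v | ∀ i, 0 ≤ v i}) hX
    (seriesOp_mem hc fun _ _ => Int.natCast_nonneg _) ha

theorem negBelow_add {t : ℕ} {α v : Fin N → ℤ} (hα : α ∈ negBelow N t) (hv : ∀ i, 0 ≤ v i) :
    α + v ∈ negBelow N t := by
  intro i hi
  refine hα i ?_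
  have := hv i
  rw [Pi.add_apply] at hi
  omega

variable {c : Fin N → (Fin N →₀ ℕ) → ℂ}

/-- The multiplications by the series `c j`, as additive maps. -/
def seriesOps (c : Fin N → (Fin N →₀ ℕ) → ℂ) (j : Fin N) : LaurentL1 N →+ LaurentL1 N :=
  (seriesOp (c j)).toLinearMap.toAddMonoidHom

theorem seriesOps_comm (hc : ∀ j, Summable fun ν => ‖c j ν‖) (i j : Fin N) (x : LaurentL1 N) :
    seriesOps c i (seriesOps c j x) = seriesOps c j (seriesOps c i x) := by
  have h := shiftAlgebra_comm (Set.univ : Set (Fin N → ℤ))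
    ⟨_, seriesOp_mem (hc i) fun _ => Set.mem_univ _⟩
    ⟨_, seriesOp_mem (hc j) fun _ => Set.mem_univ _⟩
  exact DFunLike.congr_fun (congrArg Subtype.val h) x

theorem totalDiff_mem {M : Type} [AddCommGroup M] {P : Fin N → M →+ M} {S : AddSubgroup M}
    (hP : ∀ j, ∀ x ∈ S, P j x ∈ S) {z : Finset (Fin N) → M} (hz : ∀ J, z J ∈ S)
    (J : Finset (Fin N)) : totalDiff P z J ∈ S :=
  sum_mem fun j _ => S.zsmul_mem (hP j _ (hz _)) _

theorem contraction_mem {M : Type} [AddCommGroup M] {P : Fin N → M →+ M} {S T : AddSubgroup M}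
    (hP : ∀ j, ∀ x ∈ S, P j x ∈ T) {z : Finset (Fin N) → M} (hz : ∀ J, z J ∈ S)
    (J : Finset (Fin N)) : contraction P z J ∈ T :=
  sum_mem fun j _ => T.zsmul_mem (hP j _ (hz _)) _

/-- Where the coordinate `t` is invertible, the series `c j` generate the unit ideal. -/
theorem exists_sum_seriesOps_eq (hc : ∀ j, Summable fun ν => ‖c j ν‖) (t : Fin N)
    (hzero : ∀ z : Fin N → ℂ, (∀ i, ‖z i‖ ≤ 1) → z t ≠ 0 →
      ∃ j, ∑' ν, c j ν * (ν.prod fun i k => z i ^ k) ≠ 0) :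
    ∃ B : Fin N → shiftAlgebra (freeDirections t),
      ∀ x : LaurentL1 N, ∑ j, (B j).1 (seriesOps c j x) = x := by
  obtain ⟨B, hB⟩ := exists_sum_mul_eq_one (shiftAlgebra (freeDirections t))
    (isClosed_shiftAlgebra _) (shiftAlgebra_comm _)
    (fun j => ⟨seriesOp (c j), seriesOp_mem (hc j) (toIntExp_mem_freeDirections t)⟩) <| by
    intro φ hφ
    -- The point attached to the character lies in the closed unit polydisc because the shifts are
    -- contractions.
    have hbound : ∀ i, ‖φ ⟨shift (toIntExp (Finsupp.single i 1)),
        shift_mem_shiftAlgebra (toIntExp_mem_freeDirections t _)⟩‖ ≤ 1 := fun i =>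
      (hφ _).trans (norm_shift_le _)
    -- Its coordinate t does not vanish: the algebra also contains the inverse of the shift in the
    -- direction t.
    have hne : φ ⟨shift (toIntExp (Finsupp.single t 1)),
        shift_mem_shiftAlgebra (toIntExp_mem_freeDirections t _)⟩ ≠ 0 := by
      have hmem : -toIntExp (Finsupp.single t 1) ∈ freeDirections t := by
        intro i hi
        simp [toIntExp_apply, Finsupp.single_eq_of_ne hi]
      have hone : (⟨shift (toIntExp (Finsupp.single t 1)),
          shift_mem_shiftAlgebra (toIntExp_mem_freeDirections t _)⟩ :
            shiftAlgebra (freeDirections t)) *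
          ⟨shift (-toIntExp (Finsupp.single t 1)), shift_mem_shiftAlgebra hmem⟩ = 1 := by
        ext1
        change shift _ * shift _ = 1
        rw [← shift_add, add_neg_cancel, shift_zero]
      intro h0
      have := congrArg φ hone
      rw [map_mul, h0, zero_mul, map_one] at this
      exact zero_ne_one this
    obtain ⟨j, hj⟩ := hzero _ hbound hne
    refine ⟨j, ?_⟩
    rw [character_seriesOp (hc j) (toIntExp_mem_freeDirections t) φ hφ]
    exact hj
  refine ⟨B, fun x => ?_⟩
  have h1 := congrArg (fun T => T.1 x) hB
  have h2 : ((∑ j, B j * ⟨seriesOp (c j), seriesOp_mem (hc j) (toIntExp_mem_freeDirections t)⟩ :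
      shiftAlgebra (freeDirections t)) : LaurentL1 N →L[ℂ] LaurentL1 N) =
      ∑ j, (B j).1 * seriesOp (c j) := by
    rw [AddSubmonoidClass.coe_finsetSum]
    rfl
  simp only [h2] at h1
  rw [sum_apply] at h1
  exact h1

/-- Let Q(t) be the series supported in `negBelow N t` modulo those supported in `negProper N t`;
this is like local cohomology along the first t coordinates. There is an exact sequence 0 → Q(t) →
Q(t)[xₜ⁻¹] → Q(t + 1) → 0 whose middle term has a contractible Koszul complex. Hence degree p for
Q(t) reduces to degree p - 1 for Q(t + 1), and p + t is unchanged. The descent in t, measured by k,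
ends at t = N, where p + t < N is impossible. All classes are handled by representatives, as
congruences on supports. -/
theorem koszul_exact_mod (hc : ∀ j, Summable fun ν => ‖c j ν‖)
    (hzero : ∀ z : Fin N → ℂ, (∀ i, ‖z i‖ ≤ 1) → z ≠ 0 →
      ∃ j, ∑' ν, c j ν * (ν.prod fun i k => z i ^ k) ≠ 0) (k : ℕ) :
    ∀ t p, N ≤ t + k → p + t < N → ∀ z : Finset (Fin N) → LaurentL1 N, IsHomogeneousForm p z →
      (∀ J, z J ∈ supportedIn (negBelow N t)) →
      (∀ J, totalDiff (seriesOps c) z J ∈ supportedIn (negProper N t)) →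
      ∃ y : Finset (Fin N) → LaurentL1 N, (∀ J, y J ≠ 0 → J.card + 1 = p) ∧
        (∀ J, y J ∈ supportedIn (negBelow N t)) ∧
        ∀ J, (z - totalDiff (seriesOps c) y) J ∈ supportedIn (negProper N t) := by
  induction k with
  | zero => intro t p h1 h2; omega
  | succ k ih =>
    intro t p htk hpt z hz hzT hDz
    have htN : t < N := by omega
    obtain ⟨B, hB⟩ := exists_sum_seriesOps_eq hc ⟨t, htN⟩ fun z h1 h2 =>
      hzero z h1 fun h => h2 (by rw [h]; rfl)
    let b : Fin N → LaurentL1 N →+ LaurentL1 N := fun j => (B j).1.toLinearMap.toAddMonoidHom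
    have hcomm : ∀ i j x, seriesOps c i (b j x) = b j (seriesOps c i x) := by
      intro i j x
      have h := shiftAlgebra_comm _
        ⟨_, seriesOp_mem (hc i) (toIntExp_mem_freeDirections ⟨t, htN⟩)⟩ (B j)
      exact DFunLike.congr_fun (congrArg Subtype.val h) x
    have hhom := totalDiff_contraction (seriesOps c) b hcomm hB z
    set D := totalDiff (seriesOps c) with hD
    -- the exponents in `S'` miss a negative coordinate below `t`
    let S' : Set (Fin N → ℤ) := {α | α ∈ negBelow N (t + 1) ∧ ∃ i : Fin N, (i : ℕ) < t ∧ 0 ≤ α i}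
    have hfree : ∀ α ∈ negBelow N (t + 1), ∀ v ∈ freeDirections (⟨t, htN⟩ : Fin N),
        α + v ∈ negBelow N (t + 1) := by
      intro α hα v hv i hi
      rcases eq_or_ne i ⟨t, htN⟩ with rfl | hne
      · exact Nat.lt_succ_self t
      · refine hα i ?_
        have := hv i hne
        rw [Pi.add_apply] at hi
        omega
    have hS'free : ∀ α ∈ S', ∀ v ∈ freeDirections (⟨t, htN⟩ : Fin N), α + v ∈ S' := by
      rintro α ⟨hα, i, hi, hi'⟩ v hv
      refine ⟨hfree α hα v hv, i, hi, add_nonneg hi' (hv i ?_)⟩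
      rintro rfl
      exact lt_irrefl _ hi
    have hbelow : negBelow N t ⊆ negBelow N (t + 1) := fun α hα i hi =>
      (hα i hi).trans (Nat.lt_succ_self t)
    have hproper : negProper N t ⊆ S' := fun α hα => ⟨hbelow hα.1, hα.2⟩
    have hbS' : ∀ j, ∀ x ∈ (supportedIn S').toAddSubgroup, b j x ∈ (supportedIn S').toAddSubgroup :=
      fun j x hx => shiftAlgebra_apply_mem hS'free (B j).2 hx
    have hcS' : ∀ j, ∀ x ∈ (supportedIn S').toAddSubgroup,
        seriesOps c j x ∈ (supportedIn S').toAddSubgroup := fun j x hx =>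
      shiftAlgebra_apply_mem hS'free (seriesOp_mem (hc j) (toIntExp_mem_freeDirections _)) hx
    have hcT : ∀ j, ∀ x ∈ (supportedIn (negBelow N t)).toAddSubgroup,
        seriesOps c j x ∈ (supportedIn (negBelow N t)).toAddSubgroup := fun j x hx =>
      seriesOp_apply_mem (hc j) (fun α hα v hv => negBelow_add hα hv) hx
    have hinter : ∀ x : LaurentL1 N, x ∈ supportedIn (negBelow N t) → x ∈ supportedIn S' →
        x ∈ supportedIn (negProper N t) := by
      intro x h1 h2 α hα
      by_cases h : α ∈ negBelow N t
      · exact h2 α fun h' => hα ⟨h, h'.2⟩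
      · exact h1 α h
    set y₁ := contraction b z with hy₁
    -- By the homotopy formula z - D y₁ is the contraction of D z, so y₁ is a primitive of z modulo
    -- S', in the middle term of the exact sequence.
    have hz1 : ∀ J, (z - D y₁) J ∈ supportedIn S' := by
      intro J
      rw [sub_eq_of_eq_add' hhom.symm]
      exact contraction_mem hbS' (fun J => supportedIn_mono hproper (hDz J)) J
    have hy1 : ∀ J, y₁ J ≠ 0 → J.card + 1 = p := by
      intro J hJ
      obtain ⟨j, hj, hne⟩ := Finset.exists_ne_zero_of_sum_ne_zero hJ
      have h0 : z (insert j J) ≠ 0 := fun h => hne (by rw [h, map_zero, smul_zero])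
      rw [← hz _ h0, Finset.card_insert_of_notMem (by simpa using hj)]
    -- it suffices to find a primitive modulo `S'` supported in `negProper N (t + 1)`
    suffices hs : ∃ y₂ : Finset (Fin N) → LaurentL1 N, (∀ J, y₂ J ≠ 0 → J.card + 1 = p) ∧
        (∀ J, y₂ J ∈ supportedIn (negProper N (t + 1))) ∧
        ∀ J, (z - D y₂) J ∈ supportedIn S' by
      obtain ⟨y₂, hy2, hy2S, hz2⟩ := hs
      refine ⟨fun J => truncate (negBelow N t) (y₂ J), fun J hJ => hy2 J fun h => hJ ?_,
        fun J α hα => truncate_apply_of_notMem hα _, fun J => ?_⟩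
      · simp only [h, truncate_zero]
      -- Truncation changes y₂ only by terms in S': an exponent of `negProper N (t + 1)` that is not
      -- in `negBelow N t` is negative at t, so its non-negative coordinate below t + 1 lies below
      -- t.
      have hdiff : ∀ J, (y₂ - fun J => truncate (negBelow N t) (y₂ J)) J ∈ supportedIn S' := by
        intro J α hα
        rw [Pi.sub_apply, lp.coeFn_sub, Pi.sub_apply]
        by_cases h : α ∈ negBelow N t
        · rw [truncate_apply_of_mem h, sub_self]
        · rw [truncate_apply_of_notMem h, sub_zero]
          refine hy2S J α fun hα' => hα ⟨hα'.1, ?_⟩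
          obtain ⟨i, hi, hi'⟩ := hα'.2
          refine ⟨i, lt_of_le_of_ne (Nat.lt_succ_iff.mp hi) fun hit => h fun k hk => ?_, hi'⟩
          refine lt_of_le_of_ne (Nat.lt_succ_iff.mp (hα'.1 k hk)) fun hkt => ?_
          rw [Fin.ext (hkt.trans hit.symm)] at hk
          omega
      refine hinter _ ?_ ?_
      · exact sub_mem (hzT J) (totalDiff_mem hcT (fun J α hα => truncate_apply_of_notMem hα _) J)
      · have h := add_mem (hz2 J) (totalDiff_mem hcS' hdiff J)
        have heq : z - D (fun J => truncate (negBelow N t) (y₂ J)) =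
            (z - D y₂) + D (y₂ - fun J => truncate (negBelow N t) (y₂ J)) := by
          rw [map_sub]; abel
        rw [heq]
        exact h
    -- In degree 0 the contraction y₁ vanishes, so the support condition is empty. In positive
    -- degree y₁ still has to be corrected by a coboundary.
    rcases Nat.eq_zero_or_pos p with hp0 | hp0
    · refine ⟨y₁, hy1, fun J => ?_, hz1⟩
      have : y₁ J = 0 := by
        by_contra h
        have := hy1 J h
        omega
      rw [this]
      exact zero_mem _
    have hy1T : ∀ J, y₁ J ∈ supportedIn (negBelow N (t + 1)) :=
      contraction_mem (S := (supportedIn (negBelow N (t + 1))).toAddSubgroup)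
        (T := (supportedIn (negBelow N (t + 1))).toAddSubgroup)
        (fun j x hx => shiftAlgebra_apply_mem hfree (B j).2 hx)
        fun J => supportedIn_mono hbelow (hzT J)
    -- D y₁ differs from z by an element supported in S', and z has no negative exponent at t; so y₁
    -- is a cocycle of degree p - 1 in Q(t + 1).
    have hDy1 : ∀ J, D y₁ J ∈ supportedIn (negProper N (t + 1)) := by
      intro J
      have h1 : D y₁ J = z J - (z - D y₁) J := by rw [Pi.sub_apply, sub_sub_cancel]
      rw [h1]
      refine sub_mem (supportedIn_mono ?_ (hzT J)) (supportedIn_mono ?_ (hz1 J))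
      · intro α hα
        refine ⟨hbelow hα, ⟨t, htN⟩, Nat.lt_succ_self t, ?_⟩
        by_contra h
        exact lt_irrefl _ (hα ⟨t, htN⟩ (not_le.mp h))
      · rintro α ⟨hα, i, hi, hi'⟩
        exact ⟨hα, i, hi.trans (Nat.lt_succ_self t), hi'⟩
    obtain ⟨x, hx, -, hxS⟩ := ih (t + 1) (p - 1) (by omega) (by omega) y₁
      (fun J hJ => by have := hy1 J hJ; omega) hy1T hDy1
    -- Subtracting D x moves y₁ into `negProper N (t + 1)` without changing its differential.
    refine ⟨y₁ - D x, fun J hJ => ?_, hxS, fun J => ?_⟩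
    · by_contra hne
      apply hJ
      have h1 : y₁ J = 0 := by_contra fun h => hne (hy1 J h)
      have h2 : D x J = 0 := by
        by_contra h
        obtain ⟨j, hj, hne'⟩ := Finset.exists_ne_zero_of_sum_ne_zero h
        have h0 : x (J.erase j) ≠ 0 := fun h => hne' (by rw [h, map_zero, smul_zero])
        have h3 := hx _ h0
        rw [Finset.card_erase_add_one hj] at h3
        omega
      rw [Pi.sub_apply, h1, h2, sub_zero]
    · rw [map_sub, hD, totalDiff_totalDiff _ (seriesOps_comm hc), sub_zero]
      exact hz1 J

/-- The Koszul complex of absolutely convergent series on the closed unit polydisc which have no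
common zero there, except perhaps the origin, is exact in the degrees `p < N`. -/
theorem koszul_exact_of_summable (hc : ∀ j, Summable fun ν => ‖c j ν‖)
    (hzero : ∀ z : Fin N → ℂ, (∀ i, ‖z i‖ ≤ 1) → z ≠ 0 →
      ∃ j, ∑' ν, c j ν * (ν.prod fun i k => z i ^ k) ≠ 0) {p : ℕ} (hp : p < N)
    (z : Finset (Fin N) → LaurentL1 N) (hz : IsHomogeneousForm p z)
    (hz0 : ∀ J, z J ∈ supportedIn (Set.range toIntExp)) (hD : totalDiff (seriesOps c) z = 0) :
    ∃ y : Finset (Fin N) → LaurentL1 N, (∀ J, y J ≠ 0 → J.card + 1 = p) ∧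
      (∀ J, y J ∈ supportedIn (Set.range toIntExp)) ∧ totalDiff (seriesOps c) y = z := by
  have hrange : Set.range (toIntExp (N := N)) = negBelow N 0 := by
    ext α
    rw [mem_range_toIntExp]
    exact ⟨fun h i hi => absurd hi (not_lt.mpr (h i)),
      fun h i => not_lt.mp fun hi => absurd (h i hi) (Nat.not_lt_zero _)⟩
  obtain ⟨y, hy, hy0, hzy⟩ := koszul_exact_mod hc hzero N 0 p (by omega) hp z hz
    (fun J => hrange ▸ hz0 J) fun J => by rw [hD]; exact zero_mem _
  refine ⟨y, hy, fun J => hrange ▸ hy0 J, funext fun J => ?_⟩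
  -- No coordinate lies below 0, so `negProper N 0` is empty and the congruence is an equality.
  have h : ∀ α, (z - totalDiff (seriesOps c) y) J α = 0 := fun α =>
    hzy J α fun h => absurd h.2.choose_spec.1 (Nat.not_lt_zero _)
  ext α
  have := h α
  rw [Pi.sub_apply, lp.coeFn_sub, Pi.sub_apply, sub_eq_zero] at this
  exact this.symm

end KoszulExact

/-! ### Exactness of the Koszul complex over the convergent power series -/

section ConvergentKoszul

variable {N : ℕ}

/-- The coefficients of the series in the rescaled variables `x / ρ`. -/
def scaledCoeff (ρ : ℝ) (ν : Fin N →₀ ℕ) : ConvSeries (Fin N) →+ ℂ :=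
  (AddMonoidHom.mulRight ((ρ : ℂ) ^ ν.degree)).comp
    ((MvPowerSeries.coeff ν).toAddMonoidHom.comp (toSeries (Fin N)).toRingHom.toAddMonoidHom)

theorem scaledCoeff_apply (ρ : ℝ) (ν : Fin N →₀ ℕ) (g : ConvSeries (Fin N)) :
    scaledCoeff ρ ν g = MvPowerSeries.coeff ν (toSeries _ g) * (ρ : ℂ) ^ ν.degree := rfl

theorem norm_scaledCoeff {ρ : ℝ} (hρ : 0 < ρ) (ν : Fin N →₀ ℕ) (g : ConvSeries (Fin N)) :
    ‖scaledCoeff ρ ν g‖ = ‖MvPowerSeries.coeff ν (toSeries _ g)‖ * ρ ^ ν.degree := by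
  rw [scaledCoeff_apply, norm_mul, norm_pow, Complex.norm_real, Real.norm_of_nonneg hρ.le]

theorem eq_of_scaledCoeff {ρ : ℝ} (hρ : 0 < ρ) {a b : ConvSeries (Fin N)}
    (h : ∀ ν, scaledCoeff ρ ν a = scaledCoeff ρ ν b) : a = b := by
  apply toSeries_injective
  ext ν
  have h1 := h ν
  rw [scaledCoeff_apply, scaledCoeff_apply] at h1
  exact mul_right_cancel₀ (pow_ne_zero _ (Complex.ofReal_ne_zero.mpr hρ.ne')) h1

theorem scaledCoeff_mul (ρ : ℝ) (γ : Fin N →₀ ℕ) (a b : ConvSeries (Fin N)) :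
    scaledCoeff ρ γ (a * b) =
      ∑ x ∈ Finset.HasAntidiagonal.antidiagonal γ, scaledCoeff ρ x.1 a * scaledCoeff ρ x.2 b := by
  rw [scaledCoeff_apply, map_mul, MvPowerSeries.coeff_mul, Finset.sum_mul]
  refine Finset.sum_congr rfl fun x hx => ?_
  rw [scaledCoeff_apply, scaledCoeff_apply, ← Finset.HasAntidiagonal.mem_antidiagonal.mp hx,
    map_add, pow_add]
  ring

open Filter Topology in
theorem eventually_summable_scaledCoeff (g : ConvSeries (Fin N)) :
    ∀ᶠ ρ in 𝓝[>] (0 : ℝ), Summable fun ν => ‖scaledCoeff ρ ν g‖ := by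
  obtain ⟨r, hr, h⟩ := g.2
  filter_upwards [Ioc_mem_nhdsGT hr] with ρ hρ
  refine h.of_nonneg_of_le (fun ν => norm_nonneg _) fun ν => ?_
  rw [norm_scaledCoeff hρ.1]
  have := hρ.1.le
  have := hρ.2
  gcongr
  rfl

theorem tsum_scaledCoeff_mul_prod (ρ : ℝ) (g : ConvSeries (Fin N)) (z : Fin N → ℂ) :
    ∑' ν, scaledCoeff ρ ν g * (ν.prod fun i k => z i ^ k) = evalAt g fun i => ρ * z i := by
  refine tsum_congr fun ν => ?_
  rw [scaledCoeff_apply, mul_assoc]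
  congr 1
  simp only [Finsupp.prod, mul_pow, Finset.prod_mul_distrib, Finset.prod_pow_eq_pow_sum,
    Finsupp.degree_apply]

/-- The family `b` consists of the coefficients of `g` in the rescaled variables. -/
def Represents (ρ : ℝ) (b : LaurentL1 N) (g : ConvSeries (Fin N)) : Prop :=
  b ∈ supportedIn (Set.range toIntExp) ∧ ∀ ν, b (toIntExp ν) = scaledCoeff ρ ν g

theorem exists_represents {ρ : ℝ} {g : ConvSeries (Fin N)}
    (h : Summable fun ν => ‖scaledCoeff ρ ν g‖) : ∃ b : LaurentL1 N, Represents ρ b g := by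
  have hext : ∀ ν, Function.extend toIntExp (fun ν => scaledCoeff ρ ν g) 0 (toIntExp ν) =
      scaledCoeff ρ ν g := fun ν => toIntExp_injective.extend_apply _ _ _
  have hzero : ∀ α ∉ Set.range (toIntExp (N := N)),
      Function.extend toIntExp (fun ν => scaledCoeff ρ ν g) 0 α = 0 := fun α hα =>
    Function.extend_apply' _ _ _ hα
  refine ⟨⟨Function.extend toIntExp (fun ν => scaledCoeff ρ ν g) 0, memℓp_one_of_summable ?_⟩,
    hzero, hext⟩
  rw [← toIntExp_injective.summable_iff fun α hα => by rw [hzero α hα, norm_zero]]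
  simpa only [Function.comp_def, hext] using h

theorem exists_represented {ρ : ℝ} (hρ : 0 < ρ) {b : LaurentL1 N}
    (hb : b ∈ supportedIn (Set.range toIntExp)) : ∃ g : ConvSeries (Fin N), Represents ρ b g := by
  let s : MvPowerSeries (Fin N) ℂ := fun ν => b (toIntExp ν) * ((ρ : ℂ) ^ ν.degree)⁻¹
  have hs : ∀ ν : Fin N →₀ ℕ,
      MvPowerSeries.coeff ν s * (ρ : ℂ) ^ ν.degree = b (toIntExp ν) := fun ν =>
    inv_mul_cancel_right₀ (pow_ne_zero _ (Complex.ofReal_ne_zero.mpr hρ.ne')) _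
  refine ⟨(⟨s, ρ, hρ, (b.summable.comp_injective toIntExp_injective).congr fun ν => ?_⟩ :
    convSubalgebra (Fin N)), hb, fun ν => (hs ν).symm⟩
  rw [Function.comp_apply, ← hs, norm_mul, norm_pow, Complex.norm_real, Real.norm_of_nonneg hρ.le]

theorem Represents.eq_left {ρ : ℝ} {b b' : LaurentL1 N} {g : ConvSeries (Fin N)}
    (h : Represents ρ b g) (h' : Represents ρ b' g) : b = b' := by
  ext α
  by_cases hα : α ∈ Set.range (toIntExp (N := N))
  · obtain ⟨ν, rfl⟩ := hα
    rw [h.2, h'.2]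
  · rw [h.1 α hα, h'.1 α hα]

theorem Represents.eq_right {ρ : ℝ} (hρ : 0 < ρ) {b : LaurentL1 N} {g g' : ConvSeries (Fin N)}
    (h : Represents ρ b g) (h' : Represents ρ b g') : g = g' :=
  eq_of_scaledCoeff hρ fun ν => by rw [← h.2, h'.2]

theorem range_toIntExp_add {α v : Fin N → ℤ} (hα : α ∈ Set.range (toIntExp (N := N)))
    (hv : ∀ i, 0 ≤ v i) : α + v ∈ Set.range (toIntExp (N := N)) := by
  rw [mem_range_toIntExp] at hα ⊢
  exact fun i => add_nonneg (hα i) (hv i)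

/-- Because b has only non-negative exponents, the convolution at γ is a finite sum over the
decompositions of γ, as in the product of power series. -/
theorem Represents.seriesOp {ρ : ℝ} {b : LaurentL1 N} {g : ConvSeries (Fin N)}
    (h : Represents ρ b g) {a : ConvSeries (Fin N)}
    (ha : Summable fun ν => ‖scaledCoeff ρ ν a‖) :
    Represents ρ (seriesOp (fun ν => scaledCoeff ρ ν a) b) (a * g) := by
  classical
  refine ⟨seriesOp_apply_mem ha (fun α hα v hv => range_toIntExp_add hα hv) h.1, fun γ => ?_⟩
  rw [seriesOp_apply ha, scaledCoeff_mul,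
    tsum_eq_sum (s := (Finset.HasAntidiagonal.antidiagonal γ).image Prod.fst)]
  · rw [Finset.sum_image]
    · refine Finset.sum_congr rfl fun x hx => ?_
      rw [← Finset.HasAntidiagonal.mem_antidiagonal.mp hx, map_add, add_sub_cancel_left, h.2]
    · intro x hx y hy hxy
      have h1 := Finset.HasAntidiagonal.mem_antidiagonal.mp hx
      have h2 := Finset.HasAntidiagonal.mem_antidiagonal.mp hy
      refine Prod.ext hxy (add_left_cancel (a := x.1) ?_)
      rw [h1, hxy, h2]
  · intro ν hν
    rw [h.1, mul_zero]
    rintro ⟨δ, hδ⟩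
    refine hν (Finset.mem_image.mpr ⟨(ν, δ), Finset.HasAntidiagonal.mem_antidiagonal.mpr ?_, rfl⟩)
    apply toIntExp_injective
    rw [map_add, hδ, add_sub_cancel]

theorem Represents.zero (ρ : ℝ) : Represents ρ (0 : LaurentL1 N) 0 :=
  ⟨zero_mem _, fun ν => (map_zero (scaledCoeff ρ ν)).symm⟩

theorem Represents.add {ρ : ℝ} {b b' : LaurentL1 N} {g g' : ConvSeries (Fin N)}
    (h : Represents ρ b g) (h' : Represents ρ b' g') : Represents ρ (b + b') (g + g') :=
  ⟨add_mem h.1 h'.1, fun ν => by rw [lp.coeFn_add, Pi.add_apply, h.2, h'.2, map_add]⟩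

theorem Represents.zsmul {ρ : ℝ} {b : LaurentL1 N} {g : ConvSeries (Fin N)}
    (h : Represents ρ b g) (k : ℤ) : Represents ρ (k • b) (k • g) :=
  ⟨(supportedIn _).toAddSubgroup.zsmul_mem h.1 k, fun ν => by
    rw [map_zsmul, ← h.2]
    rfl⟩

theorem Represents.sum {ρ : ℝ} {ι : Type} (s : Finset ι) {b : ι → LaurentL1 N}
    {g : ι → ConvSeries (Fin N)} (h : ∀ i ∈ s, Represents ρ (b i) (g i)) :
    Represents ρ (∑ i ∈ s, b i) (∑ i ∈ s, g i) := by
  induction s using Finset.cons_induction with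
  | empty => exact Represents.zero ρ
  | cons i s hi ih =>
    rw [Finset.sum_cons, Finset.sum_cons]
    exact (h i (Finset.mem_cons_self i s)).add (ih fun j hj => h j (Finset.mem_cons_of_mem hj))

/-- The multiplications by the partial derivatives of `f`. -/
def jacobianOps (f : ConvSeries (Fin N)) (j : Fin N) : ConvSeries (Fin N) →+ ConvSeries (Fin N) :=
  AddMonoidHom.mulLeft (partialX j f)

theorem Represents.totalDiff {ρ : ℝ} {f : ConvSeries (Fin N)}
    (hf : ∀ j, Summable fun ν => ‖scaledCoeff ρ ν (partialX j f)‖)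
    {b : Finset (Fin N) → LaurentL1 N} {g : Finset (Fin N) → ConvSeries (Fin N)}
    (h : ∀ J, Represents ρ (b J) (g J)) (J : Finset (Fin N)) :
    Represents ρ (totalDiff (seriesOps fun j ν => scaledCoeff ρ ν (partialX j f)) b J)
      (totalDiff (jacobianOps f) g J) :=
  Represents.sum J fun j _ => ((h _).seriesOp (hf j)).zsmul _

/-- The Koszul complex of the partial derivatives of a function with an isolated singularity is
exact below the top degree. -/
theorem koszul_exact {n : ℕ} {f : ConvSeries (Fin (n + 1))} (hf : IsolatedSingularity f) {p : ℕ}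
    (hp : p < n + 1) (z : Finset (Fin (n + 1)) → ConvSeries (Fin (n + 1)))
    (hz : IsHomogeneousForm p z) (hD : totalDiff (jacobianOps f) z = 0) :
    ∃ y : Finset (Fin (n + 1)) → ConvSeries (Fin (n + 1)), (∀ J, y J ≠ 0 → J.card + 1 = p) ∧
      totalDiff (jacobianOps f) y = z := by
  obtain ⟨-, r, hr, hcrit⟩ := hf
  -- Only finitely many series occur, so one small radius ρ makes all of them summable. With ρ < r
  -- the rescaled closed unit polydisc contains no critical point except the origin.
  obtain ⟨ρ, ⟨hsf, hsz⟩, hρ0, hρr⟩ := ((Filter.eventually_all.mpr fun j =>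
    eventually_summable_scaledCoeff (partialX j f)).and (Filter.eventually_all.mpr fun J =>
    eventually_summable_scaledCoeff (z J)) |>.and (Ioo_mem_nhdsGT hr)).exists
  choose b hb using fun J => exists_represents (hsz J)
  have hcommon : ∀ w : Fin (n + 1) → ℂ, (∀ i, ‖w i‖ ≤ 1) → w ≠ 0 →
      ∃ j, ∑' ν, scaledCoeff ρ ν (partialX j f) * (ν.prod fun i k => w i ^ k) ≠ 0 := by
    intro w hw hw0
    by_contra! hall
    refine hw0 (funext fun i => ?_)
    have := congrFun (hcrit (fun i => ρ * w i) (fun i => ?_) fun j => ?_) i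
    · exact (mul_eq_zero.mp this).resolve_left (Complex.ofReal_ne_zero.mpr hρ0.ne')
    · rw [norm_mul, Complex.norm_real, Real.norm_of_nonneg hρ0.le]
      exact (mul_le_of_le_one_right hρ0.le (hw i)).trans_lt hρr
    · rw [← tsum_scaledCoeff_mul_prod]
      exact hall j
  have hhom : IsHomogeneousForm p b := by
    intro J hJ
    refine hz J fun h => hJ ?_
    have := hb J
    rw [h] at this
    exact this.eq_left (Represents.zero ρ)
  have hDb : totalDiff (seriesOps fun j ν => scaledCoeff ρ ν (partialX j f)) b = 0 := by
    funext J
    have := Represents.totalDiff hsf hb J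
    rw [hD] at this
    exact this.eq_left (Represents.zero ρ)
  obtain ⟨y, hy, hy0, hyb⟩ := koszul_exact_of_summable hsf hcommon hp b hhom
    (fun J => (hb J).1) hDb
  choose g hg using fun J => exists_represented hρ0 (hy0 J)
  refine ⟨g, fun J hJ => hy J fun h => hJ ?_, funext fun J => ?_⟩
  · have := hg J
    rw [h] at this
    exact this.eq_right hρ0 (Represents.zero ρ)
  · have := Represents.totalDiff hsf hg J
    rw [hyb] at this
    exact this.eq_right hρ0 (hb J)

end ConvergentKoszul

/-! ### The formal Brieskorn lattice in the formal Gauss-Manin system -/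

section LatticeInjective

variable {n : ℕ}

theorem opP_comm (f : ConvSeries (Fin (n + 1))) (i j : Fin (n + 1)) (x : CoefP n) :
    opP f i (opP f j x) = opP f j (opP f i x) := by
  have hd : ∀ (j : Fin (n + 1)) (a : ConvSeries (Fin (n + 1))) (x : CoefP n),
      dP j (PowerSeries.C a * x) =
        PowerSeries.C (partialX j a) * x + PowerSeries.C a * dP j x := by
    intro j a x
    ext k : 1
    simp [coeff_dP, PowerSeries.coeff_C_mul, partialX_mul]
  have hcomm : ∀ a : ConvSeries (Fin (n + 1)), partialX i (partialX j a) =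
      partialX j (partialX i a) := by
    intro a
    apply toSeries_injective
    simp only [toSeries_partialX]
    ext ν
    simp only [MvPowerSeries.coeff_pderiv]
    rcases eq_or_ne i j with rfl | hij
    · rfl
    · rw [add_right_comm]
      simp [Finsupp.single_eq_of_ne hij, Finsupp.single_eq_of_ne hij.symm]
      ring
  have hdd : dP i (dP j x) = dP j (dP i x) := by
    ext k : 1
    simp only [coeff_dP, hcomm]
  simp only [opP, opPt_apply, map_sub, dP_X_mul, hd, hdd, hcomm]
  ring

/-- The differential `u d - df ∧` on forms of all degrees. -/
def totalDiffP (f : ConvSeries (Fin (n + 1))) :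
    (Finset (Fin (n + 1)) → CoefP n) →+ (Finset (Fin (n + 1)) → CoefP n) :=
  totalDiff fun j => (opP f j).toAddMonoidHom

theorem totalDiffP_totalDiffP (f : ConvSeries (Fin (n + 1)))
    (η : Finset (Fin (n + 1)) → CoefP n) : totalDiffP f (totalDiffP f η) = 0 :=
  totalDiff_totalDiff _ (opP_comm f) η

theorem coeff_zero_totalDiffP (f : ConvSeries (Fin (n + 1))) (η : Finset (Fin (n + 1)) → CoefP n)
    (J : Finset (Fin (n + 1))) :
    PowerSeries.coeff 0 (totalDiffP f η J) =
      -totalDiff (jacobianOps f) (fun J => PowerSeries.coeff 0 (η J)) J := by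
  rw [totalDiffP, totalDiff_apply, totalDiff_apply, map_sum, ← Finset.sum_neg_distrib]
  refine Finset.sum_congr rfl fun j _ => ?_
  rw [map_zsmul, ← zsmul_neg]
  congr 1
  change PowerSeries.coeff 0 (PowerSeries.X * dP j _ - PowerSeries.C (partialX j f) * _) = _
  rw [map_sub, PowerSeries.coeff_zero_X_mul, PowerSeries.coeff_C_mul, zero_sub]
  rfl

theorem totalDiffP_X_mul (f : ConvSeries (Fin (n + 1))) (η : Finset (Fin (n + 1)) → CoefP n) :
    totalDiffP f (fun J => PowerSeries.X * η J) = fun J => PowerSeries.X * totalDiffP f η J := by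
  funext J
  rw [totalDiffP, totalDiff_apply, totalDiff_apply, Finset.mul_sum]
  refine Finset.sum_congr rfl fun j _ => ?_
  rw [mul_smul_comm]
  congr 1
  exact (mul_opPt _ _ f j PowerSeries.X (dP_X_mul j) _).symm

/-- This says that the top cohomology over O[[u]] has no u-torsion. If D η is divisible by u, the
constant term of η is killed by df∧, hence is df∧y by Koszul exactness in degree n. Adding D y makes
η divisible by u without changing D η, and one factor u can be cancelled. -/
theorem exists_primitive_of_X_pow_mul {f : ConvSeries (Fin (n + 1))} (hf : IsolatedSingularity f)
    (ω : Finset (Fin (n + 1)) → CoefP n) (k : ℕ) :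
    ∀ η : Finset (Fin (n + 1)) → CoefP n, IsHomogeneousForm n η →
      (totalDiffP f η = fun J => PowerSeries.X ^ k * ω J) →
      ∃ η' : Finset (Fin (n + 1)) → CoefP n, IsHomogeneousForm n η' ∧ totalDiffP f η' = ω := by
  induction k with
  | zero => intro η hη h; exact ⟨η, hη, by simpa using h⟩
  | succ k ih =>
    intro η hη h
    obtain ⟨y, hy, hyz⟩ := koszul_exact hf (Nat.lt_succ_self n)
      (fun J => PowerSeries.coeff 0 (η J)) (fun J hJ => hη J fun h => hJ (by simp [h])) <| by
        funext J
        have h1 := coeff_zero_totalDiffP f η J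
        rw [h] at h1
        simp only [pow_succ', mul_assoc, PowerSeries.coeff_zero_X_mul] at h1
        exact neg_eq_zero.mp h1.symm
    -- The sign is plus because at u = 0 the differential is -df∧.
    obtain ⟨ζ, hζ⟩ : ∃ ζ, ζ = η + totalDiffP f (fun J => PowerSeries.C (y J)) := ⟨_, rfl⟩
    have hζ0 : ∀ J, PowerSeries.coeff 0 (ζ J) = 0 := by
      intro J
      rw [hζ, Pi.add_apply, map_add, coeff_zero_totalDiffP]
      simp only [PowerSeries.coeff_zero_C, hyz]
      exact add_neg_cancel _
    have hζh : IsHomogeneousForm n ζ := by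
      intro J hJ
      by_contra hne
      apply hJ
      have h1 : η J = 0 := by_contra fun h => hne (hη J h)
      have h2 : totalDiffP f (fun J => PowerSeries.C (y J)) J = 0 := by
        refine Finset.sum_eq_zero fun j hj => ?_
        have h3 : y (J.erase j) = 0 := by
          by_contra h
          have := hy _ h
          rw [Finset.card_erase_add_one hj] at this
          exact hne this
        simp only [h3, map_zero, smul_zero]
      rw [hζ, Pi.add_apply, h1, h2, add_zero]
    have hDζ : totalDiffP f ζ = totalDiffP f η := by
      rw [hζ, map_add, totalDiffP_totalDiffP, add_zero]
    have hcancel : ∀ a b : CoefP n, PowerSeries.X * a = PowerSeries.X * b → a = b := by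
      intro a b hab
      ext k : 1
      have := congrArg (PowerSeries.coeff (k + 1)) hab
      rwa [PowerSeries.coeff_succ_X_mul, PowerSeries.coeff_succ_X_mul] at this
    choose ξ hξ using fun J => (PowerSeries.X_dvd_iff.mpr
      ((PowerSeries.coeff_zero_eq_constantCoeff_apply _).symm.trans (hζ0 J)) :
        PowerSeries.X ∣ ζ J)
    obtain rfl : ζ = fun J => PowerSeries.X * ξ J := funext hξ
    refine ih ξ (fun J hJ => hζh J fun h => hJ (hcancel _ _ ?_)) (funext fun J => hcancel _ _ ?_)
    · rw [mul_zero]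
      exact h
    · rw [totalDiffP_X_mul, h] at hDζ
      rw [← mul_assoc, ← pow_succ']
      exact congrFun hDζ J

/-! ### Clearing denominators between O[[u]] and O((u)), and the relations among u, t and the
lattice. -/

theorem PtoL_injective : Function.Injective (PtoL n) := HahnSeries.ofPowerSeries_injective

theorem PtoL_X_pow (k : ℕ) : PtoL n (PowerSeries.X ^ k) = uPow n k := by
  induction k with
  | zero => rw [pow_zero, map_one]; rfl
  | succ k ih => rw [pow_succ, map_mul, ih, PtoL_X, ← uPow_add]; rfl

-- Stated for all large k, so that finitely many coefficients can be cleared of poles by one power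
-- of u.
open Filter in
theorem eventually_uPow_mul_mem_range (g : CoefL n) :
    ∀ᶠ k : ℕ in atTop, ∃ p, PtoL n p = uPow n k * g := by
  have h := LaurentSeries.single_order_mul_powerSeriesPart
    (g : LaurentSeries (ConvSeries (Fin (n + 1))))
  filter_upwards [eventually_ge_atTop (HahnSeries.order
    (g : LaurentSeries (ConvSeries (Fin (n + 1))))).natAbs] with k hk
  set d : ℤ := HahnSeries.order (g : LaurentSeries (ConvSeries (Fin (n + 1)))) with hd
  obtain ⟨l, hl⟩ : ∃ l : ℕ, (l : ℤ) = k + d := ⟨(k + d).toNat, by omega⟩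
  refine ⟨PowerSeries.X ^ l * LaurentSeries.powerSeriesPart
    (g : LaurentSeries (ConvSeries (Fin (n + 1)))), ?_⟩
  rw [map_mul, PtoL_X_pow, hl, uPow_add, mul_assoc]
  exact congrArg (uPow n k * ·) h

theorem exists_uPow_mul_eq_PtoL {ι : Type} [Finite ι] (η : ι → CoefL n) :
    ∃ k : ℕ, ∃ p : ι → CoefP n, ∀ i, PtoL n (p i) = uPow n k * η i := by
  obtain ⟨k, hk⟩ := (Filter.eventually_all.mpr fun i => eventually_uPow_mul_mem_range (η i)).exists
  choose p hp using hk
  exact ⟨k, p, hp⟩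

theorem diff_map_PtoL (f : ConvSeries (Fin (n + 1))) (p : ℕ) (η : Form (n + 1) p (CoefP n)) :
    Form.map (PtoL n).toAddMonoidHom (diff (opP f) p η) =
      diff (opL f) p (Form.map (PtoL n).toAddMonoidHom η) :=
  Form.map_diff (PtoL n).toAddMonoidHom (PtoL n).toAddMonoidHom (fun j x =>
    map_opPt _ _ _ f j (PtoL n) _ _ _ PtoL_X PtoL_C (PtoL_dP j) x) η

theorem diff_uPow_mul (f : ConvSeries (Fin (n + 1))) (k : ℤ) (p : ℕ)
    (η : Form (n + 1) p (CoefL n)) :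
    diff (opL f) p (fun J => uPow n k * η J) = fun J => uPow n k * diff (opL f) p η J :=
  (Form.map_diff (AddMonoidHom.mulLeft (uPow n k)) (AddMonoidHom.mulLeft (uPow n k)) (fun j x =>
    mul_opPt _ _ f j (uPow n k) (dL_uPow_mul j k) x) η).symm

theorem toGM_mk (f : ConvSeries (Fin (n + 1))) (ω : Form (n + 1) (n + 1) (CoefP n)) :
    toGM f (Submodule.Quotient.mk ω) = Submodule.Quotient.mk fun J => PtoL n (ω J) := rfl

theorem uGM_mk (f : ConvSeries (Fin (n + 1))) (k : ℤ) (ω : Form (n + 1) (n + 1) (CoefL n)) :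
    uGM f k (Submodule.Quotient.mk ω) = Submodule.Quotient.mk fun J => uPow n k * ω J := rfl

theorem tGM_mk (f : ConvSeries (Fin (n + 1))) (ω : Form (n + 1) (n + 1) (CoefL n)) :
    tGM f (Submodule.Quotient.mk ω) =
      Submodule.Quotient.mk fun J => constL n f * ω J + thetaL (ω J) := rfl

/-- If ω is exact over O((u)), clearing the poles of a primitive shows that uᵏω is exact over
O[[u]], and then ω is exact because there is no u-torsion. -/
theorem toGM_injective {f : ConvSeries (Fin (n + 1))} (hf : IsolatedSingularity f) :
    Function.Injective (toGM f) := by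
  rw [injective_iff_map_eq_zero]
  intro x hx
  obtain ⟨ω, rfl⟩ := Submodule.Quotient.mk_surjective _ x
  rw [toGM_mk, Submodule.Quotient.mk_eq_zero] at hx
  obtain ⟨η, hη⟩ := hx
  obtain ⟨k, p, hp⟩ := exists_uPow_mul_eq_PtoL η
  have h1 : diff (opP f) n p = fun J => PowerSeries.X ^ k * ω J := by
    funext J
    apply PtoL_injective
    have h2 := congrFun (diff_map_PtoL f n p) J
    have h3 : Form.map (PtoL n).toAddMonoidHom p = fun J => uPow n k * η J := funext hp
    rw [h3, diff_uPow_mul, hη] at h2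
    rw [map_mul, PtoL_X_pow]
    exact h2
  obtain ⟨η', -, hη'⟩ := exists_primitive_of_X_pow_mul hf (Form.extend ω) k (Form.extend p)
    (Form.isHomogeneousForm_extend p) <| by
      rw [totalDiffP, totalDiff_extend, h1]
      funext J
      simp only [Form.extend]
      split_ifs
      · rfl
      · rw [mul_zero]
  rw [Submodule.Quotient.mk_eq_zero]
  refine ⟨fun J => η' J.1, funext fun J => ?_⟩
  rw [diff_restrict]
  have h4 := congrFun hη' J.1
  rw [Form.extend_apply] at h4
  exact h4

theorem exists_uGM_eq_toGM (f : ConvSeries (Fin (n + 1))) (g : GaussManin f) :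
    ∃ k : ℕ, ∃ h, toGM f h = uGM f k g := by
  obtain ⟨ω, rfl⟩ := Submodule.Quotient.mk_surjective _ g
  obtain ⟨k, p, hp⟩ := exists_uPow_mul_eq_PtoL ω
  exact ⟨k, Submodule.Quotient.mk p, congrArg Submodule.Quotient.mk (funext hp)⟩

theorem uGM_add (f : ConvSeries (Fin (n + 1))) (k l : ℤ) (g : GaussManin f) :
    uGM f (k + l) g = uGM f k (uGM f l g) := by
  obtain ⟨ω, rfl⟩ := Submodule.Quotient.mk_surjective _ g
  refine congrArg Submodule.Quotient.mk (funext fun J => ?_)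
  change uPow n (k + l) * ω J = uPow n k * (uPow n l * ω J)
  rw [uPow_add, mul_assoc]

theorem uGM_zero (f : ConvSeries (Fin (n + 1))) (g : GaussManin f) : uGM f 0 g = g := by
  obtain ⟨ω, rfl⟩ := Submodule.Quotient.mk_surjective _ g
  refine congrArg Submodule.Quotient.mk (funext fun J => ?_)
  change uPow n 0 * ω J = ω J
  rw [uPow_zero, one_mul]

theorem toGM_uLattice (f : ConvSeries (Fin (n + 1))) (x : Lattice f) :
    toGM f (uLattice f x) = uGM f 1 (toGM f x) := by
  obtain ⟨ω, rfl⟩ := Submodule.Quotient.mk_surjective _ x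
  refine congrArg Submodule.Quotient.mk (funext fun J => ?_)
  change PtoL n (PowerSeries.X * ω J) = uPow n 1 * PtoL n (ω J)
  rw [map_mul, PtoL_X]

theorem PtoL_smul (c : ℂ) (g : CoefP n) : PtoL n (c • g) = c • PtoL n g := by
  refine CoefL.ext fun k => ?_
  rw [CoefL.coeff_smul]
  rcases lt_or_ge k 0 with hk | hk
  · rw [coeff_PtoL_neg _ hk, coeff_PtoL_neg _ hk, smul_zero]
  · lift k to ℕ using hk
    rw [coeff_PtoL_natCast, coeff_PtoL_natCast]
    rfl

theorem toGM_smul (f : ConvSeries (Fin (n + 1))) (c : ℂ) (x : Lattice f) :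
    toGM f (c • x) = c • toGM f x := by
  obtain ⟨ω, rfl⟩ := Submodule.Quotient.mk_surjective _ x
  refine congrArg Submodule.Quotient.mk (funext fun J => ?_)
  exact PtoL_smul c (ω J)

theorem thetaL_uPow_mul (k : ℤ) (g : CoefL n) :
    thetaL (uPow n k * g) = k • (uPow n (k + 1) * g) + uPow n k * thetaL g := by
  refine CoefL.ext fun l => ?_
  have hz : (k • (uPow n (k + 1) * g)).coeff l = k • (uPow n (k + 1) * g).coeff l := rfl
  rw [CoefL.coeff_add, hz]
  simp only [coeff_thetaL, CoefL.coeff_uPow_mul]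
  rw [show l - 1 - k = l - (k + 1) by ring, show l - k - 1 = l - (k + 1) by ring, ← add_smul]
  congr 1
  ring

theorem tGM_uGM (f : ConvSeries (Fin (n + 1))) (k : ℤ) (g : GaussManin f) :
    tGM f (uGM f k g) = uGM f k (tGM f g) + k • uGM f (k + 1) g := by
  obtain ⟨ω, rfl⟩ := Submodule.Quotient.mk_surjective _ g
  rw [uGM_mk, tGM_mk, tGM_mk, uGM_mk, uGM_mk, ← Submodule.Quotient.mk_smul,
    ← Submodule.Quotient.mk_add]
  refine congrArg Submodule.Quotient.mk (funext fun J => ?_)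
  change constL n f * (uPow n k * ω J) + thetaL (uPow n k * ω J) =
    uPow n k * (constL n f * ω J + thetaL (ω J)) + k • (uPow n (k + 1) * ω J)
  rw [thetaL_uPow_mul]
  ring

end LatticeInjective

/-! ### Complements of a lattice that are stable under `u⁻¹` -/

section Tail

variable {H G : Type} [AddCommGroup H] [Module ℂ H] [AddCommGroup G] [Module ℂ G]

/-- `H` is, by means of `j`, a lattice in the module `G` on which `u` is invertible. -/
structure IsLatticeMap (j : H →ₗ[ℂ] G) (U : ℤ → G →ₗ[ℂ] G) (uH : H →ₗ[ℂ] H) : Prop where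
  inj : ∀ x, j x = 0 → x = 0
  add : ∀ k l g, U (k + l) g = U k (U l g)
  zero : ∀ g, U 0 g = g
  comm : ∀ x, j (uH x) = U 1 (j x)
  exhaust : ∀ g, ∃ k : ℕ, ∃ x, j x = U k g

/-- `I` is a complement of the image of `u`. -/
structure IsComplement (uH : H →ₗ[ℂ] H) (I : Submodule ℂ H) : Prop where
  disjoint : ∀ x, uH x ∈ I → uH x = 0
  exists_add : ∀ x, ∃ i ∈ I, ∃ y, x = i + uH y

/-- The sum of the `u ^ (-k) I` for `k ≤ K`. -/
def tailLevel (j : H →ₗ[ℂ] G) (U : ℤ → G →ₗ[ℂ] G) (I : Submodule ℂ H) : ℕ → Submodule ℂ G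
  | 0 => I.map j
  | K + 1 => I.map j ⊔ (tailLevel j U I K).map (U (-1))

/-- The sum of the `u ^ (-k) I` for `k ≥ 0`. -/
def tail (j : H →ₗ[ℂ] G) (U : ℤ → G →ₗ[ℂ] G) (I : Submodule ℂ H) : Submodule ℂ G :=
  ⨆ K, tailLevel j U I K

variable {j : H →ₗ[ℂ] G} {U : ℤ → G →ₗ[ℂ] G} {uH : H →ₗ[ℂ] H} {I : Submodule ℂ H}

theorem tailLevel_mono : Monotone (tailLevel j U I) := by
  refine monotone_nat_of_le_succ fun K => ?_
  induction K with
  | zero => exact le_sup_left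
  | succ K ih => exact sup_le_sup_left (Submodule.map_mono ih) _

theorem mem_tail {w : G} : w ∈ tail j U I ↔ ∃ K, w ∈ tailLevel j U I K :=
  Submodule.mem_iSup_of_directed _ tailLevel_mono.directed_le

theorem map_mem_tail {x : H} (hx : x ∈ I) : j x ∈ tail j U I :=
  mem_tail.mpr ⟨0, Submodule.mem_map_of_mem hx⟩

theorem neg_one_mem_tail {w : G} (hw : w ∈ tail j U I) : U (-1) w ∈ tail j U I := by
  obtain ⟨K, hK⟩ := mem_tail.mp hw
  exact mem_tail.mpr ⟨K + 1, Submodule.mem_sup_right (Submodule.mem_map_of_mem hK)⟩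

theorem exists_of_mem_tailLevel_succ {K : ℕ} {w : G} (hw : w ∈ tailLevel j U I (K + 1)) :
    ∃ i ∈ I, ∃ w' ∈ tailLevel j U I K, w = j i + U (-1) w' := by
  obtain ⟨_, ⟨i, hi, rfl⟩, _, ⟨w', hw', rfl⟩, h⟩ := Submodule.mem_sup.mp hw
  exact ⟨i, hi, w', hw', h.symm⟩

theorem exists_of_mem_tail {w : G} (hw : w ∈ tail j U I) :
    ∃ i ∈ I, ∃ w' ∈ tail j U I, w = j i + U (-1) w' := by
  obtain ⟨K, hK⟩ := mem_tail.mp hw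
  obtain ⟨i, hi, w', hw', h⟩ := exists_of_mem_tailLevel_succ (tailLevel_mono (Nat.le_succ K) hK)
  exact ⟨i, hi, w', mem_tail.mpr ⟨K, hw'⟩, h⟩

theorem tail_induction {p : G → Prop} (h0 : ∀ x ∈ I, p (j x)) (hadd : ∀ a b, p a → p b → p (a + b))
    (hU : ∀ w ∈ tail j U I, p w → p (U (-1) w)) {w : G} (hw : w ∈ tail j U I) : p w := by
  obtain ⟨K, hK⟩ := mem_tail.mp hw
  clear hw
  induction K generalizing w with
  | zero =>
    obtain ⟨x, hx, rfl⟩ := hK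
    exact h0 x hx
  | succ K ih =>
    obtain ⟨i, hi, w', hw', rfl⟩ := exists_of_mem_tailLevel_succ hK
    exact hadd _ _ (h0 i hi) (hU _ (mem_tail.mpr ⟨K, hw'⟩) (ih hw'))

namespace IsLatticeMap

variable (h : IsLatticeMap j U uH)
include h

theorem one_neg_one (g : G) : U 1 (U (-1) g) = g := by
  rw [← h.add, add_neg_cancel, h.zero]

theorem neg_one_one (g : G) : U (-1) (U 1 g) = g := by
  rw [← h.add, neg_add_cancel, h.zero]

/-- This is H ∩ u⁻¹I[u⁻¹] = 0, by induction on the number of negative powers. If u x = i + u⁻¹w',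
then w' = u(u x - i), so u x = i by induction; this lies in I ∩ uH = 0, and u is injective on H. -/
theorem map_mem_neg_tail (hI : IsComplement uH I) {x : H} (hx : U 1 (j x) ∈ tail j U I) :
    x = 0 := by
  have hu : ∀ x, uH x = 0 → x = 0 := by
    intro x hx
    apply h.inj
    rw [← h.neg_one_one (j x), ← h.comm, hx, map_zero, map_zero]
  obtain ⟨K, hK⟩ := mem_tail.mp hx
  clear hx
  induction K generalizing x with
  | zero =>
    obtain ⟨i, hi, hix⟩ := hK
    have h1 : i = uH x := by
      rw [← sub_eq_zero]
      apply h.inj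
      rw [map_sub, hix, h.comm, sub_self]
    exact hu x (hI.disjoint x (h1 ▸ hi))
  | succ K ih =>
    -- The induction hypothesis applies to u x - i, whose image under u is w', with one negative
    -- power fewer.
    obtain ⟨i, hi, w', hw', hw⟩ := exists_of_mem_tailLevel_succ hK
    have h1 : w' = U 1 (j (uH x - i)) := by
      rw [map_sub, h.comm, hw, add_sub_cancel_left, h.one_neg_one]
    have h2 : uH x = i := sub_eq_zero.mp (ih (h1 ▸ hw'))
    exact hu x (hI.disjoint x (h2 ▸ hi))

theorem mem_of_map_mem_tail (hI : IsComplement uH I) {x : H} (hx : j x ∈ tail j U I) : x ∈ I := by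
  obtain ⟨i, hi, w', hw', hw⟩ := exists_of_mem_tail hx
  have h1 : w' = U 1 (j (x - i)) := by
    rw [map_sub, hw, add_sub_cancel_left, h.one_neg_one]
  have h2 : x - i = 0 := h.map_mem_neg_tail hI (h1 ▸ hw')
  rwa [sub_eq_zero.mp h2]

/-- This is G = H + u⁻¹I[u⁻¹], by induction on the pole order: writing y = i + u y' turns
u^{-(k+1)}y into u^{-(k+1)}i + u^{-k}y', whose first term is in the tail. -/
theorem exists_add_neg_tail (hI : IsComplement uH I) (g : G) :
    ∃ x, ∃ w ∈ (tail j U I).map (U (-1)), g = j x + w := by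
  obtain ⟨k, y, hy⟩ := h.exhaust g
  obtain rfl : g = U (-(k : ℤ)) (j y) := by rw [hy, ← h.add, neg_add_cancel, h.zero]
  clear hy
  induction k generalizing y with
  | zero => exact ⟨y, 0, zero_mem _, by rw [Nat.cast_zero, neg_zero, h.zero, add_zero]⟩
  | succ k ih =>
    obtain ⟨i, hi, y', rfl⟩ := hI.exists_add y
    obtain ⟨x, w, hw, hx⟩ := ih y'
    have hmem : ∀ k : ℕ, U (-k) (j i) ∈ tail j U I := by
      intro k
      induction k with
      | zero => rw [Nat.cast_zero, neg_zero, h.zero]; exact map_mem_tail hi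
      | succ k ih =>
        rw [Nat.cast_succ, neg_add_rev, h.add]
        exact neg_one_mem_tail ih
    refine ⟨x, U (-(k + 1 : ℕ)) (j i) + w, add_mem ⟨_, hmem k, ?_⟩ hw, ?_⟩
    · rw [← h.add, Nat.cast_succ, neg_add_rev]
    · rw [map_add, map_add, add_left_comm, ← hx, h.comm, ← h.add]
      congr 3
      push_cast
      ring

/-- Goodness gives u⁻¹tI ⊂ u⁻¹I + I. The inclusion passes to u⁻¹I[u⁻¹] because the commutator of t
with u⁻¹ is -1, which preserves the tail. -/
theorem neg_one_t_mem_tail {t : G →+ G} (ht : ∀ k g, t (U k g) = U k (t g) + k • U (k + 1) g)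
    (hgood : ∀ x ∈ I, ∃ y ∈ I, ∃ z ∈ I, t (j x) = j y + U 1 (j z)) {w : G}
    (hw : w ∈ tail j U I) : U (-1) (t w) ∈ tail j U I := by
  refine tail_induction (p := fun w => U (-1) (t w) ∈ tail j U I) ?_ ?_ ?_ hw
  · intro x hx
    obtain ⟨y, hy, z, hz, hyz⟩ := hgood x hx
    rw [hyz, map_add, h.neg_one_one]
    exact add_mem (neg_one_mem_tail (map_mem_tail hy)) (map_mem_tail hz)
  · intro a b ha hb
    rw [map_add, map_add]
    exact add_mem ha hb
  · intro w hw ih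
    rw [ht, neg_add_cancel, h.zero, map_add, map_zsmul]
    exact add_mem (neg_one_mem_tail ih)
      ((tail j U I).toAddSubgroup.zsmul_mem (neg_one_mem_tail hw) _)

end IsLatticeMap

end Tail

/-! ### Formal deformations of a lattice -/

section Deformation

variable {H G HS GS : Type} {m : ℕ} [AddCommGroup H] [Module ℂ H] [AddCommGroup G] [Module ℂ G]
  [AddCommGroup HS] [Module (MvPowerSeries (Fin m) ℂ) HS] [AddCommGroup GS]

/-- The lattice `HS` in `GS` is a formal deformation of the lattice `H` in `G`, and `GS` is
trivialised along the parameters by the coefficient maps `c`. -/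
structure IsLatticeDeformation (j : H →ₗ[ℂ] G) (U : ℤ → G →ₗ[ℂ] G) (t : G →+ G) (jS : HS →+ GS)
    (US : ℤ → GS →+ GS) (tS : GS →+ GS) (δ : Fin m → GS →+ GS)
    (uHS : HS →ₗ[MvPowerSeries (Fin m) ℂ] HS) (restr : HS →+ H)
    (c : (Fin m →₀ ℕ) → GS →+ G) : Prop where
  c_inj : ∀ y, (∀ ν, c ν y = 0) → y = 0
  c_U : ∀ ν k y, c ν (US k y) = U k (c ν y)
  jS_u : ∀ x, jS (uHS x) = US 1 (jS x)
  c_δ : ∀ ν i y, c ν (δ i y) = (ν i + 1) • c (ν + Finsupp.single i 1) y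
  c_t : ∀ ν y, c ν (tS y) = t (c ν y)
  c_zero : ∀ x, c 0 (jS x) = j (restr x)
  c_smul : ∀ ν (a : MvPowerSeries (Fin m) ℂ) (x : HS), c ν (jS (a • x)) = ∑ p ∈ Finset.HasAntidiagonal.antidiagonal ν,
    MvPowerSeries.coeff p.1 a • c p.2 (jS x)
  lift_t : ∀ x, ∃ x', jS x' = tS (jS x)
  lift_δ : ∀ i x, ∃ x', jS x' = US 1 (δ i (jS x))
  δ_U : ∀ i k y, δ i (US k y) = US k (δ i y)
  exists_sub_mem : ∀ V : Submodule ℂ G, (∀ g, ∃ x, ∃ v ∈ V, g = j x + v) →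
    ∀ y : (Fin m →₀ ℕ) → G, ∃ x, ∀ ν, y ν - c ν (jS x) ∈ V
  eq_zero_of_mem : ∀ V : Submodule ℂ G, (∀ x, j x ∈ V → x = 0) →
    ∀ x, (∀ ν, c ν (jS x) ∈ V) → x = 0

namespace IsLatticeDeformation

variable {j : H →ₗ[ℂ] G} {U : ℤ → G →ₗ[ℂ] G} {t : G →+ G} {jS : HS →+ GS}
  {US : ℤ → GS →+ GS} {tS : GS →+ GS} {δ : Fin m → GS →+ GS}
  {uHS : HS →ₗ[MvPowerSeries (Fin m) ℂ] HS} {restr : HS →+ H}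
  {c : (Fin m →₀ ℕ) → GS →+ G} {uH : H →ₗ[ℂ] H} {I : Submodule ℂ H}
  (hS : IsLatticeDeformation j U t jS US tS δ uHS restr c) (h : IsLatticeMap j U uH)
  (hI : IsComplement uH I)

/-- The elements all of whose coefficients are in `I[u⁻¹]`. -/
def flatPart (I : Submodule ℂ H) : Submodule (MvPowerSeries (Fin m) ℂ) HS where
  carrier := {x | ∀ ν, c ν (jS x) ∈ tail j U I}
  zero_mem' ν := by rw [map_zero, map_zero]; exact zero_mem _
  add_mem' ha hb ν := by rw [map_add, map_add]; exact add_mem (ha ν) (hb ν)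
  smul_mem' a x hx ν := by
    rw [hS.c_smul]
    exact sum_mem fun p _ => Submodule.smul_mem _ _ (hx _)

include hS h hI

theorem eq_zero_of_one_mem {x : HS} (hx : ∀ ν, U 1 (c ν (jS x)) ∈ tail j U I) : x = 0 := by
  refine hS.eq_zero_of_mem ((tail j U I).map (U (-1))) ?_ x fun ν => ⟨_, hx ν, h.neg_one_one _⟩
  rintro y ⟨w, hw, hwy⟩
  refine h.map_mem_neg_tail hI ?_
  rw [← hwy, h.one_neg_one]
  exact hw

theorem exists_sub_mem_tail (y : (Fin m →₀ ℕ) → G) :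
    ∃ x, ∀ ν, U 1 (y ν - c ν (jS x)) ∈ tail j U I := by
  obtain ⟨x, hx⟩ := hS.exists_sub_mem _ (h.exists_add_neg_tail hI) y
  refine ⟨x, fun ν => ?_⟩
  obtain ⟨w, hw, hwν⟩ := hx ν
  rw [← hwν, h.one_neg_one]
  exact hw

/-- With V = u⁻¹I[u⁻¹], an element u y is flat exactly when all coefficients of y lie in V, which
forces y = 0. To split x, choose y in the lattice whose coefficients agree with those of u⁻¹x modulo
V; then x - u y is flat. -/
theorem isCompl_flatPart : IsCompl (hS.flatPart I) (LinearMap.range uHS) := by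
  refine IsCompl.of_le ?_ ?_
  · rintro _ ⟨hx, ⟨y, rfl⟩⟩
    have hy : y = 0 := hS.eq_zero_of_one_mem h hI fun ν => by
      rw [← hS.c_U, ← hS.jS_u]
      exact hx ν
    rw [hy, map_zero]
    exact zero_mem _
  · rintro x -
    obtain ⟨y, hy⟩ := hS.exists_sub_mem_tail h hI fun ν => U (-1) (c ν (jS x))
    refine Submodule.mem_sup.mpr ⟨x - uHS y, fun ν => ?_, uHS y, ⟨y, rfl⟩, sub_add_cancel _ _⟩
    have := hy ν
    rwa [map_sub, h.one_neg_one, ← hS.c_U, ← hS.jS_u, ← map_sub, ← map_sub] at this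

/-- The common source of both goodness conditions. Decompose x = y + u z with y flat; the
coefficients of z are those of u⁻¹x - u⁻¹y, so z is flat as well. -/
theorem exists_of_neg_one_mem {x : HS} (hx : ∀ ν, U (-1) (c ν (jS x)) ∈ tail j U I) :
    ∃ y ∈ hS.flatPart I, ∃ z ∈ hS.flatPart I, jS x = jS y + US 1 (jS z) := by
  have htop : x ∈ hS.flatPart I ⊔ LinearMap.range uHS := by
    rw [(hS.isCompl_flatPart h hI).sup_eq_top]
    trivial
  obtain ⟨y, hy, _, ⟨z, rfl⟩, hyz⟩ := Submodule.mem_sup.mp htop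
  refine ⟨y, hy, z, fun ν => ?_, by rw [← hyz, map_add, hS.jS_u]⟩
  have h1 : c ν (jS z) = U (-1) (c ν (jS x)) - U (-1) (c ν (jS y)) := by
    rw [← hyz, map_add, map_add, map_add, add_sub_cancel_left, hS.jS_u, hS.c_U, h.neg_one_one]
  rw [h1]
  exact sub_mem (hx ν) (neg_one_mem_tail (hy ν))

theorem t_mem_flatPart (ht : ∀ k g, t (U k g) = U k (t g) + k • U (k + 1) g)
    (hgood : ∀ x ∈ I, ∃ y ∈ I, ∃ z ∈ I, t (j x) = j y + U 1 (j z)) {x : HS}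
    (hx : x ∈ hS.flatPart I) :
    ∃ y ∈ hS.flatPart I, ∃ z ∈ hS.flatPart I, tS (jS x) = jS y + US 1 (jS z) := by
  obtain ⟨x', hx'⟩ := hS.lift_t x
  rw [← hx']
  refine hS.exists_of_neg_one_mem h hI fun ν => ?_
  rw [hx', hS.c_t]
  exact h.neg_one_t_mem_tail ht hgood (hx ν)

theorem δ_mem_flatPart (hUS : ∀ k l y, US (k + l) y = US k (US l y)) (hUS0 : ∀ y, US 0 y = y)
    (i : Fin m) {x : HS} (hx : x ∈ hS.flatPart I) :
    ∃ y ∈ hS.flatPart I, ∃ z ∈ hS.flatPart I, δ i (jS x) = jS y + US (-1) (jS z) := by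
  obtain ⟨x', hx'⟩ := hS.lift_δ i x
  -- The previous decomposition is applied to u δᵢx, which lies in the lattice; multiplying it by
  -- u⁻¹ exchanges the roles of the two summands.
  obtain ⟨y, hy, z, hz, hyz⟩ := hS.exists_of_neg_one_mem h hI (x := x') fun ν => by
    rw [hx', hS.c_U, h.neg_one_one, hS.c_δ]
    exact nsmul_mem (hx _) _
  refine ⟨z, hz, y, hy, ?_⟩
  have h1 : δ i (jS x) = US (-1) (jS x') := by rw [hx', ← hUS, neg_add_cancel, hUS0]
  rw [h1, hyz, map_add, ← hUS, neg_add_cancel, hUS0, add_comm]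

theorem restr_mem {x : HS} (hx : x ∈ hS.flatPart I) : restr x ∈ I := by
  refine h.mem_of_map_mem_tail hI ?_
  rw [← hS.c_zero]
  exact hx 0

-- The uniqueness argument. The condition on the δᵢ makes R[u⁻¹] stable under differentiation in s,
-- so every coefficient of an element of R is, up to a non-zero integer, the value at s = 0 of an
-- element of R[u⁻¹].
omit hI in
theorem mem_flatPart_of_good {R : AddSubgroup HS} (hUS : ∀ k l y, US (k + l) y = US k (US l y))
    (hUS0 : ∀ y, US 0 y = y) (hR : ∀ x ∈ R, restr x ∈ I)
    (hδ : ∀ i, ∀ x ∈ R, ∃ y ∈ R, ∃ z ∈ R, δ i (jS x) = jS y + US (-1) (jS z)) {x : HS}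
    (hx : x ∈ R) : x ∈ hS.flatPart I := by
  -- P is R[u⁻¹]; the summand u⁻¹R in the condition on δᵢ makes it necessary to pass from R to P.
  let P : AddSubgroup GS := ⨆ k : ℕ, (R.map jS).map (US (-k))
  have hmem : ∀ (k : ℕ), ∀ x ∈ R, US (-k) (jS x) ∈ P := fun k x hx =>
    AddSubgroup.mem_iSup_of_mem k ⟨_, ⟨x, hx, rfl⟩, rfl⟩
  have hP0 : ∀ y ∈ P, c 0 y ∈ tail j U I := by
    intro y hy
    induction hy using AddSubgroup.iSup_induction' with
    | hp k y hy =>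
      obtain ⟨_, ⟨x, hx, rfl⟩, rfl⟩ := hy
      rw [hS.c_U, hS.c_zero]
      induction k with
      | zero => rw [Nat.cast_zero, neg_zero, h.zero]; exact map_mem_tail (hR x hx)
      | succ k ih =>
        rw [Nat.cast_succ, neg_add_rev, h.add]
        exact neg_one_mem_tail ih
    | h1 => rw [map_zero]; exact zero_mem _
    | hadd a b _ _ ha hb => rw [map_add]; exact add_mem ha hb
  have hPδ : ∀ i, ∀ y ∈ P, δ i y ∈ P := by
    intro i y hy
    induction hy using AddSubgroup.iSup_induction' with
    | hp k y hy =>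
      obtain ⟨_, ⟨x, hx, rfl⟩, rfl⟩ := hy
      obtain ⟨y, hy, z, hz, hyz⟩ := hδ i x hx
      rw [hS.δ_U, hyz, map_add, ← hUS, ← neg_add, ← Nat.cast_succ]
      exact add_mem (hmem k y hy) (hmem (k + 1) z hz)
    | h1 => rw [map_zero]; exact zero_mem _
    | hadd a b _ _ ha hb => rw [map_add]; exact add_mem ha hb
  have hPν : ∀ ν, ∀ y ∈ P, c ν y ∈ tail j U I := by
    intro ν
    induction hd : ν.degree generalizing ν with
    | zero =>
      obtain rfl : ν = 0 := (Finsupp.degree_eq_zero_iff ν).mp hd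
      exact hP0
    | succ d ih =>
      intro y hy
      obtain ⟨i, hi⟩ : ∃ i, ν i ≠ 0 := by
        by_contra! hall
        rw [show ν = 0 from Finsupp.ext hall, map_zero] at hd
        exact Nat.succ_ne_zero d hd.symm
      obtain ⟨μ, rfl⟩ : ∃ μ, ν = μ + Finsupp.single i 1 :=
        ⟨ν - Finsupp.single i 1, (tsub_add_cancel_of_le
          (Finsupp.single_le_iff.mpr (Nat.one_le_iff_ne_zero.mpr hi))).symm⟩
      rw [map_add, Finsupp.degree_single] at hd
      have h1 := ih μ (Nat.succ.inj hd) (δ i y) (hPδ i y hy)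
      -- The factor μᵢ + 1 from differentiating a power of sᵢ is invertible in ℂ.
      rw [hS.c_δ, ← Nat.cast_smul_eq_nsmul ℂ] at h1
      exact (Submodule.smul_mem_iff _ (Nat.cast_ne_zero.mpr (Nat.succ_ne_zero _))).mp h1
  intro ν
  refine hPν ν _ ?_
  have := hmem 0 x hx
  rwa [Nat.cast_zero, neg_zero, hUS0] at this

end IsLatticeDeformation

end Deformation

/-! ### Exponentials of series without constant term -/

section Exponential

variable {σ K : Type} [CommRing K] [Algebra ℂ K]

/-- The partial sums of the exponential series. -/
def expTrunc (g : MvPowerSeries σ K) (M : ℕ) : MvPowerSeries σ K :=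
  ∑ k ∈ Finset.range M, ((k.factorial : ℂ)⁻¹) • g ^ k

/-- The exponential of a series without constant term. -/
def expSeries (g : MvPowerSeries σ K) : MvPowerSeries σ K :=
  fun ν => MvPowerSeries.coeff ν (expTrunc g (ν.degree + 1))

theorem coeff_smul_pow_eq_zero {g : MvPowerSeries σ K} (hg : MvPowerSeries.constantCoeff g = 0)
    (c : ℂ) {k : ℕ} {ν : σ →₀ ℕ} (h : ν.degree < k) : MvPowerSeries.coeff ν (c • g ^ k) = 0 := by
  classical
  have h1 : MvPowerSeries.coeff ν (g ^ k) = 0 :=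
    MvPowerSeries.coeff_eq_zero_of_constantCoeff_nilpotent (m := 1) (by rw [pow_one, hg]) (by omega)
  have h2 : MvPowerSeries.coeff ν (c • g ^ k) = c • MvPowerSeries.coeff ν (g ^ k) := rfl
  rw [h2, h1, smul_zero]

theorem coeff_expTrunc {g : MvPowerSeries σ K} (hg : MvPowerSeries.constantCoeff g = 0) {M : ℕ}
    {ν : σ →₀ ℕ} (h : ν.degree < M) :
    MvPowerSeries.coeff ν (expTrunc g M) = MvPowerSeries.coeff ν (expSeries g) := by
  change _ = MvPowerSeries.coeff ν (expTrunc g (ν.degree + 1))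
  induction M with
  | zero => omega
  | succ M ih =>
    rcases Nat.lt_succ_iff_lt_or_eq.mp h with h' | h'
    · rw [← ih h', expTrunc, expTrunc, Finset.sum_range_succ, map_add,
        coeff_smul_pow_eq_zero hg _ h', add_zero]
    · rw [h']

theorem constantCoeff_expSeries (g : MvPowerSeries σ K) :
    MvPowerSeries.constantCoeff (expSeries g) = 1 := by
  change MvPowerSeries.coeff (0 : σ →₀ ℕ) (expTrunc g ((0 : σ →₀ ℕ).degree + 1)) = 1
  rw [map_zero, zero_add, expTrunc, Finset.sum_range_one, pow_zero, Nat.factorial_zero,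
    Nat.cast_one, inv_one, one_smul]
  exact (MvPowerSeries.constantCoeff (σ := σ) (R := K)).map_one

theorem isUnit_expSeries (g : MvPowerSeries σ K) : IsUnit (expSeries g) := by
  rw [MvPowerSeries.isUnit_iff_constantCoeff, constantCoeff_expSeries]
  exact isUnit_one

/-- The value of a derivation on a multiple of an exponential. -/
theorem derivation_expSeries_mul {g g' : MvPowerSeries σ K}
    (hg : MvPowerSeries.constantCoeff g = 0) (δ : MvPowerSeries σ K →+ MvPowerSeries σ K)
    (hsmul : ∀ (c : ℂ) x, δ (c • x) = c • δ x)
    (hloc : ∀ x (ν : σ →₀ ℕ), (∀ μ : σ →₀ ℕ, μ.degree ≤ ν.degree + 1 →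
      MvPowerSeries.coeff μ x = 0) → MvPowerSeries.coeff ν (δ x) = 0)
    (hδ : ∀ x, δ (g * x) = g' * x + g * δ x) (x : MvPowerSeries σ K) :
    δ (expSeries g * x) = g' * expSeries g * x + expSeries g * δ x := by
  classical
  have hpow : ∀ (k : ℕ) (x : MvPowerSeries σ K), δ (g ^ (k + 1) * x) =
      ((k + 1 : ℕ) : ℂ) • (g' * g ^ k * x) + g ^ (k + 1) * δ x := by
    intro k
    induction k with
    | zero => intro x; simp [hδ]
    | succ k ih =>
      intro x
      rw [pow_succ g (k + 1), mul_assoc, ih, hδ]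
      simp only [Nat.cast_smul_eq_nsmul, nsmul_eq_mul]
      push_cast
      ring
  have hterm : ∀ (k : ℕ) (x : MvPowerSeries σ K),
      δ ((((k + 1).factorial : ℂ)⁻¹ • g ^ (k + 1)) * x) =
        g' * ((k.factorial : ℂ)⁻¹ • g ^ k) * x +
          ((((k + 1).factorial : ℂ)⁻¹ • g ^ (k + 1)) * δ x) := by
    intro k x
    rw [smul_mul_assoc, hsmul, hpow, smul_add, smul_smul, smul_mul_assoc, mul_smul_comm,
      smul_mul_assoc]
    congr 2
    rw [Nat.factorial_succ, Nat.cast_mul, mul_inv, mul_assoc, mul_comm (k.factorial : ℂ)⁻¹,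
      ← mul_assoc, inv_mul_cancel₀ (Nat.cast_ne_zero.mpr (Nat.succ_ne_zero k)), one_mul]
  have htrunc : ∀ (M : ℕ) (x : MvPowerSeries σ K), δ (expTrunc g (M + 1) * x) =
      g' * expTrunc g M * x + expTrunc g (M + 1) * δ x := by
    intro M x
    simp only [expTrunc, Finset.sum_range_succ' _ M, add_mul, Finset.sum_mul, Finset.mul_sum,
      map_add, map_sum, hterm, Finset.sum_add_distrib]
    simp [add_assoc]
  have hagree : ∀ (y : MvPowerSeries σ K) (M : ℕ) (μ : σ →₀ ℕ), μ.degree < M →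
      MvPowerSeries.coeff μ (expTrunc g M * y) = MvPowerSeries.coeff μ (expSeries g * y) := by
    intro y M μ h
    rw [MvPowerSeries.coeff_mul, MvPowerSeries.coeff_mul]
    refine Finset.sum_congr rfl fun p hp => ?_
    rw [coeff_expTrunc hg]
    refine lt_of_le_of_lt ?_ h
    rw [← Finset.HasAntidiagonal.mem_antidiagonal.mp hp, map_add]
    exact Nat.le_add_right _ _
  ext ν
  -- A derivation such as ∂/∂sᵢ may look one degree beyond ν, so terms up to degree |ν| + 1 must be
  -- kept; differentiation then loses one term, and what remains still determines the coefficient at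
  -- ν.
  have h1 : MvPowerSeries.coeff ν (δ (expSeries g * x)) =
      MvPowerSeries.coeff ν (δ (expTrunc g (ν.degree + 1 + 1) * x)) := by
    rw [← sub_eq_zero, ← map_sub, ← map_sub]
    refine hloc _ ν fun μ hμ => ?_
    rw [map_sub, hagree _ _ _ (Nat.lt_succ_of_le hμ), sub_self]
  rw [h1, htrunc, map_add, map_add, mul_comm g', mul_comm g', mul_assoc, mul_assoc,
    hagree _ _ _ (Nat.lt_succ_self _), hagree _ _ _ (by omega)]

end Exponential

/-! ### The trivialisation of the bi-formal Gauss-Manin system -/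

section Trivialisation

variable {n m : ℕ} (f : ConvSeries (Fin (n + 1))) (F : ConvSeries (Fin (n + 1) ⊕ Fin m))

/-- The difference `F - f`. -/
def deformationPart : MvPowerSeries (Fin m) (ConvSeries (Fin (n + 1))) :=
  expand F - MvPowerSeries.C f

/-- The series `-(F - f) / u`. -/
def expExponent : MvPowerSeries (Fin m) (CoefL n) :=
  -(MvPowerSeries.C (uPow n (-1)) * MvPowerSeries.map (constL n) (deformationPart f F))

/-- The series `exp (-(F - f) / u)`. -/
def expFactor : MvPowerSeries (Fin m) (CoefL n) := expSeries (expExponent f F)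

theorem constantCoeff_expFactor : MvPowerSeries.constantCoeff (expFactor f F) = 1 :=
  constantCoeff_expSeries _

variable {f F}

theorem constantCoeff_expExponent (hF : MvPowerSeries.constantCoeff (expand F) = f) :
    MvPowerSeries.constantCoeff (expExponent f F) = 0 := by
  rw [expExponent, map_neg, map_mul, MvPowerSeries.constantCoeff_map, deformationPart, map_sub, hF]
  simp only [MvPowerSeries.constantCoeff_C, sub_self, map_zero, mul_zero, neg_zero]

theorem C_u_mul_C_u_inv : (MvPowerSeries.C (uPow n 1) : MvPowerSeries (Fin m) (CoefL n)) *
    MvPowerSeries.C (uPow n (-1)) = 1 := by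
  rw [← map_mul, ← uPow_add, add_neg_cancel, uPow_zero, map_one]

/-- Coefficientwise derivations of multiples of `exp (-(F - f) / u)`. -/
theorem coeffwise_expFactor_mul (hF : MvPowerSeries.constantCoeff (expand F) = f)
    {L : CoefL n →ₗ[ℂ] CoefL n} {g' : MvPowerSeries (Fin m) (CoefL n)}
    (hL : ∀ x, coeffwise m L (expExponent f F * x) =
      g' * x + expExponent f F * coeffwise m L x) (x : MvPowerSeries (Fin m) (CoefL n)) :
    coeffwise m L (expFactor f F * x) =
      g' * expFactor f F * x + expFactor f F * coeffwise m L x := by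
  refine derivation_expSeries_mul (constantCoeff_expExponent hF)
    (coeffwise m L).toAddMonoidHom (fun c x => ?_) (fun x ν hx => ?_) hL x
  · ext ν : 1
    exact L.map_smul c (MvPowerSeries.coeff ν x)
  · change L (MvPowerSeries.coeff ν x) = 0
    rw [hx ν (Nat.le_succ _), map_zero]

theorem coeffwise_dL_expFactor_mul (hF : MvPowerSeries.constantCoeff (expand F) = f)
    (j : Fin (n + 1)) (x : MvPowerSeries (Fin m) (CoefL n)) :
    coeffwise m (dL j) (expFactor f F * x) =
      -(MvPowerSeries.C (uPow n (-1)) * MvPowerSeries.map (constL n)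
        (coeffwise m (partialX j) (deformationPart f F))) * expFactor f F * x +
      expFactor f F * coeffwise m (dL j) x := by
  refine coeffwise_expFactor_mul hF (fun x => ?_) x
  rw [expExponent, neg_mul, map_neg, mul_assoc, coeffwise_C_mul (dL j) (uPow n (-1)) 0
    (fun y => by rw [dL_uPow_mul, zero_mul, zero_add]),
    coeffwise_map_mul (constL n) (partialX j) (dL j) (dL_constL_mul j), map_zero]
  ring

/-- The logarithmic derivative is F - f, since u²∂/∂u sends -(F - f)/u to F - f. This is what turns
the action of t for F into the one for f. -/
theorem coeffwise_thetaL_expFactor_mul (hF : MvPowerSeries.constantCoeff (expand F) = f)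
    (x : MvPowerSeries (Fin m) (CoefL n)) :
    coeffwise m thetaL (expFactor f F * x) =
      MvPowerSeries.map (constL n) (deformationPart f F) * expFactor f F * x +
      expFactor f F * coeffwise m thetaL x := by
  refine coeffwise_expFactor_mul hF (fun x => ?_) x
  have hzero : coeffwise m (0 : ConvSeries (Fin (n + 1)) →ₗ[ℂ] ConvSeries (Fin (n + 1)))
      (deformationPart f F) = 0 := by
    ext ν : 1
    rfl
  rw [expExponent, neg_mul, map_neg, mul_assoc, coeffwise_C_mul thetaL (uPow n (-1)) (-1)
    (fun y => by
      rw [thetaL_uPow_mul, neg_add_cancel, uPow_zero, one_mul, neg_one_smul, neg_one_mul]),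
    coeffwise_map_mul (constL n) 0 thetaL (fun a y => by
      rw [LinearMap.zero_apply, map_zero, zero_mul, zero_add, thetaL_constL_mul]), hzero,
    map_zero, map_neg, map_one]
  ring

theorem pderiv_expFactor_mul (hF : MvPowerSeries.constantCoeff (expand F) = f)
    (i : Fin m) (x : MvPowerSeries (Fin m) (CoefL n)) :
    MvPowerSeries.pderiv (CoefL n) i (expFactor f F * x) =
      -(MvPowerSeries.C (uPow n (-1)) * MvPowerSeries.map (constL n)
        (MvPowerSeries.pderiv _ i (expand F))) * expFactor f F * x +
      expFactor f F * MvPowerSeries.pderiv (CoefL n) i x := by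
  refine derivation_expSeries_mul (constantCoeff_expExponent hF)
    (MvPowerSeries.pderiv (CoefL n) i).toLinearMap.toAddMonoidHom (fun c x => ?_)
    (fun x ν hx => ?_) (fun x => ?_) x
  · ext ν : 1
    change MvPowerSeries.coeff ν (MvPowerSeries.pderiv (CoefL n) i (c • x)) =
      c • MvPowerSeries.coeff ν (MvPowerSeries.pderiv (CoefL n) i x)
    rw [MvPowerSeries.coeff_pderiv, MvPowerSeries.coeff_pderiv, ← smul_mul_assoc]
    rfl
  · change MvPowerSeries.coeff ν (MvPowerSeries.pderiv (CoefL n) i x) = 0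
    rw [MvPowerSeries.coeff_pderiv, hx _ (by rw [map_add, Finsupp.degree_single]), zero_mul]
  · change MvPowerSeries.pderiv (CoefL n) i (_ * x) =
      _ + _ * MvPowerSeries.pderiv (CoefL n) i x
    simp only [expExponent, deformationPart, Derivation.leibniz, map_neg, map_sub, smul_eq_mul,
      MvPowerSeries.pderiv_C, pderiv_map, mul_zero, add_zero, sub_zero, MvPowerSeries.map_C]
    ring

/-- Differentiating the exponential in xⱼ contributes -∂(F - f)/∂xⱼ after multiplication by u,
exactly the difference of the two operators. Multiplication by it is thus a map of complexes. -/
theorem expFactor_mul_opLS (hF : MvPowerSeries.constantCoeff (expand F) = f)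
    (j : Fin (n + 1)) (ν : Fin m →₀ ℕ) (x : MvPowerSeries (Fin m) (CoefL n)) :
    MvPowerSeries.coeff ν (expFactor f F * opLS F j x) =
      opL f j (MvPowerSeries.coeff ν (expFactor f F * x)) := by
  have h1 : opL f j (MvPowerSeries.coeff ν (expFactor f F * x)) =
      MvPowerSeries.coeff ν (MvPowerSeries.C (uPow n 1) * coeffwise m (dL j) (expFactor f F * x) -
        MvPowerSeries.C (constL n (partialX j f)) * (expFactor f F * x)) := by
    rw [map_sub, MvPowerSeries.coeff_C_mul, MvPowerSeries.coeff_C_mul]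
    rfl
  have h2 : coeffwise m (partialX j) (deformationPart f F) =
      coeffwise m (partialX j) (expand F) - MvPowerSeries.C (partialX j f) := by
    rw [deformationPart, map_sub]
    congr 1
    classical
    ext ν : 1
    rw [coeff_coeffwise, MvPowerSeries.coeff_C, MvPowerSeries.coeff_C]
    split_ifs
    · rfl
    · rw [map_zero]
  rw [h1, coeffwise_dL_expFactor_mul hF, h2,
    map_sub (MvPowerSeries.map (constL n)), MvPowerSeries.map_C, opLS, opS_apply]
  congr 1
  linear_combination ((MvPowerSeries.map (constL n) (coeffwise m (partialX j) (expand F)) -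
    MvPowerSeries.C (constL n (partialX j f))) * expFactor f F * x) *
      (C_u_mul_C_u_inv (n := n) (m := m))

/-- The coefficient of `s ^ ν` in the trivialisation of the bi-formal Gauss-Manin system. -/
def trivCoeff (hF : MvPowerSeries.constantCoeff (expand F) = f) (ν : Fin m →₀ ℕ) :
    GaussManinS F →+ GaussManin f :=
  TopCoh.map ((MvPowerSeries.coeff ν).toAddMonoidHom.comp (AddMonoidHom.mulLeft (expFactor f F)))
    ((MvPowerSeries.coeff ν).toAddMonoidHom.comp (AddMonoidHom.mulLeft (expFactor f F)))
    fun j x => expFactor_mul_opLS hF j ν x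

variable (hF : MvPowerSeries.constantCoeff (expand F) = f)

theorem trivCoeff_mk (ν : Fin m →₀ ℕ)
    (ω : Form (n + 1) (n + 1) (MvPowerSeries (Fin m) (CoefL n))) :
    trivCoeff hF ν (Submodule.Quotient.mk ω) =
      Submodule.Quotient.mk fun J => MvPowerSeries.coeff ν (expFactor f F * ω J) := rfl

variable (F) in
theorem toGMS_mk (ω : Form (n + 1) (n + 1) (MvPowerSeries (Fin m) (CoefP n))) :
    toGMS F (Submodule.Quotient.mk ω) =
      Submodule.Quotient.mk fun J => MvPowerSeries.map (PtoL n) (ω J) := rfl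

variable (F) in
theorem uGMS_mk (k : ℤ) (ω : Form (n + 1) (n + 1) (MvPowerSeries (Fin m) (CoefL n))) :
    uGMS F k (Submodule.Quotient.mk ω) =
      Submodule.Quotient.mk fun J => MvPowerSeries.C (uPow n k) * ω J := rfl

variable (F) in
theorem sGMS_mk (i : Fin m) (ω : Form (n + 1) (n + 1) (MvPowerSeries (Fin m) (CoefL n))) :
    sGMS F i (Submodule.Quotient.mk ω) =
      Submodule.Quotient.mk fun J => sOpS (uPow n (-1)) (constL n) F i (ω J) := rfl

variable (F) in
theorem tGMS_mk (ω : Form (n + 1) (n + 1) (MvPowerSeries (Fin m) (CoefL n))) :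
    tGMS F (Submodule.Quotient.mk ω) = Submodule.Quotient.mk fun J =>
      MvPowerSeries.map (constL n) (expand F) * ω J + coeffwise m thetaL (ω J) := rfl

variable (F) in
theorem uLatticeS_mk (ω : Form (n + 1) (n + 1) (MvPowerSeries (Fin m) (CoefP n))) :
    uLatticeS F (Submodule.Quotient.mk ω) =
      Submodule.Quotient.mk fun J => MvPowerSeries.C PowerSeries.X * ω J := rfl

/-- Primitives of all the coefficients are assembled into one series in s and multiplied by the
inverse of the exponential, which is a unit since its constant term is 1. -/
theorem trivCoeff_eq_zero (y : GaussManinS F) (hy : ∀ ν, trivCoeff hF ν y = 0) : y = 0 := by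
  obtain ⟨ω, rfl⟩ := Submodule.Quotient.mk_surjective _ y
  have h1 : ∀ ν, ∃ η, diff (opL f) n η =
      fun J => MvPowerSeries.coeff ν (expFactor f F * ω J) := fun ν => by
    have := hy ν
    rw [trivCoeff_mk, Submodule.Quotient.mk_eq_zero] at this
    exact this
  choose η hη using h1
  obtain ⟨e, he⟩ := (isUnit_expSeries (expExponent f F)).exists_right_inv
  replace he : expFactor f F * e = 1 := he
  rw [Submodule.Quotient.mk_eq_zero]
  refine ⟨fun J => e * (show MvPowerSeries (Fin m) (CoefL n) from fun ν => η ν J),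
    funext fun J => (isUnit_expSeries (expExponent f F)).mul_left_cancel ?_⟩
  ext ν : 1
  have h2 := congrFun (Form.map_diff (P := opLS F) (P' := opL f)
    ((MvPowerSeries.coeff ν).toAddMonoidHom.comp (AddMonoidHom.mulLeft (expFactor f F)))
    ((MvPowerSeries.coeff ν).toAddMonoidHom.comp (AddMonoidHom.mulLeft (expFactor f F)))
    (fun j x => expFactor_mul_opLS hF j ν x)
    (fun J : {J : Finset (Fin (n + 1)) // J.card = n} =>
      e * (show MvPowerSeries (Fin m) (CoefL n) from fun ν => η ν J))) J
  refine h2.trans ?_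
  have h3 : Form.map ((MvPowerSeries.coeff ν).toAddMonoidHom.comp
      (AddMonoidHom.mulLeft (expFactor f F))) (fun J : {J : Finset (Fin (n + 1)) // J.card = n} =>
      e * (show MvPowerSeries (Fin m) (CoefL n) from fun ν => η ν J)) = η ν := by
    funext J
    change MvPowerSeries.coeff ν (expFactor f F * (e * _)) = _
    rw [← mul_assoc, he, one_mul]
    rfl
  rw [h3, hη]
  rfl

theorem trivCoeff_uGMS (ν : Fin m →₀ ℕ) (k : ℤ) (y : GaussManinS F) :
    trivCoeff hF ν (uGMS F k y) = uGM f k (trivCoeff hF ν y) := by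
  obtain ⟨ω, rfl⟩ := Submodule.Quotient.mk_surjective _ y
  rw [uGMS_mk, trivCoeff_mk, trivCoeff_mk, uGM_mk]
  refine congrArg Submodule.Quotient.mk (funext fun J => ?_)
  rw [mul_left_comm, MvPowerSeries.coeff_C_mul]

theorem trivCoeff_tGMS (ν : Fin m →₀ ℕ) (y : GaussManinS F) :
    trivCoeff hF ν (tGMS F y) = tGM f (trivCoeff hF ν y) := by
  obtain ⟨ω, rfl⟩ := Submodule.Quotient.mk_surjective _ y
  rw [tGMS_mk, trivCoeff_mk, trivCoeff_mk, tGM_mk]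
  refine congrArg Submodule.Quotient.mk (funext fun J => ?_)
  rw [← MvPowerSeries.coeff_C_mul, ← coeff_coeffwise, ← map_add,
    coeffwise_thetaL_expFactor_mul hF, deformationPart, map_sub, MvPowerSeries.map_C]
  congr 1
  ring

/-- The derivative of the exponential absorbs the term -(∂F/∂sᵢ)u⁻¹, so the connection becomes plain
differentiation in sᵢ. -/
theorem trivCoeff_sGMS (ν : Fin m →₀ ℕ) (i : Fin m) (y : GaussManinS F) :
    trivCoeff hF ν (sGMS F i y) = (ν i + 1) • trivCoeff hF (ν + Finsupp.single i 1) y := by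
  obtain ⟨ω, rfl⟩ := Submodule.Quotient.mk_surjective _ y
  rw [sGMS_mk, trivCoeff_mk, trivCoeff_mk, ← Submodule.Quotient.mk_smul]
  refine congrArg Submodule.Quotient.mk (funext fun J => ?_)
  change MvPowerSeries.coeff ν (expFactor f F * sOpS (uPow n (-1)) (constL n) F i (ω J)) =
    (ν i + 1) • MvPowerSeries.coeff (ν + Finsupp.single i 1) (expFactor f F * ω J)
  have h1 : expFactor f F * sOpS (uPow n (-1)) (constL n) F i (ω J) =
      MvPowerSeries.pderiv (CoefL n) i (expFactor f F * ω J) := by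
    rw [pderiv_expFactor_mul hF, sOpS_apply]
    ring
  rw [h1, MvPowerSeries.coeff_pderiv, nsmul_eq_mul, mul_comm]
  push_cast
  rfl

theorem trivCoeff_zero_toGMS (x : LatticeS F) :
    trivCoeff hF 0 (toGMS F x) = toGM f (restrLattice f F hF x) := by
  obtain ⟨ω, rfl⟩ := Submodule.Quotient.mk_surjective _ x
  refine congrArg Submodule.Quotient.mk (funext fun J => ?_)
  change MvPowerSeries.constantCoeff (expFactor f F * MvPowerSeries.map (PtoL n) (ω J)) =
    PtoL n (MvPowerSeries.constantCoeff (ω J))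
  rw [map_mul, constantCoeff_expFactor, one_mul, MvPowerSeries.constantCoeff_map]

theorem coeff_smul_series {K : Type} [CommRing K] [Algebra ℂ K] (ν : Fin m →₀ ℕ)
    (a : MvPowerSeries (Fin m) ℂ) (x : MvPowerSeries (Fin m) K) :
    MvPowerSeries.coeff ν (a • x) = ∑ p ∈ Finset.HasAntidiagonal.antidiagonal ν,
      MvPowerSeries.coeff p.1 a • MvPowerSeries.coeff p.2 x := by
  classical
  rw [Algebra.smul_def, MvPowerSeries.algebraMap_apply'', MvPowerSeries.coeff_mul]
  refine Finset.sum_congr rfl fun p _ => ?_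
  rw [MvPowerSeries.coeff_map, ← Algebra.smul_def]

theorem trivCoeff_toGMS_smul (ν : Fin m →₀ ℕ) (a : MvPowerSeries (Fin m) ℂ) (x : LatticeS F) :
    trivCoeff hF ν (toGMS F (a • x)) = ∑ p ∈ Finset.HasAntidiagonal.antidiagonal ν,
      MvPowerSeries.coeff p.1 a • trivCoeff hF p.2 (toGMS F x) := by
  obtain ⟨ω, rfl⟩ := Submodule.Quotient.mk_surjective _ x
  have h1 : ∀ J, MvPowerSeries.map (PtoL n) (a • ω J) = a • MvPowerSeries.map (PtoL n) (ω J) := by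
    intro J
    ext ν : 1
    rw [MvPowerSeries.coeff_map, coeff_smul_series, coeff_smul_series, map_sum]
    refine Finset.sum_congr rfl fun p _ => ?_
    rw [PtoL_smul, MvPowerSeries.coeff_map]
  refine Eq.trans ?_ (map_sum (Submodule.mkQ (LinearMap.range (diff (opL f) n)))
    (fun p : (Fin m →₀ ℕ) × (Fin m →₀ ℕ) => MvPowerSeries.coeff p.1 a •
      fun J : {J : Finset (Fin (n + 1)) // J.card = n + 1} => MvPowerSeries.coeff p.2
        (expFactor f F * MvPowerSeries.map (PtoL n) (ω J)))
    (Finset.HasAntidiagonal.antidiagonal ν))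
  refine congrArg (Submodule.mkQ (LinearMap.range (diff (opL f) n))) (funext fun J => ?_)
  change MvPowerSeries.coeff ν (expFactor f F * MvPowerSeries.map (PtoL n) (a • ω J)) = _
  rw [Finset.sum_apply, h1, mul_smul_comm, coeff_smul_series]
  rfl

/-! ### Stability of the bi-formal lattice under t and u∂/∂sᵢ, and relations among the operators. -/

theorem exists_map_PtoL {x : MvPowerSeries (Fin m) (CoefL n)}
    (h : ∀ ν, ∃ p, PtoL n p = MvPowerSeries.coeff ν x) : ∃ y, MvPowerSeries.map (PtoL n) y = x := by
  choose p hp using h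
  refine ⟨(show MvPowerSeries (Fin m) (CoefP n) from fun ν => p ν), ?_⟩
  ext ν : 1
  exact (MvPowerSeries.coeff_map _ _ _).trans (hp ν)

theorem exists_PtoL_eq_thetaL (g : CoefP n) : ∃ p, PtoL n p = thetaL (PtoL n g) := by
  refine ⟨PowerSeries.X * PowerSeries.mk fun k => k • PowerSeries.coeff k g,
    CoefL.ext fun k => ?_⟩
  rw [map_mul, PtoL_X, CoefL.coeff_uPow_mul, coeff_thetaL]
  rcases lt_or_ge (k - 1) 0 with hk | hk
  · rw [coeff_PtoL_neg _ hk, coeff_PtoL_neg _ hk, smul_zero]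
  · generalize k - 1 = l at hk
    lift l to ℕ using hk
    rw [coeff_PtoL_natCast, coeff_PtoL_natCast, PowerSeries.coeff_mk, natCast_zsmul]

theorem map_PtoL_map_C (a : MvPowerSeries (Fin m) (ConvSeries (Fin (n + 1)))) :
    MvPowerSeries.map (PtoL n) (MvPowerSeries.map PowerSeries.C a) =
      MvPowerSeries.map (constL n) a := by
  ext ν : 1
  simp only [MvPowerSeries.coeff_map, PtoL_C]

variable (F) in
theorem exists_toGMS_eq_tGMS (x : LatticeS F) : ∃ x', toGMS F x' = tGMS F (toGMS F x) := by
  obtain ⟨ω, rfl⟩ := Submodule.Quotient.mk_surjective _ x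
  have h1 : ∀ J, ∃ y, MvPowerSeries.map (PtoL n) y =
      coeffwise m thetaL (MvPowerSeries.map (PtoL n) (ω J)) := fun J => exists_map_PtoL fun ν => by
    rw [coeff_coeffwise, MvPowerSeries.coeff_map]
    exact exists_PtoL_eq_thetaL _
  choose y hy using h1
  refine ⟨Submodule.Quotient.mk fun J => MvPowerSeries.map PowerSeries.C (expand F) * ω J + y J, ?_⟩
  rw [toGMS_mk, toGMS_mk, tGMS_mk]
  refine congrArg Submodule.Quotient.mk (funext fun J => ?_)
  change MvPowerSeries.map (PtoL n) (_ * _ + _) = MvPowerSeries.map (constL n) (expand F) *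
    MvPowerSeries.map (PtoL n) (ω J) + coeffwise m thetaL (MvPowerSeries.map (PtoL n) (ω J))
  rw [map_add, map_mul, map_PtoL_map_C, hy]

variable (F) in
theorem exists_toGMS_eq_uGMS_sGMS (i : Fin m) (x : LatticeS F) :
    ∃ x', toGMS F x' = uGMS F 1 (sGMS F i (toGMS F x)) := by
  obtain ⟨ω, rfl⟩ := Submodule.Quotient.mk_surjective _ x
  refine ⟨Submodule.Quotient.mk fun J =>
    MvPowerSeries.C PowerSeries.X * MvPowerSeries.pderiv (CoefP n) i (ω J) -
      MvPowerSeries.map PowerSeries.C (MvPowerSeries.pderiv _ i (expand F)) * ω J, ?_⟩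
  rw [toGMS_mk, toGMS_mk, sGMS_mk, uGMS_mk]
  refine congrArg Submodule.Quotient.mk (funext fun J => ?_)
  change MvPowerSeries.map (PtoL n) (_ * _ - _ * _) = MvPowerSeries.C (uPow n 1) *
    sOpS (uPow n (-1)) (constL n) F i (MvPowerSeries.map (PtoL n) (ω J))
  rw [map_sub, map_mul, map_mul, map_PtoL_map_C, MvPowerSeries.map_C, PtoL_X, sOpS_apply,
    pderiv_map]
  linear_combination (MvPowerSeries.map (constL n) (MvPowerSeries.pderiv _ i (expand F)) *
    MvPowerSeries.map (PtoL n) (ω J)) * (C_u_mul_C_u_inv (n := n) (m := m))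

variable (F) in
theorem sGMS_uGMS (i : Fin m) (k : ℤ) (y : GaussManinS F) :
    sGMS F i (uGMS F k y) = uGMS F k (sGMS F i y) := by
  obtain ⟨ω, rfl⟩ := Submodule.Quotient.mk_surjective _ y
  rw [uGMS_mk, sGMS_mk, sGMS_mk, uGMS_mk]
  refine congrArg Submodule.Quotient.mk (funext fun J => ?_)
  simp only [sOpS_apply, Derivation.leibniz, MvPowerSeries.pderiv_C, smul_eq_mul, mul_zero,
    add_zero]
  ring

variable (F) in
theorem toGMS_uLatticeS (x : LatticeS F) : toGMS F (uLatticeS F x) = uGMS F 1 (toGMS F x) := by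
  obtain ⟨ω, rfl⟩ := Submodule.Quotient.mk_surjective _ x
  rw [uLatticeS_mk, toGMS_mk, toGMS_mk, uGMS_mk]
  refine congrArg Submodule.Quotient.mk (funext fun J => ?_)
  rw [map_mul, MvPowerSeries.map_C, PtoL_X]

variable (F) in
theorem uGMS_add (k l : ℤ) (y : GaussManinS F) : uGMS F (k + l) y = uGMS F k (uGMS F l y) := by
  obtain ⟨ω, rfl⟩ := Submodule.Quotient.mk_surjective _ y
  rw [uGMS_mk, uGMS_mk, uGMS_mk]
  simp only [uPow_add, map_mul, mul_assoc]

variable (F) in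
theorem uGMS_zero (y : GaussManinS F) : uGMS F 0 y = y := by
  obtain ⟨ω, rfl⟩ := Submodule.Quotient.mk_surjective _ y
  rw [uGMS_mk]
  simp only [uPow_zero, map_one, one_mul]

end Trivialisation

/-! ### Lifting along the parameters -/

section Lifting

/-- Families constructed recursively along a well-founded order, when the conditions on the value
at `ν` involve only the values at the elements `≤ ν`. -/
theorem exists_family_of_local {α β : Type} [PartialOrder α] [WellFoundedLT α] [Nonempty β]
    (P : α → (α → β) → Prop)
    (hlocal : ∀ ν F F', (∀ μ ≤ ν, F μ = F' μ) → P ν F → P ν F')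
    (hstep : ∀ ν F, (∀ μ < ν, P μ F) → ∃ F', (∀ μ < ν, F' μ = F μ) ∧ P ν F') :
    ∃ F, ∀ ν, P ν F := by
  classical
  -- A filler for indices not below or equal to ν; by locality its value does not matter.
  let b₀ : β := Classical.arbitrary β
  let ext : (ν : α) → ((μ : α) → μ < ν → β) → β → α → β := fun ν G b μ =>
    if h : μ < ν then G μ h else if μ = ν then b else b₀
  let F : α → β := (wellFounded_lt (α := α)).fix fun ν G =>
    Classical.epsilon fun b => P ν (ext ν G b)
  have hF : ∀ ν, F ν = Classical.epsilon fun b => P ν (ext ν (fun μ _ => F μ) b) := fun ν =>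
    WellFounded.fix_eq _ _ ν
  have hlt : ∀ ν b μ, μ < ν → ext ν (fun μ _ => F μ) b μ = F μ := fun ν b μ h => dif_pos h
  have heq : ∀ ν b, ext ν (fun μ _ => F μ) b ν = b := fun ν b =>
    (dif_neg (lt_irrefl ν)).trans (if_pos rfl)
  refine ⟨F, fun ν => ?_⟩
  induction ν using WellFoundedLT.induction with
  | ind ν ih =>
    obtain ⟨F', hF', hP⟩ := hstep ν F ih
    have hex : ∃ b, P ν (ext ν (fun μ _ => F μ) b) := by
      refine ⟨F' ν, hlocal ν F' _ (fun μ hμ => ?_) hP⟩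
      rcases hμ.lt_or_eq with h | rfl
      · rw [hF' μ h, hlt ν _ μ h]
      · rw [heq]
    have hspec := Classical.epsilon_spec hex
    rw [← hF] at hspec
    refine hlocal ν _ F (fun μ hμ => ?_) hspec
    rcases hμ.lt_or_eq with h | rfl
    · exact hlt ν _ μ h
    · exact heq _ _

variable {n m : ℕ} {f : ConvSeries (Fin (n + 1))} {F : ConvSeries (Fin (n + 1) ⊕ Fin m)}

theorem coeff_mul_of_lower {K : Type} [CommRing K] {ν : Fin m →₀ ℕ} {x : MvPowerSeries (Fin m) K}
    (hx : ∀ μ < ν, MvPowerSeries.coeff μ x = 0) (a : MvPowerSeries (Fin m) K) :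
    MvPowerSeries.coeff ν (a * x) = MvPowerSeries.constantCoeff a * MvPowerSeries.coeff ν x := by
  classical
  rw [MvPowerSeries.coeff_mul, Finset.sum_eq_single (0, ν)]
  · rfl
  · rintro ⟨p, q⟩ hpq hne
    have h : p + q = ν := Finset.HasAntidiagonal.mem_antidiagonal.mp hpq
    have hlt : q < ν := by
      refine lt_of_le_of_ne (h ▸ le_add_self) fun hq => hne ?_
      rw [hq, add_eq_right] at h
      rw [h, hq]
    rw [hx q hlt, mul_zero]
  · intro h
    exact absurd (Finset.HasAntidiagonal.mem_antidiagonal.mpr (zero_add ν)) h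

/-- The form whose coefficients in `s` are the given forms. -/
def assembleForm {N p : ℕ} {K : Type} (η : (Fin m →₀ ℕ) → Form N p K) :
    Form N p (MvPowerSeries (Fin m) K) := fun J ν => η ν J

theorem coeff_assembleForm {N p : ℕ} {K : Type} [CommRing K] (η : (Fin m →₀ ℕ) → Form N p K)
    (ν : Fin m →₀ ℕ) (J : {J : Finset (Fin N) // J.card = p}) :
    MvPowerSeries.coeff ν (assembleForm η J) = η ν J := rfl

theorem coeff_opPS_of_lower (hF : MvPowerSeries.constantCoeff (expand F) = f) (j : Fin (n + 1))
    {ν : Fin m →₀ ℕ} {x : MvPowerSeries (Fin m) (CoefP n)}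
    (hx : ∀ μ < ν, MvPowerSeries.coeff μ x = 0) :
    MvPowerSeries.coeff ν (opPS F j x) = opP f j (MvPowerSeries.coeff ν x) := by
  have h1 : MvPowerSeries.constantCoeff (MvPowerSeries.map PowerSeries.C
      (coeffwise m (partialX j) (expand F))) = (PowerSeries.C (partialX j f) : CoefP n) := by
    rw [MvPowerSeries.constantCoeff_map, ← hF]
    rfl
  rw [opPS, opS_apply, map_sub, MvPowerSeries.coeff_C_mul, coeff_mul_of_lower hx, h1]
  rfl

theorem coeff_diff_of_lower (hF : MvPowerSeries.constantCoeff (expand F) = f) {p : ℕ}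
    {ν : Fin m →₀ ℕ} {η : Form (n + 1) p (MvPowerSeries (Fin m) (CoefP n))}
    (hη : ∀ J, ∀ μ < ν, MvPowerSeries.coeff μ (η J) = 0)
    (J : {J : Finset (Fin (n + 1)) // J.card = p + 1}) :
    MvPowerSeries.coeff ν (diff (opPS F) p η J) =
      diff (opP f) p (fun J => MvPowerSeries.coeff ν (η J)) J := by
  simp only [diff, LinearMap.pi_apply, LinearMap.sum_apply, map_sum, LinearMap.smul_apply,
    LinearMap.comp_apply, LinearMap.proj_apply, map_zsmul]
  refine Finset.sum_congr rfl fun j _ => ?_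
  rw [coeff_opPS_of_lower hF j.1 (hη _)]

theorem coeff_diff_congr (hF : MvPowerSeries.constantCoeff (expand F) = f) {p : ℕ}
    {ν : Fin m →₀ ℕ} {η η' : Form (n + 1) p (MvPowerSeries (Fin m) (CoefP n))}
    (hη : ∀ J, ∀ μ ≤ ν, MvPowerSeries.coeff μ (η J) = MvPowerSeries.coeff μ (η' J))
    (J : {J : Finset (Fin (n + 1)) // J.card = p + 1}) :
    MvPowerSeries.coeff ν (diff (opPS F) p η J) = MvPowerSeries.coeff ν (diff (opPS F) p η' J) := by
  have h0 : ∀ J, ∀ μ ≤ ν, MvPowerSeries.coeff μ ((η - η') J) = 0 := fun J μ hμ => by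
    rw [Pi.sub_apply, map_sub, hη J μ hμ, sub_self]
  have h1 := coeff_diff_of_lower hF (fun J μ hμ => h0 J μ hμ.le) J
  have h2 : (fun J => MvPowerSeries.coeff ν ((η - η') J)) = 0 := funext fun J => h0 J ν le_rfl
  rw [h2, map_zero, map_sub, Pi.sub_apply, map_sub] at h1
  exact sub_eq_zero.mp h1

/-- Triangularity: on series without coefficients below ν only the constant term 1 of the
exponential contributes at ν. This drives both recursions below. -/
theorem trivCoeff_toGMS_of_lower (hF : MvPowerSeries.constantCoeff (expand F) = f)
    {ν : Fin m →₀ ℕ} {ω : Form (n + 1) (n + 1) (MvPowerSeries (Fin m) (CoefP n))}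
    (hω : ∀ J, ∀ μ < ν, MvPowerSeries.coeff μ (ω J) = 0) :
    trivCoeff hF ν (toGMS F (Submodule.Quotient.mk ω)) =
      toGM f (Submodule.Quotient.mk fun J => MvPowerSeries.coeff ν (ω J)) := by
  rw [toGMS_mk, trivCoeff_mk, toGM_mk]
  refine congrArg Submodule.Quotient.mk (funext fun J => ?_)
  rw [coeff_mul_of_lower, constantCoeff_expFactor, one_mul, MvPowerSeries.coeff_map]
  intro μ hμ
  rw [MvPowerSeries.coeff_map, hω J μ hμ, map_zero]

theorem trivCoeff_toGMS_congr (hF : MvPowerSeries.constantCoeff (expand F) = f)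
    {ν : Fin m →₀ ℕ} {ω ω' : Form (n + 1) (n + 1) (MvPowerSeries (Fin m) (CoefP n))}
    (hω : ∀ J, ∀ μ ≤ ν, MvPowerSeries.coeff μ (ω J) = MvPowerSeries.coeff μ (ω' J)) :
    trivCoeff hF ν (toGMS F (Submodule.Quotient.mk ω)) =
      trivCoeff hF ν (toGMS F (Submodule.Quotient.mk ω')) := by
  have h0 : ∀ J, ∀ μ ≤ ν, MvPowerSeries.coeff μ ((ω - ω') J) = 0 := fun J μ hμ => by
    rw [Pi.sub_apply, map_sub, hω J μ hμ, sub_self]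
  have h1 := trivCoeff_toGMS_of_lower hF (fun J μ hμ => h0 J μ hμ.le)
  have h2 : (fun J => MvPowerSeries.coeff ν ((ω - ω') J)) = 0 := funext fun J => h0 J ν le_rfl
  rw [h2, Submodule.Quotient.mk_zero, map_zero, Submodule.Quotient.mk_sub, map_sub, map_sub] at h1
  exact sub_eq_zero.mp h1

/-- By triangularity, adding b at the multi-index ν changes the coefficient at ν by the class of b
and leaves the conditions at smaller indices intact; b is chosen from the H-part of the current
error. -/
theorem exists_sub_trivCoeff_mem (hF : MvPowerSeries.constantCoeff (expand F) = f)
    (V : Submodule ℂ (GaussManin f)) (hV : ∀ g, ∃ x, ∃ v ∈ V, g = toGM f x + v)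
    (y : (Fin m →₀ ℕ) → GaussManin f) :
    ∃ x : LatticeS F, ∀ ν, y ν - trivCoeff hF ν (toGMS F x) ∈ V := by
  classical
  obtain ⟨η, hη⟩ := exists_family_of_local (β := Form (n + 1) (n + 1) (CoefP n))
    (fun ν η => y ν - trivCoeff hF ν (toGMS F (Submodule.Quotient.mk (assembleForm η))) ∈ V)
    (fun ν η η' h hP => by
      rwa [trivCoeff_toGMS_congr hF (ω := assembleForm η') (ω' := assembleForm η)
        fun J μ hμ => by rw [coeff_assembleForm, coeff_assembleForm, h μ hμ]])
    fun ν η _ => by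
      obtain ⟨x, v, hv, hx⟩ := hV
        (y ν - trivCoeff hF ν (toGMS F (Submodule.Quotient.mk (assembleForm η))))
      obtain ⟨b, rfl⟩ := Submodule.Quotient.mk_surjective _ x
      refine ⟨η + Pi.single ν b, fun μ hμ => ?_, ?_⟩
      · rw [Pi.add_apply, Pi.single_eq_of_ne hμ.ne, add_zero]
      · have h1 : assembleForm (η + Pi.single ν b) =
            assembleForm η + assembleForm (Pi.single ν b) := rfl
        have h2 : (fun J => MvPowerSeries.coeff ν (assembleForm (Pi.single ν b) J)) = b := by
          funext J
          rw [coeff_assembleForm, Pi.single_eq_same]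
        rw [h1, Submodule.Quotient.mk_add, map_add, map_add, trivCoeff_toGMS_of_lower hF
          (ω := assembleForm (Pi.single ν b)) (fun J μ hμ => by
            rw [coeff_assembleForm, Pi.single_eq_of_ne hμ.ne]; rfl), h2, ← sub_sub, hx,
          add_sub_cancel_left]
        exact hv
  exact ⟨_, hη⟩

/-- A primitive of ω is built coefficient by coefficient. Once ω is exact below ν, the remainder ω'
represents the same class and starts at ν, so the image in G of its coefficient there lies in V; by
hypothesis that coefficient is exact, and its primitive is added at ν. -/
theorem eq_zero_of_trivCoeff_mem (hF : MvPowerSeries.constantCoeff (expand F) = f)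
    (V : Submodule ℂ (GaussManin f)) (hV : ∀ x, toGM f x ∈ V → x = 0) (x : LatticeS F)
    (hx : ∀ ν, trivCoeff hF ν (toGMS F x) ∈ V) : x = 0 := by
  classical
  obtain ⟨ω, rfl⟩ := Submodule.Quotient.mk_surjective _ x
  obtain ⟨η, hη⟩ := exists_family_of_local (β := Form (n + 1) n (CoefP n))
    (fun ν η => ∀ J, MvPowerSeries.coeff ν (diff (opPS F) n (assembleForm η) J) =
      MvPowerSeries.coeff ν (ω J))
    (fun ν η η' h hP J => by
      rw [← hP J]
      refine coeff_diff_congr hF (fun J μ hμ => ?_) J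
      rw [coeff_assembleForm, coeff_assembleForm, h μ hμ])
    fun ν η hη => by
      obtain ⟨ω', hω'⟩ : ∃ ω', ω' = ω - diff (opPS F) n (assembleForm η) := ⟨_, rfl⟩
      have hlow : ∀ J, ∀ μ < ν, MvPowerSeries.coeff μ (ω' J) = 0 := fun J μ hμ => by
        rw [hω', Pi.sub_apply, map_sub, hη μ hμ, sub_self]
      have hmk : (Submodule.Quotient.mk ω' : LatticeS F) = Submodule.Quotient.mk ω := by
        rw [Submodule.Quotient.eq, hω', sub_sub_cancel_left]
        exact neg_mem ⟨_, rfl⟩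
      have h1 := hx ν
      rw [← hmk, trivCoeff_toGMS_of_lower hF hlow] at h1
      have h2 := hV _ h1
      rw [Submodule.Quotient.mk_eq_zero] at h2
      obtain ⟨b, hb⟩ := h2
      refine ⟨η + Pi.single ν b, fun μ hμ => ?_, fun J => ?_⟩
      · rw [Pi.add_apply, Pi.single_eq_of_ne hμ.ne, add_zero]
      · have h1 : assembleForm (η + Pi.single ν b) =
            assembleForm η + assembleForm (Pi.single ν b) := rfl
        have h2 : (fun J => MvPowerSeries.coeff ν (assembleForm (Pi.single ν b) J)) = b := by
          funext J
          rw [coeff_assembleForm, Pi.single_eq_same]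
        rw [h1, map_add, Pi.add_apply, map_add, coeff_diff_of_lower hF
          (η := assembleForm (Pi.single ν b)) (fun J μ hμ => by
            rw [coeff_assembleForm, Pi.single_eq_of_ne hμ.ne]; rfl), h2, hb, hω']
        simp only [Pi.sub_apply, map_sub, add_sub_cancel]
  rw [Submodule.Quotient.mk_eq_zero]
  exact ⟨assembleForm η, funext fun J => MvPowerSeries.ext fun ν => hη ν J⟩

end Lifting

/-! ### Good sections -/

section GoodSections

variable {n m : ℕ} {f : ConvSeries (Fin (n + 1))}

/-- The inclusion of the formal Brieskorn lattice as a linear map. -/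
def toGMₗ (f : ConvSeries (Fin (n + 1))) : Lattice f →ₗ[ℂ] GaussManin f :=
  { toGM f with map_smul' := toGM_smul f }

theorem isLatticeMap_toGM (hf : IsolatedSingularity f) :
    IsLatticeMap (toGMₗ f) (uGM f) (uLattice f) where
  inj _ hx := (injective_iff_map_eq_zero (toGM f)).mp (toGM_injective hf) _ hx
  add := uGM_add f
  zero := uGM_zero f
  comm := toGM_uLattice f
  exhaust := exists_uGM_eq_toGM f

theorem isComplement_range {σ : Omega f →ₗ[ℂ] Lattice f} (hσ : IsGoodSection f σ) :
    IsComplement (uLattice f) (LinearMap.range σ) where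
  disjoint x := by
    rintro ⟨w, hw⟩
    have h1 : (Submodule.Quotient.mk (uLattice f x) : Omega f) = 0 :=
      (Submodule.Quotient.mk_eq_zero _).mpr ⟨x, rfl⟩
    rw [← hw, hσ.proj] at h1
    rw [← hw, h1, map_zero]
  exists_add x := by
    have h1 : (Submodule.Quotient.mk (x - σ (Submodule.Quotient.mk x)) : Omega f) = 0 := by
      rw [Submodule.Quotient.mk_sub, hσ.proj, sub_self]
    obtain ⟨y, hy⟩ := (Submodule.Quotient.mk_eq_zero _).mp h1
    exact ⟨_, ⟨_, rfl⟩, y, by rw [hy, add_sub_cancel]⟩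

theorem isLatticeDeformation (F : ConvSeries (Fin (n + 1) ⊕ Fin m))
    (hF : MvPowerSeries.constantCoeff (expand F) = f) :
    IsLatticeDeformation (toGMₗ f) (uGM f) (tGM f) (toGMS F)
      (fun k => (uGMS F k).toAddMonoidHom) (tGMS F) (sGMS F) (uLatticeS F) (restrLattice f F hF)
      (trivCoeff hF) where
  c_inj := trivCoeff_eq_zero hF
  c_U := trivCoeff_uGMS hF
  jS_u := toGMS_uLatticeS F
  c_δ := trivCoeff_sGMS hF
  c_t := trivCoeff_tGMS hF
  c_zero := trivCoeff_zero_toGMS hF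
  c_smul := trivCoeff_toGMS_smul hF
  lift_t := exists_toGMS_eq_tGMS F
  lift_δ := exists_toGMS_eq_uGMS_sGMS F
  δ_U := sGMS_uGMS F
  exists_sub_mem := exists_sub_trivCoeff_mem hF
  eq_zero_of_mem := eq_zero_of_trivCoeff_mem hF

end GoodSections

end FormalBrieskorn

end

/-! ### Existence and uniqueness of the extended good section. -/

open FormalBrieskorn in
theorem theorem1 (n m : ℕ) (f : ConvSeries (Fin (n + 1))) (hf : IsolatedSingularity f)
    (F : ConvSeries (Fin (n + 1) ⊕ Fin m))
    (hF : MvPowerSeries.constantCoeff (expand F) = f)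
    (σ₀ : Omega f →ₗ[ℂ] Lattice f) (hσ₀ : IsGoodSection f σ₀) :
    ∃! σ : OmegaS F →ₗ[MvPowerSeries (Fin m) ℂ] LatticeS F,
      IsGoodSectionS F σ ∧
        ∀ w : OmegaS F, restrLattice f F hF (σ w) = σ₀ (restrOmega f F hF w) := by
  have hL := isLatticeMap_toGM hf
  have hI := isComplement_range hσ₀
  have hS := isLatticeDeformation F hF
  have hcompl := hS.isCompl_flatPart hL hI
  have hgood : ∀ x ∈ LinearMap.range σ₀, ∃ y ∈ LinearMap.range σ₀, ∃ z ∈ LinearMap.range σ₀,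
      tGM f (toGMₗ f x) = toGMₗ f y + uGM f 1 (toGMₗ f z) := hσ₀.t_mem
  have hrestr : ∀ x : LatticeS F, (Submodule.Quotient.mk (restrLattice f F hF x) : Omega f) =
      restrOmega f F hF (Submodule.Quotient.mk x) := fun _ => rfl
  have hsec : ∀ x ∈ LinearMap.range σ₀, σ₀ (Submodule.Quotient.mk x) = x := by
    rintro _ ⟨w, rfl⟩
    rw [hσ₀.proj]
  have hdisj : ∀ x ∈ hS.flatPart (LinearMap.range σ₀),
      (Submodule.Quotient.mk x : OmegaS F) = 0 → x = 0 := fun x hx hx0 =>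
    (Submodule.disjoint_def.mp hcompl.disjoint) x hx ((Submodule.Quotient.mk_eq_zero _).mp hx0)
  -- The section is the inverse of the isomorphism from the flat part onto the quotient by the image
  -- of u.
  let e := Submodule.quotientEquivOfIsCompl _ _ hcompl.symm
  let σ : OmegaS F →ₗ[MvPowerSeries (Fin m) ℂ] LatticeS F := (Submodule.subtype _).comp e.toLinearMap
  have hσmem : ∀ w, σ w ∈ hS.flatPart (LinearMap.range σ₀) := fun w => (e w).2
  have hσproj : ∀ w, (Submodule.Quotient.mk (σ w) : OmegaS F) = w := fun w =>
    Submodule.mk_quotientEquivOfIsCompl_apply hcompl.symm w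
  have hσrange : ∀ x ∈ hS.flatPart (LinearMap.range σ₀), x ∈ LinearMap.range σ := by
    intro x hx
    refine ⟨Submodule.Quotient.mk x, ?_⟩
    rw [← sub_eq_zero]
    exact hdisj _ (sub_mem (hσmem _) hx) (by rw [Submodule.Quotient.mk_sub, hσproj, sub_self])
  have hσflat : ∀ x ∈ LinearMap.range σ, x ∈ hS.flatPart (LinearMap.range σ₀) := by
    rintro _ ⟨w, rfl⟩
    exact hσmem w
  refine ⟨σ, ⟨⟨hσproj, fun x hx => ?_, fun i x hx => ?_⟩, fun w => ?_⟩, ?_⟩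
  · obtain ⟨y, hy, z, hz, h⟩ := hS.t_mem_flatPart hL hI (tGM_uGM f) hgood (hσflat x hx)
    exact ⟨y, hσrange y hy, z, hσrange z hz, h⟩
  · obtain ⟨y, hy, z, hz, h⟩ := hS.δ_mem_flatPart hL hI (uGMS_add F) (uGMS_zero F) i (hσflat x hx)
    exact ⟨y, hσrange y hy, z, hσrange z hz, h⟩
  -- The restriction of σ w lies in the image of σ₀, so it is the value of σ₀ on its own class, and
  -- that class is the restriction of w.
  · rw [← hsec _ (hS.restr_mem hL hI (hσmem w)), hrestr, hσproj]
  · rintro τ ⟨hτ, hτ₀⟩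
    refine LinearMap.ext fun w => ?_
    -- Any competing section takes values in the flat part, on which the projection is injective.
    have hmem : τ w ∈ hS.flatPart (LinearMap.range σ₀) :=
      hS.mem_flatPart_of_good hL (R := (LinearMap.range τ).toAddSubgroup) (uGMS_add F) (uGMS_zero F)
        (by rintro _ ⟨w, rfl⟩; exact ⟨_, (hτ₀ w).symm⟩) hτ.s_mem ⟨w, rfl⟩
    rw [← sub_eq_zero]
    exact hdisj _ (sub_mem hmem (hσmem w)) (by
      rw [Submodule.Quotient.mk_sub, hτ.proj, hσproj, sub_self])
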